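/- Let $p>3$ be a prime, $\mathbb F$ a field of characteristic $p$, $m\ge 2$ and $n\ge 4$ integers, and $\underline t=(t_1,\dots,t_{2m})$ a tuple of positive integers. Put $Y_0=\{1,\dots,2m\}$, $Y_1=\{2m+1,\dots,2m+n\}$, $Y=Y_0\cup Y_1$, $\pi_i=p^{t_i}-1$ for $i\in Y_0$, $\pi=(\pi_1,\dots,\pi_{2m})$ and $|\pi|=\sum_i\pi_i$; let $\mu(i)=0$ for $i\in Y_0$ and $\mu(i)=1$ for $i\in Y_1$. Let $\mathcal O(2m,n)$ be the tensor product of the divided power algebra with basis $x^{(\alpha)}$ ($\alpha\in\mathbb Z_{\ge0}^{2m}$, $x^{(\alpha)}x^{(\beta)}=\binom{\alpha+\beta}{\alpha}x^{(\alpha+\beta)}$) and the exterior algebra in $x_{2m+1},\dots,x_{2m+n}$, with basis $x^{(\alpha)}x^u$, $u\subseteq Y_1$ (where $x^u$ is the product of the $x_k$, $k\in u$, in increasing order). Let $\partial_i$ ($i\in Y$) be the partial superderivations: $\partial_i(x^{(\alpha)}x^u)=x^{(\alpha-\varepsilon_i)}x^u$ for $i\in Y_0$ (zero if $\alpha_i=0$)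 and $\partial_i(x^{(\alpha)}x^u)=x^{(\alpha)}\,\partial x^u/\partial x_i$ for $i\in Y_1$. Let $\mathcal O$ be the subalgebra spanned by the $x^{(\alpha)}x^u$ with $\alpha_i\le\pi_i$ for all $i$, graded by $\deg x^{(\alpha)}x^u=|\alpha|+|u|$ and with parity $|u|$ mod $2$. Let $\mathcal W=\bigoplus_k\mathcal W_{[k]}$ be the even part of the generalized Witt superalgebra $W(2m,n;\underline t)=\sum_{i\in Y}\mathcal O\,\partial_i$, i.e. the Lie algebra of operators $\sum_i a_i\partial_i$ with $a_i\in\mathcal O$ of parity $\mu(i)$; $\mathcal W_{[k]}$ consists of those with all $a_i$ of degree $k+1$. For $a\in\mathcal O(2m,n)$ homogeneous of parity $\mathrm p(a)$ put $\mathrm{D_H}(a)=\sum_{i\in Y}\tau(i)(-1)^{\mu(i)\mathrm p(a)}\partial_i(a)\partial_{i'}$, where $i'=i+m,\ \tau(i)=1$ for $i\le m$; $i'=i-m,\ \tau(i)=-1$ for $m<i\le 2m$; $i'=i,\ \tau(i)=1$ for $i\in Y_1$. With $\omega=Y_1$, let $\mathcal H\subset\mathcal W$ be the even part of the Hamiltonian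 superalgebra $H(2m,n;\underline t)$: the Lie subalgebra spanned by the $\mathrm{D_H}(x^{(\alpha)}x^u)$ with $\alpha\le\pi$, $|u|$ even, $(\alpha,u)\ne(\pi,\omega)$, with the induced gradation $\mathcal H_{[k]}=\mathcal H\cap\mathcal W_{[k]}$. A derivation from $\mathcal H$ into $\mathcal W$ is a linear map $D$ with $D([x,y])=[x,D(y)]-[y,D(x)]$; $\mathrm{Der}_{[k]}(\mathcal H,\mathcal W)$ is the space of derivations with $D(\mathcal H_{[i]})\subset\mathcal W_{[k+i]}$ for all $i$, and $\mathrm{Der}^-(\mathcal H,\mathcal W)=\bigoplus_{k\le-1}\mathrm{Der}_{[k]}(\mathcal H,\mathcal W)$. For $v\in\mathcal W$ write $\mathrm{ad}\,v$ for the map $\mathcal H\to\mathcal W$, $x\mapsto[v,x]$, and $(\mathrm{ad}\,\partial_r)^{k}$ for the restriction to $\mathcal H$ of the $k$-th power of $\mathrm{ad}\,\partial_r$ on $\mathcal W$. For $n$ even, $r\in Y_0$ and $s\ge1$ define linear maps $\mathcal H\to\mathcal W$ by $$\Phi_r^{(s)}(\mathrm{D_H}(f))=\partial_r^{p^s}(f)\,\mathrm{D_H}(x^\omega),\qquad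 \Theta_r^{(s)}(\mathrm{D_H}(f))=x^\omega\,(\mathrm{ad}\,\partial_r)^{p^s}(\mathrm{D_H}(f)),$$ and let $\Gamma_1$ be the linear map with $\Gamma_1(\mathrm{D_H}(x^{(\pi)}))=\mathrm{D_H}(x^\omega)$ and $\Gamma_1(\mathrm{D_H}(x^{(\alpha)}x^u))=0$ for all other $(\alpha,u)$. Let $\delta_{|\pi|>n}$ be $1$ if $|\pi|>n$ and $0$ otherwise. If $n$ is even, then $$\mathrm{Der}^-(\mathcal H,\mathcal W)=\mathrm{ad}\,\mathcal W_{[-1]}+\mathbb F\,(\delta_{|\pi|>n}\Gamma_1)+\sum_{r\in Y_0}\ \sum_{\substack{1\le s\le t_r-1\\ n-p^s<0}}\bigl(\mathbb F\,\Phi_r^{(s)}+\mathbb F\,\Theta_r^{(s)}\bigr)+\sum_{r\in Y_0}\ \sum_{1\le s\le t_r-1}\mathbb F\,(\mathrm{ad}\,\partial_r)^{p^s}.$$ If $n$ is odd, then $$\mathrm{Der}^-(\mathcal H,\mathcal W)=\mathrm{ad}\,\mathcal W_{[-1]}+\sum_{r\in Y_0}\ \sum_{1\le s\le t_r-1}\mathbb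 F\,(\mathrm{ad}\,\partial_r)^{p^s}.$$ -/

import Mathlib

noncomputable section

namespace HamSuper

/-- The index set `Y₀` of the `2m` even variables. The left summand stands for `1, …, m` and the
right one for `m + 1, …, 2m`, so that `i ↦ i'` swaps the summands. -/
abbrev EvenIdx (m : ℕ) : Type := Fin m ⊕ Fin m

/-- The index set `Y = Y₀ ∪ Y₁`, with `Y₁` of size `n`. -/
abbrev Idx (m n : ℕ) : Type := EvenIdx m ⊕ Fin n

/-- The index set of the monomial basis: `(α, u)` stands for `x^(α) x^u`. -/
abbrev Mon (m n : ℕ) : Type := (EvenIdx m → ℕ) × Finset (Fin n)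

/-- The algebra `𝒪(2m, n)`: divided powers in `2m` even variables tensored with the exterior
algebra in `n` odd variables, as the vector space with basis the monomials `x^(α) x^u`. -/
def O (F : Type*) [Field F] (m n : ℕ) : Type _ := Mon m n →₀ F

variable {F : Type*} [Field F] {m n : ℕ}

instance : AddCommGroup (O F m n) := inferInstanceAs (AddCommGroup (Mon m n →₀ F))
instance : Module F (O F m n) := inferInstanceAs (Module F (Mon m n →₀ F))

/-- The basis element `x^(α) x^u`. -/
def mono (α : EvenIdx m → ℕ) (u : Finset (Fin n)) : O F m n :=
  (Finsupp.single (α, u) (1 : F) : Mon m n →₀ F)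

/-- Linear extension of a map defined on the basis of monomials. -/
def ofBasis {M : Type*} [AddCommGroup M] [Module F M]
    (f : (EvenIdx m → ℕ) → Finset (Fin n) → M) : O F m n →ₗ[F] M :=
  Finsupp.linearCombination F (fun a : Mon m n => f a.1 a.2)

/-- The coefficient of `x^(α) x^u`. -/
def coeff (α : EvenIdx m → ℕ) (u : Finset (Fin n)) : O F m n →ₗ[F] F :=
  Finsupp.lapply (R := F) (α, u)

@[simp] theorem ofBasis_mono {M : Type*} [AddCommGroup M] [Module F M]
    (f : (EvenIdx m → ℕ) → Finset (Fin n) → M) (α : EvenIdx m → ℕ) (u : Finset (Fin n)) :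
    ofBasis (F := F) f (mono α u) = f α u := by
  exact (Finsupp.linearCombination_single F (1 : F) _).trans (one_smul F _)

theorem O_ext {M : Type*} [AddCommGroup M] [Module F M] {f g : O F m n →ₗ[F] M}
    (h : ∀ α u, f (mono α u) = g (mono α u)) : f = g := by
  refine Finsupp.lhom_ext' fun a => LinearMap.ext_ring ?_
  exact h a.1 a.2

/-- The product of `-1` over all pairs `(k, l)` in `u × v` with `l < k`, so that
`x^u x^v = sgn u v • x^(u ∪ v)` for disjoint `u`, `v`. -/
def sgn (F : Type*) [Field F] {n : ℕ} (u v : Finset (Fin n)) : F :=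
  ∏ k ∈ u, ∏ l ∈ v, if l < k then -1 else 1

/-- The multi-index binomial coefficient `binom (α + β) α`. -/
def multiBinom {m : ℕ} (α β : EvenIdx m → ℕ) : ℕ := ∏ i, (α i + β i).choose (α i)

/-- The product of `𝒪(2m, n)`:
`x^(α) x^u * x^(β) x^v = binom (α + β) α * sgn u v * x^(α + β) x^(u ∪ v)` if `u`, `v` are disjoint,
and `0` otherwise. -/
def mulO : O F m n →ₗ[F] O F m n →ₗ[F] O F m n :=
  ofBasis fun α u => ofBasis fun β v =>
    if Disjoint u v then ((multiBinom α β : F) * sgn F u v) • mono (α + β) (u ∪ v) else 0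

instance : Mul (O F m n) := ⟨fun f g => mulO f g⟩
instance : One (O F m n) := ⟨mono 0 ∅⟩

theorem mul_def (f g : O F m n) : f * g = mulO f g := rfl
theorem one_def : (1 : O F m n) = mono 0 ∅ := rfl

theorem mono_mul_mono (α β : EvenIdx m → ℕ) (u v : Finset (Fin n)) :
    (mono α u * mono β v : O F m n) =
      if Disjoint u v then ((multiBinom α β : F) * sgn F u v) • mono (α + β) (u ∪ v) else 0 := by
  simp [mul_def, mulO]

theorem sgn_union_left {u v w : Finset (Fin n)} (h : Disjoint u v) :
    sgn F (u ∪ v) w = sgn F u w * sgn F v w := by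
  simp [sgn, Finset.prod_union h]

theorem sgn_union_right {u v w : Finset (Fin n)} (h : Disjoint v w) :
    sgn F u (v ∪ w) = sgn F u v * sgn F u w := by
  simp [sgn, Finset.prod_union h, Finset.prod_mul_distrib]

theorem sgn_empty_left (u : Finset (Fin n)) : sgn F ∅ u = 1 := by simp [sgn]
theorem sgn_empty_right (u : Finset (Fin n)) : sgn F u ∅ = 1 := by simp [sgn]

theorem multiBinom_assoc (α β γ : EvenIdx m → ℕ) :
    multiBinom α β * multiBinom (α + β) γ = multiBinom β γ * multiBinom α (β + γ) := by
  simp only [multiBinom, ← Finset.prod_mul_distrib]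
  refine Finset.prod_congr rfl fun i _ => ?_
  have h := Nat.choose_mul (n := α i + β i + γ i) (k := α i + β i) (s := α i) (by omega)
  have e1 : α i + β i + γ i - α i = β i + γ i := by omega
  have e2 : α i + β i - α i = β i := by omega
  rw [e1, e2] at h
  simp only [Pi.add_apply]
  rw [mul_comm, h, mul_comm, add_assoc]

theorem multiBinom_zero_left (α : EvenIdx m → ℕ) : multiBinom 0 α = 1 := by simp [multiBinom]
theorem multiBinom_zero_right (α : EvenIdx m → ℕ) : multiBinom α 0 = 1 := by simp [multiBinom]

theorem multiBinom_comm (α β : EvenIdx m → ℕ) : multiBinom α β = multiBinom β α := by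
  refine Finset.prod_congr rfl fun i _ => ?_
  rw [Nat.choose_symm_add, add_comm]

@[elab_as_elim]
theorem O_ind {P : O F m n → Prop} (f : O F m n) (zero : P 0) (basis : ∀ α u, P (mono α u))
    (add : ∀ f g, P f → P g → P (f + g)) (smul : ∀ (c : F) f, P f → P (c • f)) : P f := by
  refine Finsupp.induction_linear (motive := P) f zero add fun a c => ?_
  have : (Finsupp.single a c : Mon m n →₀ F) = (c • mono a.1 a.2 : O F m n) :=
    (Finsupp.smul_single_one a c).symm
  rw [this]
  exact smul _ _ (basis _ _)

theorem mulO_assoc (f g h : O F m n) : f * g * h = f * (g * h) := by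
  simp only [mul_def]
  refine O_ind f (by simp) (fun α u => ?_) (fun a b ha hb => by simp [ha, hb])
    (fun c a ha => by simp [ha])
  refine O_ind g (by simp) (fun β v => ?_) (fun a b ha hb => by simp [ha, hb])
    (fun c a ha => by simp [ha])
  refine O_ind h (by simp) (fun γ w => ?_) (fun a b ha hb => by simp [ha, hb])
    (fun c a ha => by simp [ha])
  simp only [← mul_def, mono_mul_mono]
  by_cases huv : Disjoint u v
  · by_cases hvw : Disjoint v w
    · by_cases huw : Disjoint u w
      · have h1 : Disjoint (u ∪ v) w := Finset.disjoint_union_left.2 ⟨huw, hvw⟩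
        have h2 : Disjoint u (v ∪ w) := Finset.disjoint_union_right.2 ⟨huv, huw⟩
        rw [if_pos huv, if_pos hvw]
        simp only [mul_def, map_smul, LinearMap.smul_apply]
        simp only [← mul_def, mono_mul_mono, if_pos h1, if_pos h2, smul_smul, add_assoc,
          Finset.union_assoc, sgn_union_left huv, sgn_union_right hvw]
        congr 1
        have := congrArg (Nat.cast : ℕ → F) (multiBinom_assoc α β γ)
        push_cast at this
        linear_combination (sgn F u v * sgn F u w * sgn F v w) * this
      · have h1 : ¬ Disjoint (u ∪ v) w := fun h => huw (Finset.disjoint_union_left.1 h).1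
        have h2 : ¬ Disjoint u (v ∪ w) := fun h => huw (Finset.disjoint_union_right.1 h).2
        rw [if_pos huv, if_pos hvw]
        simp only [mul_def, map_smul, LinearMap.smul_apply]
        simp only [← mul_def, mono_mul_mono, if_neg h1, if_neg h2, smul_zero]
    · have h1 : ¬ Disjoint (u ∪ v) w := fun h => hvw (Finset.disjoint_union_left.1 h).2
      rw [if_pos huv, if_neg hvw]
      simp only [mul_def, map_smul, LinearMap.smul_apply]
      simp only [← mul_def, mono_mul_mono, if_neg h1]
      simp [mul_def]
  · rw [if_neg huv]
    split_ifs with hvw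
    · have h2 : ¬ Disjoint u (v ∪ w) := fun h => huv (Finset.disjoint_union_right.1 h).1
      simp only [mul_def, map_smul]
      simp only [← mul_def, mono_mul_mono, if_neg h2]
      simp [mul_def]
    · simp [mul_def]

theorem one_mulO (f : O F m n) : 1 * f = f := by
  rw [mul_def, one_def]
  refine O_ind f (by simp) (fun α u => ?_) (fun a b ha hb => by simp [ha, hb])
    (fun c a ha => by simp [ha])
  rw [← mul_def, mono_mul_mono]
  simp [multiBinom_zero_left, sgn_empty_left]

theorem mulO_one (f : O F m n) : f * 1 = f := by
  rw [mul_def, one_def]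
  refine O_ind f (by simp) (fun α u => ?_) (fun a b ha hb => by simp [ha, hb])
    (fun c a ha => by simp [ha])
  rw [← mul_def, mono_mul_mono]
  simp [multiBinom_zero_right, sgn_empty_right]

instance : Ring (O F m n) :=
  { (inferInstance : AddCommGroup (O F m n)) with
    mul := (· * ·)
    one := 1
    mul_assoc := mulO_assoc
    one_mul := one_mulO
    mul_one := mulO_one
    left_distrib := fun a b c => by simp [mul_def]
    right_distrib := fun a b c => by simp [mul_def]
    zero_mul := fun a => by simp [mul_def]
    mul_zero := fun a => by simp [mul_def] }

instance : Algebra F (O F m n) :=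
  Algebra.ofModule (fun c f g => by simp [mul_def]) (fun c f g => by simp [mul_def])

/-- The parity involution `x^(α) x^u ↦ (-1)^|u| x^(α) x^u`. -/
def parityInv : O F m n →ₗ[F] O F m n := ofBasis fun α u => ((-1 : F) ^ u.card) • mono α u

/-- `∂_i` for `i ∈ Y₀`: `x^(α) x^u ↦ x^(α - ε_i) x^u`, read as `0` if `α_i = 0`. -/
def dEven (i : EvenIdx m) : O F m n →ₗ[F] O F m n :=
  ofBasis fun α u => if α i = 0 then 0 else mono (α - Pi.single i 1) u

/-- `∂_k` for `k ∈ Y₁`: the left superderivative `∂ x^u / ∂ x_k`; the sign `sgn {k} u` is `-1` to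
the number of `l ∈ u` with `l < k`. -/
def dOdd (k : Fin n) : O F m n →ₗ[F] O F m n :=
  ofBasis fun α u => if k ∈ u then sgn F {k} u • mono α (u.erase k) else 0

theorem parityInv_mul (f g : O F m n) : parityInv (f * g) = parityInv f * parityInv g := by
  refine O_ind f (by simp) (fun α u => ?_) (fun a b ha hb => by simp [ha, hb, add_mul])
    (fun c a ha => by simp [ha])
  refine O_ind g (by simp) (fun β v => ?_) (fun a b ha hb => by simp [ha, hb, mul_add])
    (fun c a ha => by simp [ha])
  simp only [parityInv, ofBasis_mono, mono_mul_mono, smul_mul_assoc, mul_smul_comm]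
  split_ifs with h
  · simp only [map_smul, ofBasis_mono, smul_smul, Finset.card_union_of_disjoint h, pow_add]
    congr 1; ring
  · simp

theorem parityInv_parityInv (f : O F m n) : parityInv (parityInv f) = f := by
  refine O_ind f (by simp) (fun α u => ?_) (fun a b ha hb => by simp [ha, hb])
    (fun c a ha => by simp [ha])
  simp [parityInv, smul_smul, ← mul_pow]

theorem parityInv_dEven (i : EvenIdx m) (f : O F m n) : parityInv (dEven i f) = dEven i (parityInv f) := by
  refine O_ind f (by simp) (fun α u => ?_) (fun a b ha hb => by simp [ha, hb])
    (fun c a ha => by simp [ha])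
  simp only [parityInv, dEven, ofBasis_mono, map_smul]
  split_ifs <;> simp

theorem parityInv_dOdd (k : Fin n) (f : O F m n) : parityInv (dOdd k f) = - dOdd k (parityInv f) := by
  refine O_ind f (by simp) (fun α u => ?_) (fun a b ha hb => by simp [ha, hb]; abel)
    (fun c a ha => by simp [ha])
  simp only [parityInv, dOdd, ofBasis_mono, map_smul]
  split_ifs with h
  · have : u.card = (u.erase k).card + 1 := (Finset.card_erase_add_one h).symm
    simp only [map_smul, ofBasis_mono, smul_smul, this, pow_succ, ← neg_smul]
    congr 1; ring
  · simp

theorem sgn_mul_comm {u v : Finset (Fin n)} (h : Disjoint u v) :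
    sgn F u v * sgn F v u = (-1) ^ (u.card * v.card) := by
  have : sgn F v u = ∏ k ∈ u, ∏ l ∈ v, if k < l then (-1 : F) else 1 := by
    rw [sgn, Finset.prod_comm]
  rw [this, sgn, ← Finset.prod_mul_distrib, mul_comm, pow_mul, ← Finset.prod_const]
  refine Finset.prod_congr rfl fun k hk => ?_
  rw [← Finset.prod_mul_distrib, ← Finset.prod_const]
  refine Finset.prod_congr rfl fun l hl => ?_
  have hne : k ≠ l := fun e => Finset.disjoint_left.1 h hk (e ▸ hl)
  rcases lt_or_gt_of_ne hne with h1 | h1 <;> simp [h1, h1.not_gt]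

theorem sgn_sq (u v : Finset (Fin n)) : sgn F u v * sgn F u v = 1 := by
  simp only [sgn, ← Finset.prod_mul_distrib]
  refine Finset.prod_eq_one fun k _ => Finset.prod_eq_one fun l _ => ?_
  split_ifs <;> simp

theorem multiBinom_split (i : EvenIdx m) (α β : EvenIdx m → ℕ) :
    multiBinom α β = (α i + β i).choose (α i) *
      ∏ j ∈ Finset.univ.erase i, (α j + β j).choose (α j) :=
  (Finset.mul_prod_erase _ _ (Finset.mem_univ i)).symm

theorem multiBinom_pascal (i : EvenIdx m) (α β : EvenIdx m → ℕ) (h : α i + β i ≠ 0) :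
    multiBinom α β =
      (if α i = 0 then 0 else multiBinom (α - Pi.single i 1) β) +
      (if β i = 0 then 0 else multiBinom α (β - Pi.single i 1)) := by
  have e1 : ∏ j ∈ Finset.univ.erase i, ((α - Pi.single i 1 : EvenIdx m → ℕ) j + β j).choose ((α - Pi.single i 1 : EvenIdx m → ℕ) j)
      = ∏ j ∈ Finset.univ.erase i, (α j + β j).choose (α j) :=
    Finset.prod_congr rfl fun j hj => by
      simp [Pi.single_eq_of_ne (Finset.ne_of_mem_erase hj)]
  have e2 : ∏ j ∈ Finset.univ.erase i, (α j + (β - Pi.single i 1 : EvenIdx m → ℕ) j).choose (α j)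
      = ∏ j ∈ Finset.univ.erase i, (α j + β j).choose (α j) :=
    Finset.prod_congr rfl fun j hj => by
      simp [Pi.single_eq_of_ne (Finset.ne_of_mem_erase hj)]
  rw [multiBinom_split i α β, multiBinom_split i _ β, multiBinom_split i α (β - _), e1, e2]
  simp only [Pi.sub_apply, Pi.single_eq_same]
  rcases ha : α i with _ | a
  · rcases hb : β i with _ | b
    · omega
    · simp
  · rcases hb : β i with _ | b
    · simp
    · have : a + 1 + (b + 1) = (a + b + 1) + 1 := by omega
      simp only [this, Nat.add_sub_cancel, Nat.succ_ne_zero, if_false]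
      rw [Nat.choose_succ_succ, add_mul]
      congr 2 <;> congr 1 <;> omega

theorem dEven_mul (i : EvenIdx m) (f g : O F m n) :
    dEven i (f * g) = dEven i f * g + f * dEven i g := by
  refine O_ind f (by simp) (fun α u => ?_)
    (fun a b ha hb => by simp only [add_mul, map_add, ha, hb]; abel)
    (fun c a ha => by simp [ha])
  refine O_ind g (by simp) (fun β v => ?_)
    (fun a b ha hb => by simp only [mul_add, map_add, ha, hb]; abel)
    (fun c a ha => by simp [ha])
  simp only [mono_mul_mono, dEven, ofBasis_mono]
  by_cases huv : Disjoint u v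
  · rw [if_pos huv]
    simp only [map_smul, ofBasis_mono, Pi.add_apply, Nat.add_eq_zero_iff]
    have e1 : α i ≠ 0 → α - Pi.single i 1 + β = α + β - Pi.single i 1 := fun h => by
      ext j
      rcases eq_or_ne j i with rfl | hj
      · simp; omega
      · simp [Pi.single_eq_of_ne hj]
    have e2 : β i ≠ 0 → α + (β - Pi.single i 1) = α + β - Pi.single i 1 := fun h => by
      ext j
      rcases eq_or_ne j i with rfl | hj
      · simp; omega
      · simp [Pi.single_eq_of_ne hj]
    by_cases ha : α i = 0
    · by_cases hb : β i = 0
      · simp [ha, hb]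
      · have := multiBinom_pascal i α β (by omega)
        rw [if_pos ha, if_neg hb, zero_add] at this
        simp [ha, hb, mono_mul_mono, huv, e2 hb, this]
    · by_cases hb : β i = 0
      · have := multiBinom_pascal i α β (by omega)
        rw [if_pos hb, if_neg ha, add_zero] at this
        simp [ha, hb, mono_mul_mono, huv, e1 ha, this]
      · have := multiBinom_pascal i α β (by omega)
        rw [if_neg hb, if_neg ha] at this
        simp only [ha, hb, mono_mul_mono, if_pos huv, e1 ha, e2 hb, this, false_and, if_false,
          ← add_smul]
        congr 1
        push_cast
        ring
  · rw [if_neg huv]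
    split_ifs <;> simp [mono_mul_mono, huv]

theorem sgn_singleton_self (k : Fin n) : sgn F {k} {k} = 1 := by simp [sgn]

theorem sgn_erase_left {k : Fin n} {u : Finset (Fin n)} (hk : k ∈ u) (v : Finset (Fin n)) :
    sgn F u v = sgn F {k} v * sgn F (u.erase k) v := by
  rw [← sgn_union_left (Finset.disjoint_singleton_left.2 (Finset.notMem_erase k u)),
    ← Finset.insert_eq, Finset.insert_erase hk]

theorem sgn_erase_right {k : Fin n} {v : Finset (Fin n)} (hk : k ∈ v) (u : Finset (Fin n)) :
    sgn F u v = sgn F u {k} * sgn F u (v.erase k) := by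
  rw [← sgn_union_right (Finset.disjoint_singleton_left.2 (Finset.notMem_erase k v)),
    ← Finset.insert_eq, Finset.insert_erase hk]

theorem sgn_singleton_comm {k : Fin n} {u : Finset (Fin n)} (hk : k ∉ u) :
    sgn F u {k} = (-1) ^ u.card * sgn F {k} u := by
  have h := sgn_mul_comm (F := F) (Finset.disjoint_singleton_right.2 hk)
  rw [Finset.card_singleton, mul_one] at h
  rw [← h, mul_assoc, sgn_sq, mul_one]

theorem dOdd_mul (k : Fin n) (f g : O F m n) :
    dOdd k (f * g) = dOdd k f * g + parityInv f * dOdd k g := by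
  refine O_ind f (by simp) (fun α u => ?_)
    (fun a b ha hb => by simp only [add_mul, map_add, ha, hb]; abel)
    (fun c a ha => by simp [ha])
  refine O_ind g (by simp) (fun β v => ?_)
    (fun a b ha hb => by simp only [mul_add, map_add, ha, hb]; abel)
    (fun c a ha => by simp [ha])
  simp only [mono_mul_mono, dOdd, parityInv, ofBasis_mono]
  by_cases hu : k ∈ u
  · by_cases hv : k ∈ v
    · have huv : ¬ Disjoint u v := fun h => Finset.disjoint_left.1 h hu hv
      rw [if_neg huv, if_pos hu, if_pos hv]
      simp only [map_zero, smul_mul_assoc, mul_smul_comm, mono_mul_mono]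
      by_cases h : Disjoint (u.erase k) v
      · have h' : Disjoint u (v.erase k) := by
          rw [Finset.disjoint_left] at h ⊢
          intro x hx hxv
          exact h (Finset.mem_erase.2 ⟨(Finset.mem_erase.1 hxv).1, hx⟩) (Finset.mem_erase.1 hxv).2
        have hun : u.erase k ∪ v = u ∪ v.erase k := by
          ext x; simp only [Finset.mem_union, Finset.mem_erase]
          by_cases hx : x = k
          · subst hx; simp [hu, hv]
          · simp [hx]
        have hc : u.card = (u.erase k).card + 1 := (Finset.card_erase_add_one hu).symm
        rw [if_pos h, if_pos h', hun, smul_smul, smul_smul, smul_smul, ← add_smul]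
        have h1 := sgn_erase_right (F := F) hu {k}
        have h2 := sgn_erase_right (F := F) hv {k}
        have h3 := sgn_erase_right (F := F) hv (u.erase k)
        have h4 := sgn_erase_left (F := F) hu (v.erase k)
        have h5 := sgn_singleton_comm (F := F) (Finset.notMem_erase k u)
        have h6 := sgn_sq (F := F) {k} (u.erase k)
        have h7 := sgn_sq (F := F) {k} (v.erase k)
        have h8 : ((-1 : F) ^ (u.erase k).card) * (-1 : F) ^ (u.erase k).card = 1 := by
          rw [← mul_pow]; simp
        rw [sgn_singleton_self, one_mul] at h1 h2
        rw [h1, h2, h3, h4, h5, hc, pow_succ]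
        symm
        convert zero_smul F _
        linear_combination ((-1) ^ (u.erase k).card * (multiBinom α β : F) *
          sgn F (u.erase k) (v.erase k)) * (h6 - h7)
      · have h' : ¬ Disjoint u (v.erase k) := fun h' => h (by
          rw [Finset.disjoint_left] at h' ⊢
          intro x hx hxv
          exact h' (Finset.mem_erase.1 hx).2 (Finset.mem_erase.2 ⟨(Finset.mem_erase.1 hx).1, hxv⟩))
        simp [h, h']
    · rw [if_pos hu, if_neg hv, mul_zero, add_zero, smul_mul_assoc, mono_mul_mono]
      have hd : Disjoint (u.erase k) v ↔ Disjoint u v := by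
        simp only [Finset.disjoint_left, Finset.mem_erase]
        refine ⟨fun h x hx hxv => h ⟨?_, hx⟩ hxv, fun h x hx => h hx.2⟩
        rintro rfl; exact hv hxv
      by_cases huv : Disjoint u v
      · rw [if_pos huv, if_pos (hd.2 huv), map_smul, ofBasis_mono,
          if_pos (Finset.mem_union_left _ hu), smul_smul, smul_smul,
          sgn_union_right huv, Finset.erase_union_distrib, Finset.erase_eq_of_notMem hv,
          sgn_erase_left hu v]
        congr 1
        linear_combination ((multiBinom α β : F) * sgn F (u.erase k) v * sgn F {k} u) *
          sgn_sq (F := F) {k} v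
      · rw [if_neg huv, if_neg (fun h => huv (hd.1 h)), map_zero, smul_zero]
  · by_cases hv : k ∈ v
    · rw [if_neg hu, if_pos hv, zero_mul, zero_add, smul_mul_assoc, mul_smul_comm, mono_mul_mono]
      have hd : Disjoint u (v.erase k) ↔ Disjoint u v := by
        simp only [Finset.disjoint_left, Finset.mem_erase]
        refine ⟨fun h x hx hxv => h hx ⟨?_, hxv⟩, fun h x hx hxv => h hx hxv.2⟩
        rintro rfl; exact hu hx
      by_cases huv : Disjoint u v
      · rw [if_pos huv, if_pos (hd.2 huv), map_smul, ofBasis_mono,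
          if_pos (Finset.mem_union_right _ hv), smul_smul, smul_smul, smul_smul,
          sgn_union_right huv, Finset.erase_union_distrib, Finset.erase_eq_of_notMem hu,
          sgn_erase_right hv u, sgn_singleton_comm hu]
        congr 1
        linear_combination ((multiBinom α β : F) * sgn F u (v.erase k) * sgn F {k} v *
          (-1) ^ u.card) * sgn_sq (F := F) {k} u
      · rw [if_neg huv, if_neg (fun h => huv (hd.1 h)), map_zero, smul_zero, smul_zero]
    · rw [if_neg hu, if_neg hv]
      split_ifs <;> simp [hu, hv]

theorem dEven_comm (i j : EvenIdx m) (f : O F m n) :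
    dEven i (dEven j f) = dEven j (dEven i f) := by
  refine O_ind f (by simp) (fun α u => ?_) (fun a b ha hb => by simp [ha, hb])
    (fun c a ha => by simp [ha])
  rcases eq_or_ne i j with rfl | hij
  · rfl
  · simp only [dEven, ofBasis_mono]
    by_cases hi : α i = 0 <;> by_cases hj : α j = 0 <;>
      simp [hi, hj, Pi.single_eq_of_ne hij, Pi.single_eq_of_ne hij.symm, tsub_right_comm]

theorem dEven_dOdd_comm (i : EvenIdx m) (k : Fin n) (f : O F m n) :
    dEven i (dOdd k f) = dOdd k (dEven i f) := by
  refine O_ind f (by simp) (fun α u => ?_) (fun a b ha hb => by simp [ha, hb])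
    (fun c a ha => by simp [ha])
  simp only [dEven, dOdd, ofBasis_mono]
  by_cases hi : α i = 0 <;> by_cases hk : k ∈ u <;> simp [hi, hk]

theorem dOdd_anticomm (k l : Fin n) (f : O F m n) :
    dOdd k (dOdd l f) = - dOdd l (dOdd k f) := by
  refine O_ind f (by simp) (fun α u => ?_)
    (fun a b ha hb => by simp only [map_add, ha, hb]; abel)
    (fun c a ha => by simp [ha])
  simp only [dOdd, ofBasis_mono]
  rcases eq_or_ne k l with rfl | hkl
  · by_cases hk : k ∈ u <;> simp [hk]
  · by_cases hk : k ∈ u <;> by_cases hl : l ∈ u <;> simp [hk, hl, hkl, hkl.symm]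
    rw [smul_smul, smul_smul, ← neg_smul, Finset.erase_right_comm]
    congr 1
    rw [sgn_erase_right hk {l}, sgn_erase_right hl {k}]
    have h := sgn_singleton_comm (F := F) (k := l) (u := {k}) (by simpa using hkl.symm)
    rw [h, Finset.card_singleton]
    ring

/-- The span of the monomials `x^(α) x^u` with `(α, u) ∈ S`. -/
def monoSpan (F : Type*) [Field F] {m n : ℕ} (S : Set (Mon m n)) : Submodule F (O F m n) :=
  Submodule.span F ((fun a : Mon m n => mono a.1 a.2) '' S)

theorem mem_monoSpan {S : Set (Mon m n)} {f : O F m n} :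
    f ∈ monoSpan F S ↔ ∀ α u, (α, u) ∉ S → coeff α u f = 0 := by
  have : monoSpan F S = (Finsupp.supported F F S : Submodule F (Mon m n →₀ F)) :=
    (Finsupp.supported_eq_span_single F S).symm
  rw [this]
  refine (Finsupp.mem_supported' F f).trans ?_
  exact ⟨fun h α u ha => h _ ha, fun h a ha => h a.1 a.2 ha⟩

theorem mono_mem {S : Set (Mon m n)} {α : EvenIdx m → ℕ} {u : Finset (Fin n)} (h : (α, u) ∈ S) :
    (mono α u : O F m n) ∈ monoSpan F S :=
  Submodule.subset_span ⟨_, h, rfl⟩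

theorem monoSpan_mono {S T : Set (Mon m n)} (h : S ⊆ T) : monoSpan F S ≤ monoSpan F T :=
  Submodule.span_mono (Set.image_mono h)

@[elab_as_elim]
theorem monoSpan_ind {S : Set (Mon m n)} {P : O F m n → Prop} {f : O F m n}
    (hf : f ∈ monoSpan F S) (zero : P 0) (basis : ∀ α u, (α, u) ∈ S → P (mono α u))
    (add : ∀ f g, P f → P g → P (f + g)) (smul : ∀ (c : F) f, P f → P (c • f)) : P f := by
  refine Submodule.span_induction (p := fun f _ => P f) ?_ zero (fun f g _ _ => add f g)
    (fun c f _ => smul c f) hf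
  rintro _ ⟨a, ha, rfl⟩
  exact basis _ _ ha

theorem dOdd_sq (k : Fin n) (f : O F m n) : dOdd k (dOdd k f) = 0 := by
  refine O_ind f (by simp) (fun α u => ?_) (fun a b ha hb => by simp [ha, hb])
    (fun c a ha => by simp [ha])
  simp only [dOdd, ofBasis_mono]
  by_cases hk : k ∈ u <;> simp [hk]

/-- `∂_i` for all `i ∈ Y`. -/
def d : Idx m n → O F m n →ₗ[F] O F m n := Sum.elim dEven dOdd

/-- The parity `μ(i)` of `∂_i`. -/
def mu : Idx m n → ZMod 2 := Sum.elim (fun _ => 0) (fun _ => 1)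

/-- The involution `i ↦ i'`. -/
def prime : Idx m n → Idx m n := Sum.map Sum.swap id

/-- The sign `τ(i)`. -/
def tau (F : Type*) [Field F] {m n : ℕ} : Idx m n → F :=
  Sum.elim (Sum.elim (fun _ => 1) (fun _ => -1)) (fun _ => 1)

/-- The operator `a ∂_i : f ↦ a * ∂_i f` on `𝒪(2m, n)`, as a linear function of `a`. -/
def vf (i : Idx m n) : O F m n →ₗ[F] Module.End F (O F m n) :=
  LinearMap.mulRight F (d i : Module.End F (O F m n)) ∘ₗ (Algebra.lmul F (O F m n)).toLinearMap

/-- `a ↦ (-1)^(μ(i) p(a)) a`. -/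
def twist : Idx m n → O F m n →ₗ[F] O F m n :=
  Sum.elim (fun _ => LinearMap.id) (fun _ => parityInv)

/-- `D_H(a) = ∑ i, τ(i) (-1)^(μ(i) p(a)) ∂_i(a) ∂_{i'}`. -/
def DH : O F m n →ₗ[F] Module.End F (O F m n) :=
  ∑ i : Idx m n, tau F i • (vf (prime i) ∘ₗ d i ∘ₗ twist i)

theorem vf_apply (i : Idx m n) (a f : O F m n) : vf i a f = a * d i f := rfl

theorem DH_apply (a f : O F m n) :
    DH a f = ∑ i : Idx m n, tau F i • (d i (twist i a) * d (prime i) f) := by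
  simp [DH, LinearMap.sum_apply, vf_apply]

/-- The part of `O` of parity `θ`. -/
def par (F : Type*) [Field F] (m n : ℕ) (θ : ZMod 2) : Submodule F (O F m n) :=
  monoSpan F {a | (a.2.card : ZMod 2) = θ}

theorem neg_one_pow_of_even {k : ℕ} (h : (k : ZMod 2) = 0) : (-1 : F) ^ k = 1 :=
  (ZMod.natCast_eq_zero_iff_even.1 h).neg_one_pow

theorem neg_one_pow_of_odd {k : ℕ} (h : (k : ZMod 2) = 1) : (-1 : F) ^ k = -1 :=
  (ZMod.natCast_eq_one_iff_odd.1 h).neg_one_pow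

theorem parityInv_of_even {a : O F m n} (ha : a ∈ par F m n 0) : parityInv a = a := by
  refine monoSpan_ind ha (by simp) (fun α u h => ?_) (fun a b ha hb => by simp [ha, hb])
    (fun c a ha => by simp [ha])
  rw [parityInv, ofBasis_mono, neg_one_pow_of_even h, one_smul]

theorem parityInv_of_odd {a : O F m n} (ha : a ∈ par F m n 1) : parityInv a = -a := by
  refine monoSpan_ind ha (by simp) (fun α u h => ?_) (fun a b ha hb => by simp [ha, hb]; abel)
    (fun c a ha => by simp [ha])
  rw [parityInv, ofBasis_mono, neg_one_pow_of_odd h, neg_one_smul]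

theorem mono_mul_comm (α β : EvenIdx m → ℕ) (u v : Finset (Fin n)) :
    (mono α u * mono β v : O F m n) = (-1 : F) ^ (u.card * v.card) • (mono β v * mono α u) := by
  rw [mono_mul_mono, mono_mul_mono]
  by_cases h : Disjoint u v
  · rw [if_pos h, if_pos h.symm, smul_smul, ← sgn_mul_comm h, multiBinom_comm, add_comm,
      Finset.union_comm]
    congr 1
    linear_combination (-(multiBinom β α : F) * sgn F u v) * sgn_sq (F := F) v u
  · rw [if_neg h, if_neg (fun h' => h h'.symm), smul_zero]

theorem mul_comm_of_even {a : O F m n} (ha : a ∈ par F m n 0) (f : O F m n) : a * f = f * a := by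
  refine monoSpan_ind ha (by simp) (fun α u h => ?_)
    (fun a b ha hb => by simp [ha, hb, add_mul, mul_add]) (fun c a ha => by simp [ha])
  refine O_ind f (by simp) (fun β v => ?_) (fun a b ha hb => by simp [ha, hb, add_mul, mul_add])
    (fun c a ha => by simp [ha])
  rw [mono_mul_comm, pow_mul, neg_one_pow_of_even h, one_pow, one_smul]

theorem mul_comm_of_odd {a : O F m n} (ha : a ∈ par F m n 1) (f : O F m n) :
    a * parityInv f = f * a := by
  refine monoSpan_ind ha (by simp) (fun α u h => ?_)
    (fun a b ha hb => by simp [ha, hb, add_mul, mul_add]) (fun c a ha => by simp [ha])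
  refine O_ind f (by simp) (fun β v => ?_) (fun a b ha hb => by simp [ha, hb, add_mul, mul_add])
    (fun c a ha => by simp [ha])
  rw [parityInv, ofBasis_mono, mul_smul_comm, mono_mul_comm, pow_mul, neg_one_pow_of_odd h, smul_smul,
    ← mul_pow]
  simp

/-- Even vector fields are derivations of `O`. -/
theorem vf_mul {i : Idx m n} {a : O F m n} (ha : a ∈ par F m n (mu i)) (f g : O F m n) :
    vf i a (f * g) = vf i a f * g + f * vf i a g := by
  rcases i with i | k
  · simp only [vf_apply, d, Sum.elim_inl, dEven_mul, mul_add]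
    rw [← mul_assoc, ← mul_assoc, ← mul_assoc, mul_comm_of_even ha f]
  · simp only [vf_apply, d, Sum.elim_inr, dOdd_mul, mul_add]
    rw [← mul_assoc, ← mul_assoc, ← mul_assoc, mul_comm_of_odd ha f]

theorem vf_lie {i j : Idx m n} {a b : O F m n} (ha : a ∈ par F m n (mu i))
    (hb : b ∈ par F m n (mu j)) :
    ⁅vf i a, vf j b⁆ = vf j (vf i a b) - vf i (vf j b a) := by
  ext f : 1
  rw [Ring.lie_def]
  simp only [LinearMap.sub_apply, Module.End.mul_apply]
  have e1 : vf i a (vf j b f) = vf i a b * d j f + b * vf i a (d j f) := by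
    rw [vf_apply j b f, vf_mul ha]
  have e2 : vf j b (vf i a f) = vf j b a * d i f + a * vf j b (d i f) := by
    rw [vf_apply i a f, vf_mul hb]
  have e3 : b * vf i a (d j f) = a * vf j b (d i f) := by
    simp only [vf_apply, ← mul_assoc]
    rcases i with i | k <;> rcases j with j | l
    · simp only [d, Sum.elim_inl, dEven_comm i j, mul_comm_of_even ha b]
    · simp only [d, Sum.elim_inl, Sum.elim_inr, dEven_dOdd_comm, mul_comm_of_even ha b]
    · simp only [d, Sum.elim_inl, Sum.elim_inr, dEven_dOdd_comm, mul_comm_of_even hb a]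
    · have := mul_comm_of_odd ha b
      rw [parityInv_of_odd hb] at this
      simp only [d, Sum.elim_inr, ← this, dOdd_anticomm k l, mul_neg, neg_mul, neg_neg]
  rw [e1, e2, e3, vf_apply j _ f, vf_apply i _ f]
  abel

section Truncated

variable (F) (p : ℕ) (t : EvenIdx m → ℕ) (n)

/-- The multi-index `π`, `π_i = p ^ t_i - 1`. -/
def topExp : EvenIdx m → ℕ := fun i => p ^ t i - 1

/-- The part of parity `θ` of `𝒪(2m, n; t)`: the span of the `x^(α) x^u` with `α ≤ π` and
`|u| ≡ θ` mod 2. -/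
def Otr (θ : ZMod 2) : Submodule F (O F m n) :=
  monoSpan F {a | a.1 ≤ topExp p t ∧ (a.2.card : ZMod 2) = θ}

variable {F p t n}

theorem Otr_le_par (θ : ZMod 2) : Otr F n p t θ ≤ par F m n θ :=
  monoSpan_mono fun _ h => h.2

theorem d_mem {i : Idx m n} {θ : ZMod 2} {f : O F m n} (hf : f ∈ Otr F n p t θ) :
    d i f ∈ Otr F n p t (θ + mu i) := by
  refine monoSpan_ind hf (by simp) (fun α u h => ?_)
    (fun a b ha hb => by simpa using add_mem ha hb)
    (fun c a ha => by simpa using Submodule.smul_mem _ c ha)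
  rcases i with i | k
  · simp only [d, mu, Sum.elim_inl, dEven, ofBasis_mono, add_zero]
    split_ifs
    · exact zero_mem _
    · exact mono_mem ⟨le_trans tsub_le_self h.1, h.2⟩
  · simp only [d, mu, Sum.elim_inr, dOdd, ofBasis_mono]
    split_ifs with hk
    · refine Submodule.smul_mem _ _ (mono_mem ⟨h.1, ?_⟩)
      have := congrArg (Nat.cast : ℕ → ZMod 2) (Finset.card_erase_add_one hk)
      push_cast at this
      rw [h.2] at this
      show ((u.erase k).card : ZMod 2) = θ + 1
      rw [← this, add_assoc]
      have : (1 + 1 : ZMod 2) = 0 := by decide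
      rw [this, add_zero]
    · exact zero_mem _

theorem choose_dvd (hp : p.Prime) {a b s : ℕ} (ha : a ≤ p ^ s - 1) (hb : b ≤ p ^ s - 1)
    (h : p ^ s - 1 < a + b) : p ∣ (a + b).choose a := by
  have hs : 0 < p ^ s := pow_pos hp.pos s
  have hs0 : s ≠ 0 := by rintro rfl; simp at *; omega
  have hf := Nat.factorization_choose' (p := p) (n := b) (k := a)
    (b := Nat.log p (b + a) + s + 1) hp (by omega)
  rw [add_comm a b]
  refine Nat.dvd_of_factorization_pos ?_
  rw [hf]
  refine (Finset.card_pos.2 ⟨s, ?_⟩).ne'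
  simp only [Finset.mem_filter, Finset.mem_Ico]
  refine ⟨by omega, ?_⟩
  rw [Nat.mod_eq_of_lt (by omega), Nat.mod_eq_of_lt (by omega)]
  omega

theorem mul_mem_Otr [Fact p.Prime] [CharP F p] {θ η : ZMod 2} {f g : O F m n}
    (hf : f ∈ Otr F n p t θ) (hg : g ∈ Otr F n p t η) : f * g ∈ Otr F n p t (θ + η) := by
  refine monoSpan_ind hf (by simp) (fun α u h => ?_)
    (fun a b ha hb => by simpa [add_mul] using add_mem ha hb)
    (fun c a ha => by simpa using Submodule.smul_mem _ c ha)
  refine monoSpan_ind hg (by simp) (fun β v h' => ?_)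
    (fun a b ha hb => by simpa [mul_add] using add_mem ha hb)
    (fun c a ha => by simpa using Submodule.smul_mem _ c ha)
  rw [mono_mul_mono]
  split_ifs with hd
  · by_cases hle : α + β ≤ topExp p t
    · refine Submodule.smul_mem _ _ (mono_mem ⟨hle, ?_⟩)
      show ((u ∪ v).card : ZMod 2) = θ + η
      rw [Finset.card_union_of_disjoint hd, Nat.cast_add, h.2, h'.2]
    · obtain ⟨i, hi⟩ : ∃ i, topExp p t i < α i + β i := by
        by_contra hc
        exact hle fun i => not_lt.1 fun h => hc ⟨i, h⟩
      have : (multiBinom α β : F) = 0 := by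
        rw [CharP.cast_eq_zero_iff F p]
        exact (choose_dvd Fact.out (h.1 i) (h'.1 i) hi).trans
          (Finset.dvd_prod_of_mem _ (Finset.mem_univ i))
      rw [this, zero_mul, zero_smul]
      exact zero_mem _
  · exact zero_mem _

theorem two_mu (i : Idx m n) : mu i + mu i = 0 := CharTwo.add_self_eq_zero _

theorem vf_mem [Fact p.Prime] [CharP F p] {i : Idx m n} {θ : ZMod 2} {a f : O F m n}
    (ha : a ∈ Otr F n p t (mu i)) (hf : f ∈ Otr F n p t θ) : vf i a f ∈ Otr F n p t θ := by
  have := mul_mem_Otr ha (d_mem (i := i) hf)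
  rwa [add_comm θ, ← add_assoc, two_mu, zero_add] at this


theorem twist_of_even {a : O F m n} (ha : a ∈ par F m n 0) (i : Idx m n) : twist i a = a := by
  rcases i with i | k
  · rfl
  · exact parityInv_of_even ha

theorem mu_prime (i : Idx m n) : mu (prime i) = mu i := by
  rcases i with (i | i) | k <;> rfl

theorem d_mem_zero {i : Idx m n} {f : O F m n} (hf : f ∈ Otr F n p t 0) :
    d i f ∈ Otr F n p t (mu (prime i)) := by
  have := d_mem (i := i) hf
  rwa [zero_add, ← mu_prime] at this

theorem DH_even {a : O F m n} (ha : a ∈ par F m n 0) (f : O F m n) :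
    DH a f = ∑ i : Idx m n, tau F i • (d i a * d (prime i) f) := by
  simp only [DH_apply, twist_of_even ha]

theorem DH_mul {a : O F m n} (ha : a ∈ Otr F n p t 0) (f g : O F m n) :
    DH a (f * g) = DH a f * g + f * DH a g := by
  simp only [DH_even (Otr_le_par _ ha), Finset.sum_mul, Finset.mul_sum, ← Finset.sum_add_distrib]
  refine Finset.sum_congr rfl fun i _ => ?_
  have := vf_mul (i := prime i) (Otr_le_par _ (d_mem_zero (i := i) ha)) f g
  simp only [vf_apply] at this
  rw [this, smul_add, smul_mul_assoc, mul_smul_comm]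

theorem DH_d {a : O F m n} (ha : a ∈ Otr F n p t 0) (j : Idx m n) (f : O F m n) :
    DH a (d j f) = d j (DH a f) - DH (d j a) f := by
  rw [DH_even (Otr_le_par _ ha), DH_even (Otr_le_par _ ha), DH_apply, map_sum,
    ← Finset.sum_sub_distrib]
  refine Finset.sum_congr rfl fun i _ => ?_
  rw [map_smul, ← smul_sub]
  congr 1
  have hi := parityInv_of_even (Otr_le_par _ ha)
  rcases i with i | k <;> rcases j with j | l <;>
    simp only [d, prime, twist, Sum.elim_inl, Sum.elim_inr, Sum.map_inl, Sum.map_inr, id,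
      LinearMap.id_apply, dEven_mul, dOdd_mul, parityInv_dEven, parityInv_dOdd, hi, dEven_dOdd_comm,
      map_neg, neg_mul]
  · rw [dEven_comm j i, dEven_comm j i.swap]; abel
  · abel
  · abel
  · rw [dOdd_anticomm l k a, dOdd_anticomm l k f]
    simp only [mul_neg, neg_mul]; abel

theorem DH_apply_mem [Fact p.Prime] [CharP F p] {θ : ZMod 2} {a f : O F m n}
    (ha : a ∈ Otr F n p t 0) (hf : f ∈ Otr F n p t θ) : DH a f ∈ Otr F n p t θ := by
  rw [DH_even (Otr_le_par _ ha)]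
  exact Submodule.sum_mem _ fun i _ => Submodule.smul_mem _ _ (vf_mem (d_mem_zero ha) hf)

theorem prime_prime (i : Idx m n) : prime (prime i) = i := by
  rcases i with (i | i) | k <;> rfl

/-- `[D_H(a), D_H(b)] = D_H(D_H(a)(b))` for even `a`, `b`. -/
theorem DH_lie [Fact p.Prime] [CharP F p] {a b : O F m n} (ha : a ∈ Otr F n p t 0)
    (hb : b ∈ Otr F n p t 0) : ⁅DH a, DH b⁆ = DH (DH a b) := by
  ext f : 1
  rw [Ring.lie_def]
  simp only [LinearMap.sub_apply, Module.End.mul_apply]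
  have hab := DH_apply_mem ha hb
  have e1 : DH a (DH b f) = DH (DH a b) f + DH b (DH a f) -
      ∑ j : Idx m n, tau F j • (DH (d j a) b * d (prime j) f + d j b * DH (d (prime j) a) f) := by
    rw [DH_even (Otr_le_par _ hb) f, DH_even (Otr_le_par _ hb) (DH a f),
      DH_even (Otr_le_par _ hab), map_sum, ← Finset.sum_add_distrib, ← Finset.sum_sub_distrib]
    refine Finset.sum_congr rfl fun j _ => ?_
    rw [map_smul, DH_mul ha, DH_d ha, DH_d ha, ← smul_add, ← smul_sub]
    congr 1
    rw [sub_mul, mul_sub]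
    abel
  have e2 : ∑ j : Idx m n,
      tau F j • (DH (d j a) b * d (prime j) f + d j b * DH (d (prime j) a) f) = 0 := by
    simp only [smul_add, Finset.sum_add_distrib]
    have r : ∑ j : Idx m n, tau F j • (d j b * DH (d (prime j) a) f) =
        ∑ j : Idx m n, tau F (prime j) • (d (prime j) b * DH (d j a) f) := by
      refine Finset.sum_nbij' prime prime (by simp) (by simp) (fun i _ => prime_prime i)
        (fun i _ => prime_prime i) fun i _ => by rw [prime_prime]
    rw [r]
    simp only [DH_apply, Finset.sum_mul, Finset.mul_sum, Finset.smul_sum]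
    rw [Finset.sum_comm (f := fun j i : Idx m n => tau F (prime j) •
      (d (prime j) b * tau F i • (d i (twist i (d j a)) * d (prime i) f))),
      ← Finset.sum_add_distrib]
    refine Finset.sum_eq_zero fun j _ => ?_
    rw [← Finset.sum_add_distrib]
    refine Finset.sum_eq_zero fun i _ => ?_
    have key : tau F i • (d i (twist i (d j a)) * d (prime i) b) =
        - tau F (prime i) • (d (prime i) b * d j (twist j (d i a))) := by
      have hi := parityInv_of_even (Otr_le_par _ ha)
      have ha' := fun i : Idx m n => d_mem (i := i) ha
      have hb' := fun i : Idx m n => Otr_le_par _ (d_mem (i := i) hb)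
      rcases i with i | k
      · have h1 := hb' (Sum.inl i.swap)
        simp only [mu, Sum.elim_inl, add_zero] at h1
        have ht : tau F (prime (Sum.inl i : Idx m n)) = - tau F (Sum.inl i : Idx m n) := by
          rcases i with i | i <;> simp [tau, prime]
        rw [ht, neg_neg]
        congr 1
        rcases j with j | l
        · simp only [d, prime, twist, Sum.elim_inl, Sum.map_inl, LinearMap.id_apply] at h1 ⊢
          rw [mul_comm_of_even h1, dEven_comm i j]
        · simp only [d, prime, twist, Sum.elim_inl, Sum.elim_inr, Sum.map_inl,
            LinearMap.id_apply, parityInv_dEven, hi] at h1 ⊢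
          rw [mul_comm_of_even h1, dEven_dOdd_comm]
      · have h1 := hb' (Sum.inr k)
        simp only [mu, Sum.elim_inr, zero_add] at h1
        have ht : tau F (prime (Sum.inr k : Idx m n)) = 1 := rfl
        have ht' : tau F (Sum.inr k : Idx m n) = 1 := rfl
        rw [ht, ht', one_smul, neg_smul, one_smul]
        have h2 := mul_comm_of_odd h1
        rcases j with j | l
        · simp only [d, prime, twist, Sum.elim_inl, Sum.elim_inr, Sum.map_inr, id,
            LinearMap.id_apply] at h1 h2 ⊢
          simp only [← h2, parityInv_dOdd, parityInv_dEven, hi, dEven_dOdd_comm, mul_neg]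
        · simp only [d, prime, twist, Sum.elim_inr, Sum.map_inr, id] at h1 h2 ⊢
          simp only [← h2, parityInv_dOdd, hi, map_neg, mul_neg, neg_neg, dOdd_anticomm l k]
    rw [mul_smul_comm, ← mul_assoc, smul_smul, mul_comm (tau F (prime i)), ← smul_smul,
      key, ← smul_mul_assoc (tau F (prime i)), ← smul_add, ← add_mul, neg_smul, neg_add_cancel,
      zero_mul, smul_zero]
  rw [e1, e2]
  abel

instance : LieRing (Module.End F (O F m n)) := LieRing.ofAssociativeRing
instance : LieAlgebra F (Module.End F (O F m n)) := LieAlgebra.ofAssociativeAlgebra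

variable (F n p t)

/-- `𝒲`, the even part of `W(2m, n; t)`: the operators `∑ a_i ∂_i` with `a_i ∈ 𝒪(2m, n; t)` of the
same parity as `∂_i`. On even elements the super-bracket is the commutator of operators. -/
def wittEven [Fact p.Prime] [CharP F p] : LieSubalgebra F (Module.End F (O F m n)) where
  __ := Submodule.span F {D | ∃ i : Idx m n, ∃ a ∈ Otr F n p t (mu i), D = vf i a}
  lie_mem' := by
    intro D E hD hE
    refine Submodule.span_induction₂
      (p := fun D E _ _ => ⁅D, E⁆ ∈ Submodule.span F
        {D | ∃ i : Idx m n, ∃ a ∈ Otr F n p t (mu i), D = vf i a})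
      ?_ ?_ ?_ ?_ ?_ ?_ ?_ hD hE
    · rintro _ _ ⟨i, a, ha, rfl⟩ ⟨j, b, hb, rfl⟩
      rw [vf_lie (Otr_le_par _ ha) (Otr_le_par _ hb)]
      exact sub_mem (Submodule.subset_span ⟨j, _, vf_mem ha hb, rfl⟩)
        (Submodule.subset_span ⟨i, _, vf_mem hb ha, rfl⟩)
    · intro y _; simp
    · intro x _; simp
    · intro x y z _ _ _ h1 h2; rw [add_lie]; exact add_mem h1 h2
    · intro x y z _ _ _ h1 h2; rw [lie_add]; exact add_mem h1 h2
    · intro r x y _ _ h; rw [smul_lie]; exact Submodule.smul_mem _ _ h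
    · intro r x y _ _ h; rw [lie_smul]; exact Submodule.smul_mem _ _ h

/-- The span of the `x^(α) x^u` with `α ≤ π`, `|u|` even and `(α, u) ≠ (π, ω)`. -/
def hamPot : Submodule F (O F m n) :=
  monoSpan F {a | a.1 ≤ topExp p t ∧ (a.2.card : ZMod 2) = 0 ∧ a ≠ (topExp p t, Finset.univ)}

variable {F n p t}

theorem hamPot_le : hamPot F n p t ≤ Otr F n p t 0 := monoSpan_mono fun _ h => ⟨h.1, h.2.1⟩

theorem mem_hamPot {f : O F m n} (hf : f ∈ Otr F n p t 0)
    (h : coeff (topExp p t) Finset.univ f = 0) : f ∈ hamPot F n p t := by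
  rw [hamPot, mem_monoSpan]
  intro α u hau
  by_cases he : (α, u) = (topExp p t, Finset.univ)
  · rw [Prod.mk.injEq] at he
    rw [he.1, he.2, h]
  · exact mem_monoSpan.1 hf α u fun h' => hau ⟨h'.1, h'.2, he⟩

theorem coeff_mono (α β : EvenIdx m → ℕ) (u v : Finset (Fin n)) :
    coeff α u (mono β v : O F m n) = if β = α ∧ v = u then 1 else 0 := by
  have : coeff α u (mono β v : O F m n) = if (β, v) = (α, u) then 1 else 0 :=
    Finsupp.single_apply
  simpa [Prod.ext_iff] using this

theorem coeff_top_d {θ : ZMod 2} {f : O F m n} (hf : f ∈ Otr F n p t θ) (i : Idx m n) :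
    coeff (topExp p t) Finset.univ (d i f) = 0 := by
  refine monoSpan_ind hf (by simp) (fun α u h => ?_) (fun a b ha hb => by simp [ha, hb])
    (fun c a ha => by simp [ha])
  rcases i with i | k
  · simp only [d, Sum.elim_inl, dEven, ofBasis_mono]
    split_ifs with h0
    · simp
    · rw [coeff_mono, if_neg]
      rintro ⟨h1, -⟩
      have h2 := congrFun h1 i
      have h3 := h.1 i
      simp only [Pi.sub_apply, Pi.single_eq_same] at h2 h3
      omega
  · simp only [d, Sum.elim_inr, dOdd, ofBasis_mono]
    split_ifs with hk
    · rw [map_smul, coeff_mono, if_neg, smul_zero]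
      rintro ⟨-, h1⟩
      have := Finset.mem_univ k
      rw [← h1] at this
      exact Finset.notMem_erase k u this
    · simp

theorem DH_divergence {a : O F m n} (ha : a ∈ par F m n 0) (b : O F m n) :
    DH a b = ∑ i : Idx m n, tau F i • d i (a * d (prime i) b) := by
  have h : ∑ i : Idx m n, tau F i • (a * d i (d (prime i) b)) = 0 := by
    simp only [Fintype.sum_sum_type, tau, d, prime, Sum.elim_inl, Sum.elim_inr, Sum.map_inl,
      Sum.map_inr, Sum.swap_inl, Sum.swap_inr, id, dOdd_sq, mul_zero, smul_zero,
      Finset.sum_const_zero, add_zero, one_smul, neg_smul, Finset.sum_neg_distrib]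
    rw [← sub_eq_add_neg, sub_eq_zero]
    exact Finset.sum_congr rfl fun i _ => by rw [dEven_comm]
  rw [DH_even ha, ← sub_eq_zero, ← neg_eq_zero, ← h, ← Finset.sum_sub_distrib,
    ← Finset.sum_neg_distrib]
  refine Finset.sum_congr rfl fun i _ => ?_
  rw [← smul_sub, ← smul_neg]
  congr 1
  rcases i with i | k
  · simp only [d, Sum.elim_inl, dEven_mul]; abel
  · simp only [d, Sum.elim_inr, dOdd_mul, parityInv_of_even ha]; abel

theorem DH_mem_hamPot [Fact p.Prime] [CharP F p] {a b : O F m n} (ha : a ∈ Otr F n p t 0)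
    (hb : b ∈ Otr F n p t 0) : DH a b ∈ hamPot F n p t := by
  refine mem_hamPot (DH_apply_mem ha hb) ?_
  rw [DH_divergence (Otr_le_par _ ha), map_sum]
  refine Finset.sum_eq_zero fun i _ => ?_
  rw [map_smul, coeff_top_d (mul_mem_Otr ha (d_mem hb)), smul_zero]

theorem vf_mem_wittEven [Fact p.Prime] [CharP F p] {i : Idx m n} {a : O F m n}
    (ha : a ∈ Otr F n p t (mu i)) : vf i a ∈ wittEven F n p t :=
  Submodule.subset_span ⟨i, a, ha, rfl⟩

theorem DH_mem_wittEven [Fact p.Prime] [CharP F p] {a : O F m n} (ha : a ∈ Otr F n p t 0) :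
    DH a ∈ wittEven F n p t := by
  have : DH a = ∑ i : Idx m n, tau F i • vf (prime i) (d i a) := by
    ext f : 1
    simp [DH_even (Otr_le_par _ ha), LinearMap.sum_apply, vf_apply]
  rw [this]
  exact sum_mem fun i _ => SMulMemClass.smul_mem _ (vf_mem_wittEven (d_mem_zero ha))

variable (F n p t)

/-- `𝓗`, the even part of `H(2m, n; t)`, as a subalgebra of `𝒲`: the span of the `D_H(x^(α) x^u)`
with `α ≤ π`, `|u|` even and `(α, u) ≠ (π, ω)`. -/
def hamEven [Fact p.Prime] [CharP F p] : LieSubalgebra F (wittEven F n p t) where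
  __ := ((hamPot F n p t).map DH).comap (wittEven F n p t).toSubmodule.subtype
  lie_mem' := by
    rintro ⟨_, _⟩ ⟨_, _⟩ ⟨a, ha, rfl⟩ ⟨b, hb, rfl⟩
    exact ⟨DH a b, DH_mem_hamPot (hamPot_le ha) (hamPot_le hb),
      (DH_lie (hamPot_le ha) (hamPot_le hb)).symm⟩

variable {F n p t}

/-- `D_H(f)` as an element of `𝓗`. -/
def hamOf [Fact p.Prime] [CharP F p] : hamPot F n p t →ₗ[F] hamEven F n p t where
  toFun f := ⟨⟨DH f, DH_mem_wittEven (hamPot_le f.2)⟩, ⟨f, f.2, rfl⟩⟩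
  map_add' f g := by ext1; ext1; simp
  map_smul' c f := by ext1; ext1; simp

theorem hamOf_surjective [Fact p.Prime] [CharP F p] :
    Function.Surjective (hamOf (F := F) (n := n) (p := p) (t := t)) := by
  rintro ⟨x, hx⟩
  obtain ⟨a, ha, h⟩ := hx
  exact ⟨⟨a, ha⟩, Subtype.ext (Subtype.ext h)⟩

theorem d_eq_zero_of_DH {f : O F m n} (hf : f ∈ par F m n 0) (h : DH f = 0) (i : Idx m n) :
    d i f = 0 := by
  obtain ⟨x, hx⟩ : ∃ x : O F m n, ∀ j : Idx m n, d j x = if j = prime i then 1 else 0 := by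
    rcases i with i | k
    · refine ⟨mono (Pi.single i.swap 1) ∅, ?_⟩
      rintro (j | l)
      · simp only [d, prime, Sum.elim_inl, Sum.map_inl, dEven, ofBasis_mono, Sum.inl.injEq]
        rcases eq_or_ne j i.swap with rfl | hj
        · simp [one_def]
        · simp [hj]
      · simp [d, prime, dOdd]
    · refine ⟨mono 0 {k}, ?_⟩
      rintro (j | l)
      · simp [d, prime, dEven]
      · simp only [d, prime, Sum.elim_inr, Sum.map_inr, dOdd, ofBasis_mono, Sum.inr.injEq, id,
          Finset.mem_singleton]
        split_ifs with hl
        · subst hl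
          simp [one_def, sgn_singleton_self]
        · rfl
  have h1 : DH f x = 0 := by rw [h]; rfl
  rw [DH_even hf, Finset.sum_eq_single i] at h1
  · rw [hx, if_pos rfl, mul_one] at h1
    have ht : tau F i ≠ 0 := by rcases i with (i | i) | k <;> simp [tau]
    exact (smul_eq_zero.1 h1).resolve_left ht
  · intro j _ hj
    rw [hx, if_neg, mul_zero, smul_zero]
    intro e
    exact hj (by rw [← prime_prime j, e, prime_prime])
  · simp

theorem coeff_eq_zero_of_d {f : O F m n} (h : ∀ i : Idx m n, d i f = 0)
    {α : EvenIdx m → ℕ} {u : Finset (Fin n)} (hau : (α, u) ≠ (0, ∅)) : coeff α u f = 0 := by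
  by_cases hα : α = 0
  · have hu : u ≠ ∅ := fun hu => hau (by rw [hα, hu])
    obtain ⟨k, hk⟩ := Finset.nonempty_iff_ne_empty.2 hu
    have key : coeff α (u.erase k) (dOdd k f) = sgn F {k} u * coeff α u f := by
      refine O_ind f (by simp) (fun β v => ?_) (fun a b ha hb => by simp [ha, hb, mul_add])
        (fun c a ha => by simp [ha]; ring)
      simp only [dOdd, ofBasis_mono]
      split_ifs with hv
      · rw [map_smul, coeff_mono, coeff_mono]
        by_cases e : v = u
        · simp [e]
        · have : v.erase k ≠ u.erase k := fun h' => e (by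
            rw [← Finset.insert_erase hv, h', Finset.insert_erase hk])
          simp [e, this]
      · rw [coeff_mono, if_neg]
        · simp
        · rintro ⟨-, rfl⟩; exact hv hk
    have h0 : dOdd k f = 0 := h (Sum.inr k)
    rw [h0, map_zero] at key
    have hs : sgn F {k} u ≠ 0 := fun h' => by
      have := sgn_sq (F := F) {k} u
      simp [h'] at this
    exact (mul_eq_zero.1 key.symm).resolve_left hs
  · obtain ⟨i, hi⟩ : ∃ i, α i ≠ 0 := by
      by_contra hc
      exact hα (funext fun i => by_contra fun h' => hc ⟨i, h'⟩)
    have key : coeff (α - Pi.single i 1) u (dEven i f) = coeff α u f := by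
      refine O_ind f (by simp) (fun β v => ?_) (fun a b ha hb => by simp [ha, hb])
        (fun c a ha => by simp [ha])
      simp only [dEven, ofBasis_mono]
      split_ifs with hv
      · rw [coeff_mono, if_neg]
        · simp
        · rintro ⟨rfl, -⟩; exact hi hv
      · rw [coeff_mono, coeff_mono]
        by_cases e : β = α
        · simp [e]
        · have : β - Pi.single i 1 ≠ α - Pi.single i 1 := fun h' => e (by
            funext j
            have := congrFun h' j
            rcases eq_or_ne j i with rfl | hj
            · simp at this; omega
            · simpa [Pi.single_eq_of_ne hj] using this)
          simp [e, this]
    have h0 : dEven i f = 0 := h (Sum.inl i)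
    rw [h0, map_zero] at key
    exact key.symm

/-- `Ker D_H` consists of the constants. -/
theorem eq_const_of_DH {f : O F m n} (hf : f ∈ par F m n 0) (h : DH f = 0) :
    f = coeff 0 ∅ f • (1 : O F m n) := by
  have h1 := @coeff_eq_zero_of_d F _ m n f (d_eq_zero_of_DH hf h)
  refine Finsupp.ext fun a => ?_
  change coeff a.1 a.2 f = coeff a.1 a.2 (coeff 0 ∅ f • (1 : O F m n))
  rw [map_smul, one_def, coeff_mono]
  by_cases e : a = (0, ∅)
  · simp [e]
  · rw [h1 e, if_neg, smul_zero]
    rintro ⟨h2, h3⟩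
    exact e (Prod.ext h2.symm h3.symm)

theorem exists_descend [Fact p.Prime] [CharP F p] {M : Type*} [AddCommGroup M] [Module F M]
    (g : O F m n →ₗ[F] M) (hg : g 1 = 0) :
    ∃! φ : hamEven F n p t →ₗ[F] M, ∀ f : hamPot F n p t, φ (hamOf f) = g f := by
  obtain ⟨s, hs⟩ := LinearMap.exists_rightInverse_of_surjective
    (hamOf (F := F) (n := n) (p := p) (t := t)) (LinearMap.range_eq_top.2 hamOf_surjective)
  refine ⟨g ∘ₗ (hamPot F n p t).subtype ∘ₗ s, fun f => ?_, fun ψ hψ => ?_⟩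
  · have h1 : hamOf (s (hamOf f)) = hamOf f := LinearMap.congr_fun hs _
    have h2 : DH ((s (hamOf f) : O F m n) - (f : O F m n)) = 0 := by
      rw [map_sub, sub_eq_zero]
      exact congrArg Subtype.val (congrArg Subtype.val h1)
    have h3 := eq_const_of_DH (Otr_le_par _ (hamPot_le (sub_mem (s (hamOf f)).2 f.2))) h2
    have h4 : g ((s (hamOf f) : O F m n) - (f : O F m n)) = 0 := by rw [h3, map_smul, hg, smul_zero]
    rw [map_sub, sub_eq_zero] at h4
    exact h4
  · ext x
    obtain ⟨f, rfl⟩ := hamOf_surjective x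
    rw [hψ]
    have h1 : hamOf (s (hamOf f)) = hamOf f := LinearMap.congr_fun hs _
    have := hψ (s (hamOf f))
    rw [h1, hψ] at this
    exact this


section Derivations

variable [Fact p.Prime] [CharP F p]

theorem one_mem_Otr : (1 : O F m n) ∈ Otr F n p t 0 :=
  mono_mem ⟨fun _ => Nat.zero_le _, by simp⟩

theorem topMono_mem (hn : Even n) : (mono 0 Finset.univ : O F m n) ∈ Otr F n p t 0 :=
  mono_mem ⟨fun _ => Nat.zero_le _, by simpa using ZMod.natCast_eq_zero_iff_even.2 hn⟩

theorem exists_potential : ∃! φ : hamEven F n p t →ₗ[F] Otr F n p t 0,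
    ∀ f : hamPot F n p t, (φ (hamOf f) : O F m n) = f - coeff 0 ∅ (f : O F m n) • 1 := by
  let g : O F m n →ₗ[F] O F m n := LinearMap.id - (coeff 0 ∅).smulRight 1
  have hg : g 1 = 0 := by simp [g, one_def, coeff_mono]
  obtain ⟨φ, h1, h2⟩ := exists_descend (F := F) (n := n) (p := p) (t := t) g hg
  have hm : ∀ x, φ x ∈ Otr F n p t 0 := fun x => by
    obtain ⟨f, rfl⟩ := hamOf_surjective x
    rw [h1]
    exact sub_mem (hamPot_le f.2) (Submodule.smul_mem _ _ one_mem_Otr)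
  refine ⟨φ.codRestrict _ hm, fun f => h1 f, fun ψ hψ => ?_⟩
  have := h2 ((Otr F n p t 0).subtype ∘ₗ ψ) hψ
  ext x
  exact LinearMap.congr_fun this x

/-- The inverse of `D_H` up to constants: `D_H(f) ↦ f - c`, where `c` is the constant term of `f`. -/
def potential : hamEven F n p t →ₗ[F] Otr F n p t 0 := exists_potential.choose

theorem potential_hamOf (f : hamPot F n p t) :
    (potential (hamOf f) : O F m n) = f - coeff 0 ∅ (f : O F m n) • 1 :=
  exists_potential.choose_spec.1 f

/-- `(a, D) ↦ a D` for `a` an even element of `𝒪(2m, n; t)` and `D ∈ 𝒲`. -/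
def oMul : Otr F n p t 0 →ₗ[F] wittEven F n p t →ₗ[F] wittEven F n p t :=
  LinearMap.mk₂ F (fun a D => ⟨LinearMap.mulLeft F (a : O F m n) * (D : Module.End F (O F m n)), by
      refine Submodule.span_induction
        (p := fun D _ => LinearMap.mulLeft F (a : O F m n) * D ∈ wittEven F n p t)
        ?_ ?_ ?_ ?_ D.2
      · rintro _ ⟨i, b, hb, rfl⟩
        have h := mul_mem_Otr a.2 hb
        rw [zero_add] at h
        have e : LinearMap.mulLeft F (a : O F m n) * vf i b = vf i ((a : O F m n) * b) := by
          ext f : 1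
          simp [vf_apply, mul_assoc]
        rw [e]
        exact vf_mem_wittEven h
      · rw [mul_zero]; exact zero_mem _
      · intro x y _ _ hx hy; rw [mul_add]; exact add_mem hx hy
      · intro c x _ hx; rw [mul_smul_comm]; exact SMulMemClass.smul_mem c hx⟩)
    (fun a b D => by ext1; ext f : 1; simp [add_mul])
    (fun c a D => by ext1; ext f : 1; simp)
    (fun a D E => by ext1; ext f : 1; simp [mul_add])
    (fun c a D => by ext1; ext f : 1; simp)

/-- `D_H(x^ω)`, for even `n`, as an element of `𝒲`. -/
def dhTop (hn : Even n) : wittEven F n p t :=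
  ⟨DH (mono 0 Finset.univ), DH_mem_wittEven (topMono_mem hn)⟩

/-- `∂_i`, for `i ∈ Y₀`, as an element of `𝒲`. -/
def partialW (i : EvenIdx m) : wittEven F n p t :=
  ⟨d (Sum.inl i), by
    have h : (d (Sum.inl i) : Module.End F (O F m n)) = vf (Sum.inl i) 1 := by
      ext f : 1
      simp [vf_apply]
    rw [h]
    exact vf_mem_wittEven one_mem_Otr⟩

theorem dEven_mem {i : EvenIdx m} {f : O F m n} (hf : f ∈ Otr F n p t 0) :
    d (Sum.inl i) f ∈ Otr F n p t 0 := by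
  have h : (0 : ZMod 2) + mu (Sum.inl i : Idx m n) = 0 := by simp [mu]
  have h' := d_mem (i := Sum.inl i) hf
  rwa [h] at h'

/-- `∂_i`, for `i ∈ Y₀`, as an operator on the even part of the truncated algebra. -/
def dTr (i : EvenIdx m) : Module.End F (Otr F n p t 0) :=
  LinearMap.restrict (d (Sum.inl i)) fun _ hf => dEven_mem hf

theorem dTr_pow_coe (i : EvenIdx m) (k : ℕ) (f : Otr F n p t 0) :
    ((dTr i ^ k) f : O F m n) = ((d (Sum.inl i) : Module.End F (O F m n)) ^ k) f := by
  induction k with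
  | zero => rfl
  | succ k ih => rw [pow_succ', pow_succ', Module.End.mul_apply, Module.End.mul_apply, ← ih]; rfl

/-- The linear map `(ad ∂_i)^(p^s) : 𝓗 → 𝒲`. -/
def adPartialPow (s : ℕ) (i : EvenIdx m) : hamEven F n p t →ₗ[F] wittEven F n p t :=
  ((LieAlgebra.ad F (wittEven F n p t) (partialW i)) ^ (p ^ s)) ∘ₗ
    (hamEven F n p t).toSubmodule.subtype

/-- `Φ_i^(s) : D_H(f) ↦ ∂_i^(p^s)(f) D_H(x^ω)`. -/
def phi (hn : Even n) (s : ℕ) (i : EvenIdx m) : hamEven F n p t →ₗ[F] wittEven F n p t :=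
  oMul.flip (dhTop hn) ∘ₗ
    (dTr i ^ (p ^ s)) ∘ₗ potential

/-- `Θ_i^(s) : D_H(f) ↦ x^ω (ad ∂_i)^(p^s)(D_H(f))`. -/
def theta (hn : Even n) (s : ℕ) (i : EvenIdx m) : hamEven F n p t →ₗ[F] wittEven F n p t :=
  oMul ⟨mono 0 Finset.univ, topMono_mem hn⟩ ∘ₗ adPartialPow s i

/-- `Γ_c : D_H(x^(π)) ↦ c D_H(x^ω)`, and `D_H(x^(α) x^u) ↦ 0` for all other `(α, u)`. -/
def gam (hn : Even n) (c : F) : hamEven F n p t →ₗ[F] wittEven F n p t :=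
  (coeff (topExp p t) ∅ ∘ₗ (Otr F n p t 0).subtype ∘ₗ potential).smulRight (c • dhTop hn)

theorem phi_hamOf (hn : Even n) (s : ℕ) (i : EvenIdx m) (f : hamPot F n p t) :
    (phi hn s i (hamOf f) : Module.End F (O F m n)) =
      LinearMap.mulLeft F (((d (Sum.inl i) : Module.End F (O F m n)) ^ (p ^ s)) f) *
        DH (mono 0 Finset.univ) := by
  have h0 : ((d (Sum.inl i) : Module.End F (O F m n)) ^ (p ^ s)) 1 = 0 := by
    obtain ⟨k, hk⟩ := Nat.exists_eq_succ_of_ne_zero (pow_ne_zero s (Fact.out : p.Prime).ne_zero)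
    rw [hk, pow_succ, Module.End.mul_apply]
    simp [d, one_def, dEven]
  have h1 : ((d (Sum.inl i) : Module.End F (O F m n)) ^ (p ^ s)) (potential (hamOf f)) =
      ((d (Sum.inl i) : Module.End F (O F m n)) ^ (p ^ s)) f := by
    rw [potential_hamOf, map_sub, map_smul, h0, smul_zero, sub_zero]
  rw [← h1, ← dTr_pow_coe]
  rfl

theorem gam_hamOf (hπ : topExp p t ≠ 0) (hn : Even n) (c : F) (f : hamPot F n p t) :
    gam hn c (hamOf f) = coeff (topExp p t) ∅ (f : O F m n) • c • dhTop hn := by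
  have : coeff (topExp p t) ∅ (potential (hamOf f) : O F m n) =
      coeff (topExp p t) ∅ (f : O F m n) := by
    rw [potential_hamOf, map_sub, map_smul, one_def, coeff_mono, if_neg (fun h => hπ h.1.symm),
      smul_zero, sub_zero]
  rw [← this]
  rfl

variable (F n p t)

/-- `𝒲_[k]`: the span of the `f ∂_i` in `𝒲` with `f` of degree `k + 1`. The gradation of `𝓗` is the
induced one. -/
def wittGr (k : ℤ) : Submodule F (wittEven F n p t) :=
  (Submodule.span F {D | ∃ i : Idx m n, ∃ a ∈ Otr F n p t (mu i) ⊓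
    monoSpan F {a : Mon m n | ((∑ i, a.1 i + a.2.card : ℕ) : ℤ) = k + 1}, D = vf i a}).comap
    (wittEven F n p t).toSubmodule.subtype

/-- `Der(𝓗, 𝒲)`, as a space of linear maps. -/
def derSpace : Submodule F (hamEven F n p t →ₗ[F] wittEven F n p t) where
  carrier := {φ | ∃ D : LieDerivation F (hamEven F n p t) (wittEven F n p t), D.toLinearMap = φ}
  add_mem' := by
    rintro _ _ ⟨D, rfl⟩ ⟨E, rfl⟩
    exact ⟨D + E, rfl⟩
  zero_mem' := ⟨0, rfl⟩
  smul_mem' := by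
    rintro c _ ⟨D, rfl⟩
    exact ⟨c • D, rfl⟩

/-- `Der_[k](𝓗, 𝒲)`: the derivations that map `𝓗_[i]` into `𝒲_[k + i]` for all `i`. -/
def derGr (k : ℤ) : Submodule F (hamEven F n p t →ₗ[F] wittEven F n p t) where
  carrier := {φ | φ ∈ derSpace F n p t ∧ ∀ (i : ℤ) (x : hamEven F n p t),
    (x : wittEven F n p t) ∈ wittGr F n p t i → φ x ∈ wittGr F n p t (k + i)}
  add_mem' hφ hψ := ⟨add_mem hφ.1 hψ.1, fun i x hx => add_mem (hφ.2 i x hx) (hψ.2 i x hx)⟩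
  zero_mem' := ⟨zero_mem _, fun _ _ _ => zero_mem _⟩
  smul_mem' c _ hφ := ⟨Submodule.smul_mem _ c hφ.1,
    fun i x hx => Submodule.smul_mem _ c (hφ.2 i x hx)⟩

/-- `Der⁻(𝓗, 𝒲)`, the sum of all `Der_[k](𝓗, 𝒲)` with `k ≤ -1`. -/
def derNeg : Submodule F (hamEven F n p t →ₗ[F] wittEven F n p t) :=
  ⨆ k : ℤ, ⨆ _ : k ≤ -1, derGr F n p t k

/-- `v ↦ ad v`, where `ad v : 𝓗 → 𝒲` is `x ↦ [v, x]`. -/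
def adMap : wittEven F n p t →ₗ[F] hamEven F n p t →ₗ[F] wittEven F n p t :=
  LinearMap.mk₂ F (fun v x => ⁅v, (x : wittEven F n p t)⁆)
    (fun _ _ _ => add_lie _ _ _) (fun _ _ _ => smul_lie _ _ _)
    (fun _ _ _ => lie_add _ _ _) (fun _ _ _ => lie_smul _ _ _)

end Derivations

end Truncated

end HamSuper

end

open HamSuper

/-! ### Coordinates, coefficients, and vector fields through their components. -/

namespace HamSuper

variable {F : Type*} [Field F] {m n : ℕ}

/-! A derivation `D` of degree `k ≤ -1` is studied through the map `G(f) = D(D_H(f))` on potentials,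
which satisfies a cocycle identity for the bracket `D_H(f)(g)`. The plan is to subtract explicit
derivations until finitely many scalars vanish, and to show that these scalars determine `G`.

Normalization. By degree, `G` kills the coordinates `x_i`, `i ∈ Y₀`. On quadratic functions its even
components are constants. The `∂_i`-component of `G(x_i x_{i'})` is removed by the inner derivation
of a combination of the `∂_i` (`exists_sub_adMap`). Weights for the torus spanned by the `x_i
x_{i'}`, together with parity and rotations in the odd variables, then force `G` to vanish on all
`x_i x_j`, `x_k x_l` and `x_i x_k x_l` with `i, j` even and `k, l` odd indices (`kills_of_degree`).

Rigidity. Since `G` kills the coordinates, it commutes with the `∂_i`, so `G(x^(β))` is encoded by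
the coefficients free of even variables, the numbers `lam`. Quadratic functions act on these as a
symplectic Lie algebra (`lam_square`, `lam_weight`, `lam_mixed`), and brackets of functions of order
at least three contribute nothing (`lam_cubic`, `lam_split`). The even components survive only at `β
= p^s ε_r + ε_{b'}`, the odd ones only at `p^s ε_r` and `π`. Moreover `G(x^(β))` commutes with the
rotations `x_k x_l`: its even components involve only `1` and `x^ω`, and its odd components only
`x_k` and `x^{ω∖k}`, of which `x_k` is excluded because 2 is invertible. Finally, a normalized
cocycle that vanishes on functions of the even variables vanishes everywhere (`eq_zero_of_pure`).
This leaves four families of scalars (`cocycle_eq_zero`).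

Matching. The four families are exactly those detected by `(ad ∂_r)^{p^s}`, `Θ`, `Φ` and `Γ`, in a
diagonal fashion; for odd `n` the last three families vanish by parity. Conversely these maps are
derivations: `∂_r^{p^s}` derives the bracket by Frobenius, every `D_H(f)` kills `x^ω`, hence
commutes with `D_H(x^ω)`, and `x^(π)` never occurs in a bracket. The inequalities in the statement
say precisely that the degrees are negative. -/

/-- The coordinates `x_i`, `i ∈ Y`. -/
noncomputable def coord (F : Type*) [Field F] {m n : ℕ} : Idx m n → O F m n :=
  Sum.elim (fun i => mono (Pi.single i 1) ∅) (fun k => mono 0 {k})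

theorem d_coord (i j : Idx m n) : d i (coord F j) = if i = j then 1 else 0 := by
  rcases i with i | k <;> rcases j with j | l
  · rcases eq_or_ne i j with rfl | h
    · simp [d, coord, dEven, one_def]
    · simp [d, coord, dEven, h]
  · simp [d, coord, dEven]
  · simp [d, coord, dOdd]
  · rcases eq_or_ne k l with rfl | h
    · simp [d, coord, dOdd, one_def, sgn_singleton_self]
    · simp [d, coord, dOdd, h]

theorem dEven_mono_add (i : EvenIdx m) (α : EvenIdx m → ℕ) (u : Finset (Fin n)) :
    dEven i (mono (α + Pi.single i 1) u : O F m n) = mono α u := by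
  simp [dEven]

theorem dEven_mono_zero {i : EvenIdx m} {α : EvenIdx m → ℕ} (h : α i = 0) (u : Finset (Fin n)) :
    dEven i (mono α u : O F m n) = 0 := by
  simp [dEven, h]

theorem exists_eq_add_single {i : EvenIdx m} {α : EvenIdx m → ℕ} (h : α i ≠ 0) :
    ∃ β : EvenIdx m → ℕ, α = β + Pi.single i 1 := by
  refine ⟨α - Pi.single i 1, ?_⟩
  funext j
  rcases eq_or_ne j i with rfl | hj
  · simp; omega
  · simp [Pi.single_eq_of_ne hj]

/-- In the divided power basis `∂_i` is a pure shift, so no scalar appears. Hence all coefficients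
can be read off from the coefficients at `α = 0` of iterated derivatives. -/
theorem coeff_dEven (i : EvenIdx m) (α : EvenIdx m → ℕ) (u : Finset (Fin n)) (f : O F m n) :
    coeff α u (dEven i f) = coeff (α + Pi.single i 1) u f := by
  refine O_ind f (by simp) (fun β v => ?_) (fun a b ha hb => by simp [ha, hb])
    (fun c a ha => by simp [ha])
  by_cases h : β i = 0
  · rw [dEven_mono_zero h, coeff_mono, if_neg, map_zero]
    rintro ⟨rfl, -⟩
    simp at h
  · obtain ⟨γ, rfl⟩ := exists_eq_add_single h
    rw [dEven_mono_add, coeff_mono, coeff_mono]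
    simp

theorem O_eq_zero {f : O F m n} (h : ∀ α u, coeff α u f = 0) : f = 0 :=
  Finsupp.ext fun a => h a.1 a.2

theorem multiBinom_single (i : EvenIdx m) (α : EvenIdx m → ℕ) :
    multiBinom (Pi.single i 1) α = α i + 1 := by
  rw [multiBinom, Finset.prod_eq_single i]
  · simp [add_comm]
  · intro j _ hj
    simp [Pi.single_eq_of_ne hj]
  · simp

theorem coord_mul_mono (i : EvenIdx m) (α : EvenIdx m → ℕ) (u : Finset (Fin n)) :
    coord F (Sum.inl i) * mono α u = ((α i + 1 : ℕ) : F) • mono (α + Pi.single i 1) u := by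
  rw [coord, Sum.elim_inl, mono_mul_mono, if_pos (Finset.disjoint_empty_left u),
    multiBinom_single, sgn_empty_left, mul_one, Finset.empty_union, add_comm α]

theorem mono_mem_par {α : EvenIdx m → ℕ} {u : Finset (Fin n)} {θ : ZMod 2}
    (h : (u.card : ZMod 2) = θ) : (mono α u : O F m n) ∈ par F m n θ := mono_mem h

theorem mono_empty_mem_par (α : EvenIdx m → ℕ) : (mono α ∅ : O F m n) ∈ par F m n 0 :=
  mono_mem_par (by simp)

theorem coord_inl_mem_par (i : EvenIdx m) : coord F (Sum.inl i) ∈ par F m n 0 :=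
  mono_empty_mem_par _

theorem mono_empty_mul_mono_empty (α β : EvenIdx m → ℕ) :
    (mono α ∅ * mono β ∅ : O F m n) = (multiBinom α β : F) • mono (α + β) ∅ := by
  simp [mono_mul_mono, sgn_empty_left]

theorem mono_empty_mul_mono (α β : EvenIdx m → ℕ) (u : Finset (Fin n)) :
    (mono α ∅ * mono β u : O F m n) = (multiBinom α β : F) • mono (α + β) u := by
  simp [mono_mul_mono, sgn_empty_left]

theorem mono_zero_empty_mul_mono (α : EvenIdx m → ℕ) (u : Finset (Fin n)) :
    (mono 0 u * mono α ∅ : O F m n) = mono α u := by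
  simp [mono_mul_mono, sgn_empty_right, multiBinom_zero_left]

/-- The elements that vanish when all even variables are set to zero form an ideal. -/
theorem coeff_zero_mul_left {a : O F m n} (h : ∀ u, coeff 0 u a = 0) (b : O F m n)
    (v : Finset (Fin n)) : coeff 0 v (a * b) = 0 := by
  have ha : a ∈ monoSpan F {c : Mon m n | c.1 ≠ 0} := mem_monoSpan.2 fun α u hu => by
    have : α = 0 := not_not.1 hu
    rw [this, h]
  refine monoSpan_ind ha (by simp) (fun α u hα => ?_) (fun a b ha hb => by simp [add_mul, ha, hb])
    (fun c a ha => by simp [ha])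
  refine O_ind b (by simp) (fun β w => ?_) (fun a b ha hb => by simp [mul_add, ha, hb])
    (fun c a ha => by simp [ha])
  rw [mono_mul_mono]
  split_ifs
  · rw [map_smul, coeff_mono, if_neg, smul_zero]
    rintro ⟨h0, -⟩
    refine hα (funext fun i => ?_)
    have := congrFun h0 i
    simp only [Pi.add_apply, Pi.zero_apply] at this ⊢
    omega
  · simp

theorem coeff_zero_mul_right {b : O F m n} (h : ∀ u, coeff 0 u b = 0) (a : O F m n)
    (v : Finset (Fin n)) : coeff 0 v (a * b) = 0 := by
  have hb : b ∈ monoSpan F {c : Mon m n | c.1 ≠ 0} := mem_monoSpan.2 fun α u hu => by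
    have : α = 0 := not_not.1 hu
    rw [this, h]
  refine monoSpan_ind hb (by simp) (fun α u hα => ?_) (fun a b ha hb => by simp [mul_add, ha, hb])
    (fun c a ha => by simp [ha])
  refine O_ind a (by simp) (fun β w => ?_) (fun a b ha hb => by simp [add_mul, ha, hb])
    (fun c a ha => by simp [ha])
  rw [mono_mul_mono]
  split_ifs
  · rw [map_smul, coeff_mono, if_neg, smul_zero]
    rintro ⟨h0, -⟩
    refine hα (funext fun i => ?_)
    have := congrFun h0 i
    simp only [Pi.add_apply, Pi.zero_apply] at this ⊢
    omega
  · simp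

/-- The coordinate `x_b` pairs only with its conjugate, so the components of `D_H(f)` are the signed
partial derivatives of `f`. -/
theorem DH_coord {f : O F m n} (hf : f ∈ par F m n 0) (b : Idx m n) :
    DH f (coord F b) = tau F (prime b) • d (prime b) f := by
  rw [DH_even hf, Finset.sum_eq_single (prime b)]
  · rw [d_coord, prime_prime, if_pos rfl, mul_one]
  · intro j _ hj
    rw [d_coord, if_neg, mul_zero, smul_zero]
    intro e
    exact hj (by rw [← e, prime_prime])
  · simp

theorem DH_coord_even (i : EvenIdx m) (f : O F m n) :
    DH (coord F (Sum.inl i)) f = tau F (Sum.inl i : Idx m n) • dEven i.swap f := by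
  rw [DH_even (coord_inl_mem_par i), Finset.sum_eq_single (Sum.inl i)]
  · rw [d_coord, if_pos rfl, one_mul]; rfl
  · intro j _ hj
    rw [d_coord, if_neg hj, zero_mul, smul_zero]
  · simp

theorem mul_mem_par {θ η : ZMod 2} {f g : O F m n} (hf : f ∈ par F m n θ) (hg : g ∈ par F m n η) :
    f * g ∈ par F m n (θ + η) := by
  refine monoSpan_ind hf (by simp) (fun α u h => ?_)
    (fun a b ha hb => by simpa [add_mul] using add_mem ha hb)
    (fun c a ha => by simpa using Submodule.smul_mem _ c ha)
  refine monoSpan_ind hg (by simp) (fun β v h' => ?_)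
    (fun a b ha hb => by simpa [mul_add] using add_mem ha hb)
    (fun c a ha => by simpa using Submodule.smul_mem _ c ha)
  rw [mono_mul_mono]
  split_ifs with hd
  · refine Submodule.smul_mem _ _ (mono_mem_par ?_)
    rw [Finset.card_union_of_disjoint hd, Nat.cast_add, h, h']
  · exact zero_mem _

/-- `D_H` is a derivation in its argument. -/
theorem DH_mul_arg {a b : O F m n} (ha : a ∈ par F m n 0) (hb : b ∈ par F m n 0) (f : O F m n) :
    DH (a * b) f = a * DH b f + b * DH a f := by
  have hab : a * b ∈ par F m n 0 := by simpa using mul_mem_par ha hb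
  rw [DH_even hab, DH_even ha, DH_even hb, Finset.mul_sum, Finset.mul_sum,
    ← Finset.sum_add_distrib]
  refine Finset.sum_congr rfl fun i _ => ?_
  have e : d i (a * b) = a * d i b + b * d i a := by
    rcases i with i | k
    · simp only [d, Sum.elim_inl, dEven_mul, mul_comm_of_even hb]; abel
    · simp only [d, Sum.elim_inr, dOdd_mul, mul_comm_of_even hb, parityInv_of_even ha]; abel
  rw [e, add_mul, smul_add, mul_smul_comm, mul_smul_comm, mul_assoc, mul_assoc]

/-- The Hamiltonian field of a function of the even variables. -/
theorem DH_mono_empty (α : EvenIdx m → ℕ) (f : O F m n) :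
    DH (mono α ∅) f = ∑ i : EvenIdx m,
      tau F (Sum.inl i : Idx m n) • (dEven i (mono α ∅) * dEven i.swap f) := by
  rw [DH_even (mono_empty_mem_par α), Fintype.sum_sum_type]
  have : ∀ k : Fin n, tau F (Sum.inr k : Idx m n) • (d (Sum.inr k) (mono α ∅ : O F m n) *
      d (prime (Sum.inr k)) f) = 0 := fun k => by simp [d, dOdd]
  rw [Finset.sum_congr rfl fun k _ => this k, Finset.sum_const_zero, add_zero]
  rfl

section Truncated

variable {p : ℕ} {t : EvenIdx m → ℕ}

theorem coord_ext {D : Module.End F (O F m n)}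
    (h : ∀ f, D f = ∑ b : Idx m n, D (coord F b) * d b f) (h0 : ∀ b, D (coord F b) = 0) :
    D = 0 := by
  ext f : 1
  rw [h]
  simp [h0]

variable [Fact p.Prime] [CharP F p]

@[elab_as_elim]
theorem wittEven_ind {P : Module.End F (O F m n) → Prop} {D : Module.End F (O F m n)}
    (hD : D ∈ wittEven F n p t) (h0 : P 0)
    (h1 : ∀ i, ∀ a ∈ Otr F n p t (mu i), P (vf i a)) (h2 : ∀ x y, P x → P y → P (x + y))
    (h3 : ∀ (c : F) x, P x → P (c • x)) : P D := by
  refine Submodule.span_induction (p := fun D _ => P D) ?_ h0 (fun x y _ _ => h2 x y)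
    (fun c x _ => h3 c x) hD
  rintro _ ⟨i, a, ha, rfl⟩
  exact h1 i a ha

theorem wittEven_apply {D : Module.End F (O F m n)} (hD : D ∈ wittEven F n p t) (f : O F m n) :
    D f = ∑ b : Idx m n, D (coord F b) * d b f := by
  refine wittEven_ind hD (by simp) (fun i a _ => ?_)
    (fun x y hx hy => by simp [hx, hy, add_mul, Finset.sum_add_distrib])
    (fun c x hx => by simp [hx, Finset.smul_sum])
  simp only [vf_apply, d_coord]
  rw [Finset.sum_eq_single i]
  · simp
  · intro b _ hb
    rw [if_neg (Ne.symm hb)]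
    simp
  · simp

theorem wittEven_eq_zero {D : Module.End F (O F m n)} (hD : D ∈ wittEven F n p t)
    (h0 : ∀ b, D (coord F b) = 0) : D = 0 :=
  coord_ext (wittEven_apply hD) h0

theorem wittEven_coord_mem {D : Module.End F (O F m n)} (hD : D ∈ wittEven F n p t) (b : Idx m n) :
    D (coord F b) ∈ Otr F n p t (mu b) := by
  refine wittEven_ind hD (by simp) (fun i a ha => ?_)
    (fun x y hx hy => by simpa using add_mem hx hy)
    (fun c x hx => by simpa using Submodule.smul_mem _ c hx)
  rw [vf_apply, d_coord]
  split_ifs with h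
  · subst h; simpa using ha
  · simp

theorem wittEven_mul {D : Module.End F (O F m n)} (hD : D ∈ wittEven F n p t) (f g : O F m n) :
    D (f * g) = D f * g + f * D g := by
  refine wittEven_ind hD (by simp) (fun i a ha => vf_mul (Otr_le_par _ ha) f g)
    (fun x y hx hy => by simp only [LinearMap.add_apply, hx, hy, add_mul, mul_add]; abel)
    (fun c x hx => by simp [hx])

theorem wittEven_eq_sum {D : Module.End F (O F m n)} (hD : D ∈ wittEven F n p t) :
    D = ∑ b : Idx m n, vf b (D (coord F b)) := by
  ext f : 1
  rw [wittEven_apply hD]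
  simp [vf_apply, LinearMap.sum_apply]

theorem coeff_coord_eq_zero {D : Module.End F (O F m n)} (hD : D ∈ wittEven F n p t)
    {b : Idx m n} {α : EvenIdx m → ℕ} {u : Finset (Fin n)}
    (h : (u.card : ZMod 2) ≠ mu b) : coeff α u (D (coord F b)) = 0 :=
  mem_monoSpan.1 (wittEven_coord_mem hD b) α u fun h' => h h'.2

end Truncated

end HamSuper

/-! ### Numerical parameters, quadratic Hamiltonians, and cocycles on potentials. -/

namespace HamSuper

variable {F : Type*} [Field F] {m n p : ℕ} {t : EvenIdx m → ℕ}

/-- The numerical assumptions on the parameters. -/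
structure Params (p m n : ℕ) (t : EvenIdx m → ℕ) : Prop where
  three_lt : 3 < p
  one_lt : 1 < m
  three_lt_odd : 3 < n
  pos : ∀ i, 0 < t i

theorem mono_mem_hamPot {α : EvenIdx m → ℕ} {u : Finset (Fin n)} (hα : α ≤ topExp p t)
    (hu : Even u.card) (h : α ≠ topExp p t ∨ u ≠ Finset.univ) :
    (mono α u : O F m n) ∈ hamPot F n p t := by
  refine mono_mem ⟨hα, ZMod.natCast_eq_zero_iff_even.2 hu, fun e => ?_⟩
  rw [Prod.mk.injEq] at e
  exact h.elim (fun h => h e.1) (fun h => h e.2)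

theorem Params.five_le (hP : Params p m n t) [hp : Fact p.Prime] : 5 ≤ p := by
  have h1 := hP.three_lt
  have h2 : p ≠ 4 := by rintro rfl; exact absurd hp.out (by norm_num)
  omega

theorem Params.four_le (hP : Params p m n t) [Fact p.Prime] (i : EvenIdx m) :
    4 ≤ topExp p t i := by
  have h1 : p ^ 1 ≤ p ^ t i := Nat.pow_le_pow_right (by have := hP.three_lt; omega) (hP.pos i)
  have h2 := hP.five_le
  simp only [topExp]
  rw [pow_one] at h1
  omega

theorem Params.univ_ne (hP : Params p m n t) : (∅ : Finset (Fin n)) ≠ Finset.univ := fun h => by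
  have := congrArg Finset.card h
  have h3 := hP.three_lt_odd
  simp at this
  omega

theorem Params.pure_mem (hP : Params p m n t) {α : EvenIdx m → ℕ} (hα : α ≤ topExp p t) :
    (mono α ∅ : O F m n) ∈ hamPot F n p t :=
  mono_mem_hamPot hα (by simp) (Or.inr hP.univ_ne)

theorem Params.single_le (hP : Params p m n t) [Fact p.Prime] (i : EvenIdx m) :
    (Pi.single i 1 : EvenIdx m → ℕ) ≤ topExp p t := fun j => by
  have := hP.four_le j
  rcases eq_or_ne j i with rfl | h
  · simp; omega
  · simp [Pi.single_eq_of_ne h]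

theorem Params.coord_mem (hP : Params p m n t) [Fact p.Prime] (i : EvenIdx m) :
    (coord F (Sum.inl i) : O F m n) ∈ hamPot F n p t :=
  hP.pure_mem (hP.single_le i)

theorem Params.quad_mem (hP : Params p m n t) [Fact p.Prime] (i j : EvenIdx m) :
    (coord F (Sum.inl i) * coord F (Sum.inl j) : O F m n) ∈ hamPot F n p t := by
  simp only [coord, Sum.elim_inl, mono_empty_mul_mono_empty]
  refine Submodule.smul_mem _ _ (hP.pure_mem fun k => ?_)
  have := hP.four_le k
  simp only [Pi.add_apply, Pi.single_apply]
  split_ifs <;> omega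

/-- `π_i = p^{t_i} - 1`. An entry at the top of its range is thus nonzero in the field, and `π_i +
1` vanishes there; both facts drive the case distinctions on `β`. -/
theorem Params.natCast_topExp (hP : Params p m n t) [Fact p.Prime] [CharP F p] (i : EvenIdx m) :
    ((topExp p t i : ℕ) : F) = -1 := by
  have h : 0 < p ^ t i := pow_pos (Nat.Prime.pos Fact.out) _
  rw [topExp, Nat.cast_sub h, Nat.cast_pow, CharP.cast_eq_zero, zero_pow (hP.pos i).ne']
  simp

theorem Params.two_ne_zero (hP : Params p m n t) [Fact p.Prime] [CharP F p] : (2 : F) ≠ 0 := by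
  have h := (CharP.cast_eq_zero_iff F p 2).not.2 fun h => by
    have := Nat.le_of_dvd two_pos h
    have := hP.three_lt
    omega
  exact_mod_cast h

theorem Params.three_ne_zero (hP : Params p m n t) [Fact p.Prime] [CharP F p] : (3 : F) ≠ 0 := by
  have h := (CharP.cast_eq_zero_iff F p 3).not.2 fun h => by
    have := Nat.le_of_dvd three_pos h
    have := hP.three_lt
    omega
  exact_mod_cast h

theorem tau_ne_zero (i : Idx m n) : tau F i ≠ 0 := by
  rcases i with (i | i) | k <;> simp [tau]

theorem tau_swap (i : EvenIdx m) :
    tau F (Sum.inl i.swap : Idx m n) = - tau F (Sum.inl i : Idx m n) := by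
  rcases i with i | i <;> simp [tau]

theorem swap_ne (i : EvenIdx m) : i.swap ≠ i := by
  rcases i with i | i <;> simp

theorem coord_mul_dEven (i : EvenIdx m) (γ : EvenIdx m → ℕ) (u : Finset (Fin n)) :
    coord F (Sum.inl i) * dEven i (mono γ u : O F m n) = (γ i : F) • mono γ u := by
  by_cases h : γ i = 0
  · simp [dEven_mono_zero h, h]
  · obtain ⟨δ, rfl⟩ := exists_eq_add_single h
    rw [dEven_mono_add, coord_mul_mono]
    simp

theorem DH_quad (i j : EvenIdx m) (f : O F m n) :
    DH (coord F (Sum.inl i) * coord F (Sum.inl j)) f =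
      tau F (Sum.inl j : Idx m n) • (coord F (Sum.inl i) * dEven j.swap f) +
      tau F (Sum.inl i : Idx m n) • (coord F (Sum.inl j) * dEven i.swap f) := by
  rw [DH_mul_arg (coord_inl_mem_par i) (coord_inl_mem_par j), DH_coord_even, DH_coord_even,
    mul_smul_comm, mul_smul_comm]

theorem dEven_coord (j : EvenIdx m) (b : Idx m n) :
    dEven j (coord F b) = if b = Sum.inl j then 1 else 0 := by
  have := d_coord (F := F) (Sum.inl j) b
  simp only [eq_comm (a := b)]
  exact this



section Cocycle

variable [Fact p.Prime] [CharP F p]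

/-- A linear map on potentials that behaves like a derivation `𝓗 → 𝒲`: `G(f)` is its value at
`D_H(f)`. -/
structure IsCocycle (p : ℕ) (t : EvenIdx m → ℕ) [Fact p.Prime] [CharP F p]
    (G : O F m n →ₗ[F] Module.End F (O F m n)) : Prop where
  mem : ∀ f ∈ hamPot F n p t, G f ∈ wittEven F n p t
  lie : ∀ f ∈ hamPot F n p t, ∀ g ∈ hamPot F n p t, ∀ h,
    G (DH f g) h = DH f (G g h) - G g (DH f h) - (DH g (G f h) - G f (DH g h))

/-- The constant part in the even variables of the `b`-component of `G(x^(β))`. -/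
noncomputable def lam (G : O F m n →ₗ[F] Module.End F (O F m n)) (b : Idx m n)
    (u : Finset (Fin n)) (β : EvenIdx m → ℕ) : F :=
  coeff 0 u (G (mono β ∅) (coord F b))

variable {G : O F m n →ₗ[F] Module.End F (O F m n)}

theorem IsCocycle.lie_of_eq_zero (hG : IsCocycle p t G) {f g : O F m n}
    (hf : f ∈ hamPot F n p t) (hg : g ∈ hamPot F n p t) (h0 : G f = 0) (h : O F m n) :
    G (DH f g) h = DH f (G g h) - G g (DH f h) := by
  rw [hG.lie f hf g hg, h0]
  simp

theorem wittEven_one {D : Module.End F (O F m n)} (hD : D ∈ wittEven F n p t) : D 1 = 0 := by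
  have := wittEven_mul hD 1 1
  simpa using this

/-- Bracketing with `x_{i'}` is `±∂_i`. As `G` kills `x_{i'}` and every field kills the constants
`∂_i(x_b)`, the cocycle identity reduces to commutation. -/
theorem IsCocycle.dEven_comm (hP : Params p m n t) (hG : IsCocycle p t G)
    (hlin : ∀ i, G (coord F (Sum.inl i)) = 0) {f : O F m n} (hf : f ∈ hamPot F n p t)
    (i : EvenIdx m) (b : Idx m n) :
    dEven i (G f (coord F b)) = G (dEven i f) (coord F b) := by
  have h := hG.lie_of_eq_zero (hP.coord_mem i.swap) hf (hlin i.swap) (coord F b)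
  rw [DH_coord_even, DH_coord_even, DH_coord_even, Sum.swap_swap, map_smul, map_smul,
    dEven_coord] at h
  have h1 : G f (if b = Sum.inl i then 1 else 0) = 0 := by
    split_ifs
    · exact wittEven_one (hG.mem f hf)
    · simp
  rw [h1, smul_zero, sub_zero] at h
  exact (smul_right_injective _ (tau_ne_zero (F := F) (Sum.inl i.swap : Idx m n)) h).symm

/-- The term `D_H(x_i x_j)(G(f)(x_b))` drops out: the coefficients of `D_H(x_i x_j)` are linear in
the even variables and vanish where these are zero. -/
theorem IsCocycle.quad_lie (hP : Params p m n t) (hG : IsCocycle p t G)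
    (hquad : ∀ i j, G (coord F (Sum.inl i) * coord F (Sum.inl j)) = 0) {f : O F m n}
    (hf : f ∈ hamPot F n p t) (i j : EvenIdx m) (b : Idx m n) (u : Finset (Fin n)) :
    coeff 0 u (G (DH (coord F (Sum.inl i) * coord F (Sum.inl j)) f) (coord F b)) =
      - coeff 0 u (G f (DH (coord F (Sum.inl i) * coord F (Sum.inl j)) (coord F b))) := by
  rw [hG.lie_of_eq_zero (hP.quad_mem i j) hf (hquad i j), map_sub, DH_quad, map_add, map_smul,
    map_smul]
  have hc : ∀ (k : EvenIdx m) (v : Finset (Fin n)), coeff 0 v (coord F (Sum.inl k) : O F m n) = 0 :=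
    fun k v => by
      rw [coord, Sum.elim_inl, coeff_mono, if_neg]
      rintro ⟨h, -⟩
      have := congrFun h k
      simp at this
  rw [coeff_zero_mul_left (hc i), coeff_zero_mul_left (hc j)]
  simp

/-- The relation between the values of `lam` given by a quadratic monomial. -/
theorem IsCocycle.quad_rel (hP : Params p m n t) (hG : IsCocycle p t G)
    (hquad : ∀ i j, G (coord F (Sum.inl i) * coord F (Sum.inl j)) = 0) {γ : EvenIdx m → ℕ}
    (hγ : γ ≤ topExp p t) (i j : EvenIdx m) (b : Idx m n) (u : Finset (Fin n)) :
    tau F (Sum.inl j : Idx m n) *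
        coeff 0 u (G (coord F (Sum.inl i) * dEven j.swap (mono γ ∅)) (coord F b)) +
      tau F (Sum.inl i : Idx m n) *
        coeff 0 u (G (coord F (Sum.inl j) * dEven i.swap (mono γ ∅)) (coord F b)) =
      - (tau F (Sum.inl j : Idx m n) * (if b = Sum.inl j.swap then lam G (Sum.inl i) u γ else 0) +
        tau F (Sum.inl i : Idx m n) *
          (if b = Sum.inl i.swap then lam G (Sum.inl j) u γ else 0)) := by
  have h := hG.quad_lie hP hquad (hP.pure_mem hγ) i j b u
  rw [DH_quad, DH_quad, dEven_coord, dEven_coord] at h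
  simp only [map_add, map_smul, LinearMap.add_apply, LinearMap.smul_apply, smul_eq_mul] at h
  rw [h]
  simp only [lam]
  split_ifs <;> simp

theorem lam_quad_mono (δ : EvenIdx m → ℕ) (i j : EvenIdx m) (b : Idx m n)
    (u : Finset (Fin n)) :
    coeff 0 u (G (coord F (Sum.inl i) * dEven j (mono (δ + Pi.single j 1) ∅)) (coord F b)) =
      ((δ i + 1 : ℕ) : F) * lam G b u (δ + Pi.single i 1) := by
  rw [dEven_mono_add, coord_mul_mono]
  simp [lam]

end Cocycle

end HamSuper

/-! ### Constraints on `lam` from quadratic and cubic functions. -/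

namespace HamSuper

variable {F : Type*} [Field F] {m n p : ℕ} {t : EvenIdx m → ℕ}
variable [Fact p.Prime] [CharP F p]
variable {G : O F m n →ₗ[F] Module.End F (O F m n)}

/-- The map vanishes on the fields of degree `-1`, on the quadratic functions of the even variables. -/
structure KillsQuad (G : O F m n →ₗ[F] Module.End F (O F m n)) : Prop where
  lin : ∀ i, G (coord F (Sum.inl i)) = 0
  quad : ∀ i j, G (coord F (Sum.inl i) * coord F (Sum.inl j)) = 0

theorem le_of_add_single {δ : EvenIdx m → ℕ} {i : EvenIdx m} {c : EvenIdx m → ℕ}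
    (h : δ + Pi.single i 1 ≤ c) : δ ≤ c :=
  le_trans le_self_add h

theorem add_single_le {δ c : EvenIdx m → ℕ} {j : EvenIdx m} (h : δ ≤ c) (hj : δ j < c j) :
    δ + Pi.single j 1 ≤ c := fun k => by
  rcases eq_or_ne k j with rfl | hk
  · simpa using hj
  · simpa [Pi.single_eq_of_ne hk] using h k

/-- Bracket `x_i²` with `x^(β - ε_i + ε_{i'})`: the result is `±2 β_i x^(β)`. Since `D_H(x_i²)`
annihilates every coordinate other than `x_{i'}`, the cocycle identity has zero right-hand side. -/
theorem lam_square (hP : Params p m n t) (hG : IsCocycle p t G) (hK : KillsQuad G)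
    {β : EvenIdx m → ℕ} (hβ : β ≤ topExp p t) {i : EvenIdx m} (h1 : (β i : F) ≠ 0)
    (h2 : β i.swap < topExp p t i.swap) {b : Idx m n} (hb : b ≠ Sum.inl i.swap)
    (u : Finset (Fin n)) : lam G b u β = 0 := by
  obtain ⟨δ, rfl⟩ := exists_eq_add_single (i := i) (α := β) (by rintro h; simp [h] at h1)
  have hle : δ + Pi.single i.swap 1 ≤ topExp p t := by
    refine add_single_le (le_of_add_single hβ) ?_
    simpa [Pi.single_eq_of_ne (swap_ne i)] using h2
  have h := hG.quad_rel hP hK.quad hle i i b u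
  rw [lam_quad_mono, if_neg hb, ← add_mul] at h
  simp only [mul_zero, add_zero, neg_zero] at h
  have ht : tau F (Sum.inl i : Idx m n) + tau F (Sum.inl i : Idx m n) ≠ 0 := by
    rw [← two_mul]
    exact mul_ne_zero hP.two_ne_zero (tau_ne_zero _)
  have h3 := (mul_eq_zero.1 h).resolve_left ht
  refine (mul_eq_zero.1 h3).resolve_left ?_
  simpa using h1

/-- The torus element `x_b x_{b'}` multiplies `x^(β)` by `±(β_{b'} - β_b)`, and the direction `∂_b`
has weight one for it with the same sign. A nonzero coefficient must respect weights. -/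
theorem lam_weight (hP : Params p m n t) (hG : IsCocycle p t G) (hK : KillsQuad G)
    {β : EvenIdx m → ℕ} (hβ : β ≤ topExp p t) {b : EvenIdx m} {u : Finset (Fin n)}
    (h0 : lam G (Sum.inl b) u β ≠ 0) : (β b.swap : F) = β b + 1 := by
  have h := hG.quad_rel hP hK.quad hβ b b.swap (Sum.inl b) u
  rw [Sum.swap_swap, coord_mul_dEven, coord_mul_dEven, if_pos rfl,
    if_neg (fun e => swap_ne b (Sum.inl_injective e).symm)] at h
  simp only [map_smul, LinearMap.smul_apply, smul_eq_mul, mul_zero, add_zero] at h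
  rw [tau_swap] at h
  have h1 : tau F (Sum.inl b : Idx m n) * lam G (Sum.inl b) u β * ((β b.swap : F) - (β b + 1)) = 0 := by
    simp only [lam] at h ⊢
    linear_combination h
  exact sub_eq_zero.1 ((mul_eq_zero.1 h1).resolve_left (mul_ne_zero (tau_ne_zero _) h0))

/-- As for `lam_square`, but with `x_i x_j` against `x^(β - ε_i + ε_{j'})`. The bracket now has a
second term; the assumption `β_i ≠ 1` is what allows `lam_square` to remove it. -/
theorem lam_mixed (hP : Params p m n t) (hG : IsCocycle p t G) (hK : KillsQuad G)
    {β : EvenIdx m → ℕ} (hβ : β ≤ topExp p t) {i j : EvenIdx m} (h1 : (β i : F) ≠ 0)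
    (h1' : (β i : F) ≠ 1) (h2 : β j.swap < topExp p t j.swap) (hij : i ≠ j) (hij' : i ≠ j.swap)
    {b : Idx m n} (hb : b ≠ Sum.inl i.swap) (hb' : b ≠ Sum.inl j.swap)
    (u : Finset (Fin n)) : lam G b u β = 0 := by
  obtain ⟨δ, rfl⟩ := exists_eq_add_single (i := i) (α := β) (by rintro h; simp [h] at h1)
  have hδ := le_of_add_single hβ
  have hle : δ + Pi.single j.swap 1 ≤ topExp p t := by
    refine add_single_le hδ ?_
    simpa [Pi.single_eq_of_ne hij'.symm] using h2
  have h := hG.quad_rel hP hK.quad hle i j b u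
  rw [lam_quad_mono, if_neg hb, if_neg hb'] at h
  -- The second term is `ε_j + 1` times the value at `ε + ε_j`. Its `i`-entry is `β_i - 1`, nonzero
  -- in the field, and its `i'`-entry has been lowered, so `lam_square` applies, unless `ε_j` is
  -- top, when the factor `ε_j + 1` is zero.
  have hz : coeff 0 u (G (coord F (Sum.inl j) * dEven i.swap (mono (δ + Pi.single j.swap 1) ∅))
      (coord F b)) = 0 := by
    by_cases h0 : (δ + Pi.single j.swap 1 : EvenIdx m → ℕ) i.swap = 0
    · rw [dEven_mono_zero h0]; simp
    · obtain ⟨ε, he⟩ := exists_eq_add_single h0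
      rw [he, lam_quad_mono]
      have hεle : ε ≤ topExp p t := le_of_add_single (he ▸ hle)
      have hεj : (ε j) = δ j := by
        have := congrFun he j
        simpa [Pi.single_eq_of_ne (swap_ne j).symm,
          Pi.single_eq_of_ne (show j ≠ i.swap from fun e => hij' (by rw [e, Sum.swap_swap]))]
          using this.symm
      have hεi : (ε i) = δ i := by
        have := congrFun he i
        simpa [Pi.single_eq_of_ne hij', Pi.single_eq_of_ne (swap_ne i).symm] using this.symm
      have hεi' : ε i.swap < topExp p t i.swap := by
        have := hle i.swap
        rw [he] at this
        simpa using this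
      rcases lt_or_eq_of_le (hεle j) with hlt | heq
      · refine mul_eq_zero_of_right _ (lam_square hP hG hK (i := i) (add_single_le hεle hlt)
          ?_ ?_ hb u)
        · simp only [Pi.add_apply, Pi.single_eq_of_ne hij, add_zero, hεi]
          simp only [Pi.add_apply, Pi.single_eq_same, Nat.cast_add, Nat.cast_one] at h1'
          intro e
          exact h1' (by rw [e, zero_add])
        · have : i.swap ≠ j := fun e => hij' (by rw [← e, Sum.swap_swap])
          simpa [Pi.single_eq_of_ne this] using hεi'
      · refine mul_eq_zero_of_left ?_ _
        rw [heq, Nat.cast_add, hP.natCast_topExp]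
        simp
  rw [hz] at h
  simp only [mul_zero, add_zero, neg_zero] at h
  have h3 := (mul_eq_zero.1 h).resolve_left (tau_ne_zero _)
  refine (mul_eq_zero.1 h3).resolve_left ?_
  simpa using h1

/-- Brackets of functions of order at least three do not contribute to `lam`. -/
theorem lam_bracket (hG : IsCocycle p t G) (hP : Params p m n t) {α γ : EvenIdx m → ℕ}
    (hα : α ≤ topExp p t) (hγ : γ ≤ topExp p t) (h3 : 3 ≤ ∑ i, α i) (h3' : 3 ≤ ∑ i, γ i)
    (b : Idx m n) (u : Finset (Fin n)) :
    coeff 0 u (G (DH (mono α ∅) (mono γ ∅)) (coord F b)) = 0 := by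
  -- For order at least three, both the first and the second derivatives of `x^(α)` lack a constant
  -- term. So neither applying `D_H(x^(α))` nor differentiating its components leaves anything at
  -- zero even variables.
  have key : ∀ {α γ : EvenIdx m → ℕ}, α ≤ topExp p t → γ ≤ topExp p t → 3 ≤ ∑ i, α i →
      coeff 0 u (DH (mono α ∅) (G (mono γ ∅) (coord F b)) -
        G (mono γ ∅) (DH (mono α ∅) (coord F b))) = 0 := by
    intro α γ hα hγ h3
    have c1 : ∀ i v, coeff 0 v (dEven i (mono α ∅ : O F m n)) = 0 := fun i v => by
      rw [coeff_dEven, coeff_mono, if_neg]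
      rintro ⟨rfl, -⟩
      simp at h3
    have c2 : ∀ i j v, coeff 0 v (dEven j (dEven i (mono α ∅ : O F m n))) = 0 := fun i j v => by
      rw [coeff_dEven, coeff_dEven, coeff_mono, if_neg]
      rintro ⟨rfl, -⟩
      simp [Finset.sum_add_distrib] at h3
    rw [map_sub, DH_mono_empty, map_sum, Finset.sum_eq_zero, zero_sub, neg_eq_zero,
      wittEven_apply (hG.mem _ (hP.pure_mem hγ)), map_sum]
    · refine Finset.sum_eq_zero fun a _ => coeff_zero_mul_right (fun v => ?_) _ _
      rw [DH_coord (mono_empty_mem_par α), map_smul, map_smul, smul_eq_mul]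
      refine mul_eq_zero_of_right _ ?_
      rcases b with b | l
      · rcases a with a | k
        · exact c2 _ _ v
        · change coeff 0 v (dOdd k (dEven _ _)) = 0
          rw [← dEven_dOdd_comm]
          simp [dOdd]
      · change coeff 0 v (d a (dOdd _ _)) = 0
        simp [dOdd]
    · intro i _
      rw [map_smul, coeff_zero_mul_left (c1 i), smul_zero]
  rw [hG.lie _ (hP.pure_mem hα) _ (hP.pure_mem hγ), map_sub, key hα hγ h3, key hγ hα h3', sub_zero]

/-- This excludes the one weight left open by `lam_square` and `lam_weight`: bracketing `x_b²
x_{b'}` with `x^(β - ε_b)` reproduces `x^(β)` with an invertible factor, and both functions have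
order at least three. -/
theorem lam_cubic (hP : Params p m n t) (hG : IsCocycle p t G)
    {β : EvenIdx m → ℕ} (hβ : β ≤ topExp p t) {b : EvenIdx m} (h1 : (β b : F) = -2)
    (h2 : (β b.swap : F) = -1) (c : Idx m n) (u : Finset (Fin n)) : lam G c u β = 0 := by
  have h2ne := hP.two_ne_zero (F := F)
  have h3ne := hP.three_ne_zero (F := F)
  obtain ⟨γ, rfl⟩ := exists_eq_add_single (i := b) (α := β) (by
    rintro h; rw [h, Nat.cast_zero] at h1; exact h2ne (neg_eq_zero.1 h1.symm))
  have hγ := le_of_add_single hβ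
  simp only [Pi.add_apply, Pi.single_eq_same, Pi.single_eq_of_ne (swap_ne b), add_zero,
    Nat.cast_add, Nat.cast_one] at h1 h2
  have h3' : 3 ≤ ∑ i, γ i := by
    -- The residue of `γ_{b'}` is `-1`; the values 0, 1, 2 would make 1, 2 or 3 vanish in the field.
    have : 3 ≤ γ b.swap := by
      by_contra hlt
      have : γ b.swap = 0 ∨ γ b.swap = 1 ∨ γ b.swap = 2 := by omega
      rcases this with h | h | h <;> rw [h] at h2 <;> norm_num at h2
      · exact h2ne (by linear_combination h2)
      · exact h3ne (by linear_combination h2)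
    exact this.trans (Finset.single_le_sum (f := γ) (fun _ _ => Nat.zero_le _) (Finset.mem_univ _))
  set α : EvenIdx m → ℕ := Pi.single b 1 + Pi.single b 1 + Pi.single b.swap 1 with hαdef
  have hα : α ≤ topExp p t := fun k => by
    have := hP.four_le k
    simp only [hαdef, Pi.add_apply, Pi.single_apply]
    split_ifs <;> omega
  have hm : ∃ c : F, coord F (Sum.inl b) * coord F (Sum.inl b) * coord F (Sum.inl b.swap) =
      c • (mono α ∅ : O F m n) := by
    refine ⟨(multiBinom (Pi.single b 1) (Pi.single b 1) : F) *
      multiBinom (Pi.single b 1 + Pi.single b 1) (Pi.single b.swap 1), ?_⟩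
    simp only [coord, Sum.elim_inl, mono_empty_mul_mono_empty, smul_mul_assoc, smul_smul]
    rfl
  obtain ⟨c', hc'⟩ := hm
  have hbr := lam_bracket hG hP hα hγ (by simp [hαdef, Finset.sum_add_distrib]) h3' c u
  have e1 : DH (coord F (Sum.inl b) * coord F (Sum.inl b) * coord F (Sum.inl b.swap))
      (mono γ ∅ : O F m n) = (tau F (Sum.inl b : Idx m n) * ((γ b + 1) * (2 * γ b.swap - γ b))) •
        mono (γ + Pi.single b 1) ∅ := by
    have hb := coord_inl_mem_par (F := F) (n := n) b
    have hb' := coord_inl_mem_par (F := F) (n := n) b.swap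
    have hbb : coord F (Sum.inl b) * coord F (Sum.inl b) ∈ par F m n 0 := by
      simpa using mul_mem_par hb hb
    rw [DH_mul_arg hbb hb', DH_mul_arg hb hb, DH_coord_even, DH_coord_even, Sum.swap_swap]
    simp only [mul_smul_comm, mul_add, tau_swap]
    rw [mul_assoc (coord F (Sum.inl b)), coord_mul_dEven, ← mul_assoc,
      mul_comm_of_even hb', mul_assoc, coord_mul_dEven, mul_smul_comm, mul_smul_comm,
      coord_mul_mono]
    simp only [smul_smul, ← add_smul]
    congr 1
    push_cast
    ring
  rw [hc', map_smul, LinearMap.smul_apply] at e1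
  have e2 := congrArg (fun h => coeff 0 u (G h (coord F c))) e1
  simp only [map_smul, LinearMap.smul_apply, hbr, mul_zero, smul_eq_mul] at e2
  refine (mul_eq_zero.1 e2.symm).resolve_left (mul_ne_zero (tau_ne_zero _) ?_)
  have h4 : (γ b : F) = -3 := by linear_combination h1
  -- With `γ_b = -3` and `γ_{b'} = -1` the factor `(γ_b + 1)(2γ_{b'} - γ_b)` equals `-2`.
  rw [h2, h4]
  norm_num
  exact h2ne
end HamSuper

/-! ### Splitting multi-indices divisible by `p`. -/

namespace HamSuper

variable {F : Type*} [Field F] {m n p : ℕ} {t : EvenIdx m → ℕ}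
variable [Fact p.Prime] [CharP F p]
variable {G : O F m n →ₗ[F] Module.End F (O F m n)}

/-- Lucas' congruence strips one factor `p` from both entries at each step, down to `binom c 1 = c`.
-/
theorem choose_pow_mul_modEq (s c : ℕ) : (p ^ s * c).choose (p ^ s) ≡ c [MOD p] := by
  induction s with
  | zero => simp [Nat.ModEq.refl]
  | succ s ih =>
    have hp : 0 < p := (Fact.out : p.Prime).pos
    have h := Choose.choose_modEq_choose_mod_mul_choose_div_nat
      (n := p ^ (s + 1) * c) (k := p ^ (s + 1)) (p := p)
    have e1 : p ^ (s + 1) * c = p * (p ^ s * c) := by ring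
    have e2 : p ^ (s + 1) = p * p ^ s := by ring
    rw [e1, e2, Nat.mul_mod_right, Nat.mul_mod_right, Nat.mul_div_cancel_left _ hp,
      Nat.mul_div_cancel_left _ hp, Nat.choose_self, one_mul] at h
    rw [e1, e2]
    exact h.trans ih

/-- A multi-index divisible by `p` that is not a power of `p` times a unit vector splits with a
nonvanishing binomial coefficient. -/
theorem exists_split {δ : EvenIdx m → ℕ} (hδ : ∀ i, p ∣ δ i) (h0 : δ ≠ 0)
    (h1 : ∀ r s, δ ≠ Pi.single r (p ^ s)) :
    ∃ γ ε : EvenIdx m → ℕ, δ = γ + ε ∧ γ ≠ 0 ∧ ε ≠ 0 ∧ (∀ i, p ∣ γ i) ∧ (∀ i, p ∣ ε i) ∧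
      (multiBinom γ ε : F) ≠ 0 := by
  obtain ⟨r, hr⟩ : ∃ r, δ r ≠ 0 := by
    by_contra h
    exact h0 (funext fun i => by_contra fun h' => h ⟨i, h'⟩)
  -- With two nonzero entries, splitting off a whole entry gives binomial coefficient one.
  by_cases h2 : ∃ r', r' ≠ r ∧ δ r' ≠ 0
  · obtain ⟨r', hr', hne⟩ := h2
    refine ⟨Pi.single r (δ r), Function.update δ r 0, ?_, ?_, ?_, fun i => ?_, fun i => ?_, ?_⟩
    · funext i
      rcases eq_or_ne i r with rfl | h <;> simp [*]
    · intro h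
      exact hr (by simpa using congrFun h r)
    · intro h
      exact hne (by simpa [hr'] using congrFun h r')
    · rcases eq_or_ne i r with rfl | h <;> simp [*]
    · rcases eq_or_ne i r with rfl | h <;> simp [*]
    · have : multiBinom (Pi.single r (δ r)) (Function.update δ r 0) = 1 := by
        refine Finset.prod_eq_one fun i _ => ?_
        rcases eq_or_ne i r with rfl | h <;> simp [*]
      rw [this]
      simp
  · have hs : δ = Pi.single r (δ r) := by
      funext i
      rcases eq_or_ne i r with rfl | h
      · simp
      · rw [Pi.single_eq_of_ne h]
        exact by_contra fun h' => h2 ⟨i, h, h'⟩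
    have hp1 : p ≠ 1 := (Fact.out : p.Prime).ne_one
    obtain ⟨s, c, hc, hb⟩ := Nat.exists_eq_pow_mul_and_not_dvd hr p hp1
    have hc0 : c ≠ 0 := by rintro rfl; simp at hc
    have hc1 : c ≠ 1 := by
      rintro rfl
      rw [mul_one] at hb
      exact h1 r s (by rw [← hb]; exact hs)
    have hs0 : s ≠ 0 := by
      rintro rfl
      rw [pow_zero, one_mul] at hb
      exact hc (hb ▸ hδ r)
    have hps : p ^ s ≠ 0 := pow_ne_zero _ (Fact.out : p.Prime).ne_zero
    have hd : p ∣ p ^ s := dvd_pow_self p hs0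
    -- The single entry is `p^s c` with `p ∤ c` and `c ≠ 1`. Splitting off `p^s` gives a binomial
    -- coefficient congruent to `c`.
    refine ⟨Pi.single r (p ^ s), Pi.single r (p ^ s * (c - 1)), ?_, ?_, ?_, fun i => ?_,
      fun i => ?_, ?_⟩
    · rw [← Pi.single_add, hs, hb]
      congr 1
      obtain ⟨c, rfl⟩ := Nat.exists_eq_succ_of_ne_zero hc0
      simp
      ring
    · intro h
      exact hps (by simpa using congrFun h r)
    · intro h
      have := congrFun h r
      simp only [Pi.single_eq_same, Pi.zero_apply, mul_eq_zero] at this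
      omega
    · rcases eq_or_ne i r with rfl | h <;> simp [*]
    · rcases eq_or_ne i r with rfl | h
      · simpa using hd.mul_right _
      · simp [h]
    · have : multiBinom (Pi.single r (p ^ s)) (Pi.single r (p ^ s * (c - 1)) : EvenIdx m → ℕ) =
          (p ^ s * c).choose (p ^ s) := by
        rw [multiBinom, Finset.prod_eq_single r]
        · simp only [Pi.single_eq_same]
          congr 1
          obtain ⟨c, rfl⟩ := Nat.exists_eq_succ_of_ne_zero hc0
          simp
          ring
        · intro j _ hj
          simp [hj]
        · simp
      rw [this]
      intro h
      rw [CharP.cast_eq_zero_iff F p] at h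
      exact hc ((choose_pow_mul_modEq s c).dvd_iff (dvd_refl p) |>.1 h)

/-- The factor `γ_i + 1` produced by multiplying with `x_i` is one when `p` divides `γ_i`. -/
theorem coord_mul_of_dvd {γ : EvenIdx m → ℕ} {i : EvenIdx m} (h : p ∣ γ i)
    (u : Finset (Fin n)) :
    (mono (γ + Pi.single i 1) u : O F m n) = coord F (Sum.inl i) * mono γ u := by
  rw [coord_mul_mono, Nat.cast_add, (CharP.cast_eq_zero_iff F p _).2 h]
  simp

/-- The bracket that splits a multi-index divisible by `p`. -/
theorem lam_split (hP : Params p m n t) (hG : IsCocycle p t G) (hK : KillsQuad G)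
    {γ ε θ : EvenIdx m → ℕ} {i : EvenIdx m} (hθ : θ = 0 ∨ θ = Pi.single i.swap 1)
    (hγ0 : γ ≠ 0) (hε0 : ε ≠ 0) (hγ : ∀ j, p ∣ γ j) (hε : ∀ j, p ∣ ε j)
    (hle : γ + ε ≤ topExp p t) (hne : (multiBinom γ ε : F) ≠ 0) {b : Idx m n}
    (hb : ∀ j, j ≠ i → j ≠ i.swap → b ≠ Sum.inl j.swap) (u : Finset (Fin n)) :
    lam G b u (γ + ε + θ) = 0 := by
  have hp5 := hP.five_le
  have hθi : θ i = 0 := by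
    rcases hθ with rfl | rfl
    · rfl
    · simp [Pi.single_eq_of_ne (swap_ne i).symm]
  have hθi' : θ i.swap ≤ 1 := by rcases hθ with rfl | rfl <;> simp
  have hθj : ∀ j, j ≠ i.swap → θ j = 0 := fun j hj => by
    rcases hθ with rfl | rfl
    · rfl
    · simp [hj]
  -- The largest multiple of `p` not exceeding `p^{t_j} - 1` is `p^{t_j} - p`, so there is room for
  -- two more.
  have hlt : ∀ {x : ℕ} {j}, p ∣ x → x ≤ topExp p t j → x + 2 ≤ topExp p t j := by
    intro x j hx hxle
    obtain ⟨a, rfl⟩ := hx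
    obtain ⟨s, hs⟩ := Nat.exists_eq_succ_of_ne_zero (hP.pos j).ne'
    simp only [topExp, hs, Nat.succ_eq_add_one, pow_succ] at hxle ⊢
    have h1 : p * a < p ^ s * p := by
      have : 0 < p ^ s * p := by positivity
      omega
    rw [mul_comm] at h1
    have h2 : a < p ^ s := lt_of_mul_lt_mul_right h1 (Nat.zero_le _)
    have h3 : p * (a + 1) ≤ p * p ^ s := Nat.mul_le_mul_left p h2
    rw [mul_comm (p ^ s)]
    rw [mul_add] at h3
    omega
  have big : ∀ {x : EvenIdx m → ℕ}, x ≠ 0 → (∀ j, p ∣ x j) → 3 ≤ ∑ j, x j := by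
    intro x hx hd
    obtain ⟨r, hr⟩ : ∃ r, x r ≠ 0 := by
      by_contra h
      exact hx (funext fun i => by_contra fun h' => h ⟨i, h'⟩)
    have h1 := Nat.le_of_dvd (Nat.pos_of_ne_zero hr) (hd r)
    have h2 := Finset.single_le_sum (f := x) (fun _ _ => Nat.zero_le _) (Finset.mem_univ r)
    omega
  have hγle : γ ≤ topExp p t := le_trans le_self_add hle
  have hεle : ε ≤ topExp p t := le_trans le_add_self hle
  have hα : γ + Pi.single i 1 ≤ topExp p t :=
    add_single_le hγle (by have := hlt (hγ i) (hγle i); omega)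
  have hεθ : ε + θ + Pi.single i.swap 1 ≤ topExp p t := fun j => by
    have h1 := hlt (hε j) (hεle j)
    simp only [Pi.add_apply]
    rcases eq_or_ne j i.swap with rfl | hj
    · simp; omega
    · simp [hj, hθj j hj]; omega
  -- The bracket of `x^(γ+ε_i)` with `x^(ε+θ+ε_{i'})`: its `i`-th summand is the binomial
  -- coefficient times `x^(γ+ε+θ)` up to sign, and all other summands contribute nothing to `lam`.
  have hbr := lam_bracket hG hP hα hεθ
    ((big hγ0 hγ).trans (by simp [Finset.sum_add_distrib]))
    ((big hε0 hε).trans (by simp [Finset.sum_add_distrib]; omega)) b u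
  rw [DH_mono_empty, map_sum, LinearMap.sum_apply, map_sum, Finset.sum_eq_single i] at hbr
  · rw [dEven_mono_add, dEven_mono_add] at hbr
    have e : (mono γ ∅ * mono (ε + θ) ∅ : O F m n) =
        (multiBinom γ ε : F) • mono (γ + ε + θ) ∅ := by
      rcases hθ with rfl | rfl
      · rw [add_zero, add_zero, mono_empty_mul_mono_empty]
      · rw [coord_mul_of_dvd (hε _), coord_mul_of_dvd (dvd_add (hγ _) (hε _)),
          ← mul_assoc, ← mul_comm_of_even (coord_inl_mem_par _), mul_assoc,
          mono_empty_mul_mono_empty, mul_smul_comm]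
    rw [e, map_smul, map_smul, LinearMap.smul_apply, LinearMap.smul_apply, map_smul, map_smul,
      smul_eq_mul, smul_eq_mul] at hbr
    exact (mul_eq_zero.1 ((mul_eq_zero.1 hbr).resolve_left (tau_ne_zero _))).resolve_left hne
  · intro j _ hji
    rw [map_smul, LinearMap.smul_apply, map_smul]
    refine smul_eq_zero_of_right _ ?_
    rcases eq_or_ne j i.swap with rfl | hji'
    · have e : (dEven i.swap (mono (γ + Pi.single i 1) ∅) *
          dEven i.swap.swap (mono (ε + θ + Pi.single i.swap 1) ∅) : O F m n) = 0 := by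
        rw [Sum.swap_swap, coord_mul_of_dvd (hγ i), dEven_mul, dEven_coord, if_neg
          (fun e => swap_ne i (Sum.inl_injective e).symm), zero_mul, zero_add,
          mul_comm_of_even (coord_inl_mem_par i), mul_assoc, coord_mul_dEven]
        have : (((ε + θ + Pi.single i.swap 1 : EvenIdx m → ℕ) i : ℕ) : F) = 0 := by
          rw [CharP.cast_eq_zero_iff F p]
          simpa [hθi, Pi.single_eq_of_ne (swap_ne i).symm] using hε i
        rw [this, zero_smul, mul_zero]
      rw [e]
      simp
    · have hsj : j.swap ≠ i.swap := fun e => hji (by rw [← Sum.swap_swap j, e, Sum.swap_swap])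
      have hsj' : j.swap ≠ i := fun e => hji' (by rw [← e, Sum.swap_swap])
      by_cases h1 : γ j = 0
      · rw [dEven_mono_zero (by simp [h1, hji])]
        simp
      by_cases h2 : ε j.swap = 0
      · rw [dEven_mono_zero (i := j.swap) (by simp [h2, hsj, hθj _ hsj])]
        simp
      obtain ⟨γ', rfl⟩ := exists_eq_add_single h1
      obtain ⟨ε', rfl⟩ := exists_eq_add_single h2
      have e1 : γ' + Pi.single j 1 + Pi.single i 1 = γ' + Pi.single i 1 + Pi.single j 1 := by abel
      have e2 : ε' + Pi.single j.swap 1 + θ + Pi.single i.swap 1 =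
        ε' + θ + Pi.single i.swap 1 + Pi.single j.swap 1 := by abel
      rw [e1, e2, dEven_mono_add, dEven_mono_add, mono_empty_mul_mono_empty, map_smul,
        LinearMap.smul_apply, map_smul]
      refine smul_eq_zero_of_right _ ?_
      have hlej := hle j
      have hlej' := hle j.swap
      -- In the resulting multi-index the `j`-entry is `-1` modulo `p` and the `j'`-entry, lowered
      -- by one, is below the top: `lam_square` applies at `j`.
      have hdj : (p : ℕ) ∣ γ' j + 1 + ε' j := by
        have := dvd_add (hγ j) (hε j)
        simpa [Pi.single_eq_of_ne (swap_ne j).symm] using this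
      refine lam_square hP hG hK (i := j) (fun k => ?_) ?_ ?_ (hb j hji hji') u
      · have h3 := hle k
        have h4 := hlt (dvd_add (hγ k) (hε k)) h3
        have h5 : θ k ≤ if k = i.swap then 1 else 0 := by
          split_ifs with h
          · subst h; exact hθi'
          · rw [hθj k h]
        simp only [Pi.add_apply, Pi.single_apply] at h4 h5 ⊢
        have h6 : ¬ (k = i ∧ k = i.swap) := fun h => swap_ne i (h.2.symm.trans h.1)
        split_ifs at h4 h5 ⊢ <;> first | omega | (exfalso; apply h6; constructor <;> assumption)
      · intro h
        have h7 : (p : ℕ) ∣ γ' j + ε' j := by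
          rw [CharP.cast_eq_zero_iff F p] at h
          simpa [hji, hji', hθj j hji'] using h
        have : p ∣ 1 := by
          have := (Nat.dvd_sub hdj h7)
          have e : γ' j + 1 + ε' j - (γ' j + ε' j) = 1 := by omega
          rwa [e] at this
        have := Nat.le_of_dvd one_pos this
        omega
      · simp only [Pi.add_apply, Pi.single_eq_of_ne hsj, Pi.single_eq_of_ne hsj',
          Pi.single_eq_of_ne (swap_ne j), Pi.single_eq_same, hθj _ hsj] at hlej' ⊢
        omega
  · simp

end HamSuper

/-! ### The exceptional multi-indices. -/

namespace HamSuper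

variable {F : Type*} [Field F] {m n p : ℕ} {t : EvenIdx m → ℕ}
variable [Fact p.Prime] [CharP F p]
variable {G : O F m n →ₗ[F] Module.End F (O F m n)}

theorem Params.exp_lt (hP : Params p m n t) {s : ℕ} {r : EvenIdx m} (hs : 1 ≤ s)
    (h : p ^ s ≤ topExp p t r) : 1 ≤ s ∧ s ≤ t r - 1 := by
  refine ⟨hs, ?_⟩
  have hp : 1 < p := by have := hP.three_lt; omega
  have h1 : p ^ s < p ^ t r := by
    have : 0 < p ^ t r := by positivity
    simp only [topExp] at h
    omega
  have := (Nat.pow_lt_pow_iff_right hp).1 h1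
  omega

theorem not_dvd_single (hP : Params p m n t) {r : EvenIdx m} {s : ℕ} {δ : EvenIdx m → ℕ}
    (hd : ∀ j, p ∣ δ j) (h : δ = Pi.single r (p ^ s)) : 1 ≤ s := by
  by_contra hs
  have hs0 : s = 0 := by omega
  subst hs0
  have := hd r
  rw [h] at this
  simp only [pow_zero, Pi.single_eq_same, Nat.dvd_one] at this
  have := hP.three_lt
  omega

/-- The odd components of `G(x^(β))` can only be nonzero modulo the even variables if `β` is top or a
power of `p` times a unit vector. -/
theorem lam_odd_special (hP : Params p m n t) (hG : IsCocycle p t G) (hK : KillsQuad G)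
    {β : EvenIdx m → ℕ} (hβ : β ≤ topExp p t) {k : Fin n} {u : Finset (Fin n)}
    (h0 : lam G (Sum.inr k) u β ≠ 0) (hβ0 : β ≠ 0) :
    β = topExp p t ∨ ∃ r s, (1 ≤ s ∧ s ≤ t r - 1) ∧ β = Pi.single r (p ^ s) := by
  by_cases htop : β = topExp p t
  · exact Or.inl htop
  right
  -- Odd directions are never the excluded direction of `lam_square`, so an entry prime to `p`
  -- forces its conjugate to the top.
  have h1 : ∀ i, (β i : F) ≠ 0 → β i.swap = topExp p t i.swap := fun i hi => by
    by_contra hne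
    exact h0 (lam_square hP hG hK hβ hi (lt_of_le_of_ne (hβ _) hne) (by simp) u)
  have h2 : ∀ i, (β i : F) = 0 := fun i => by
    by_contra hi
    have e1 := h1 i hi
    have e2 : β i = topExp p t i := by
      have := h1 i.swap (by rw [e1, hP.natCast_topExp]; simp)
      rwa [Sum.swap_swap] at this
    obtain ⟨j, hj⟩ : ∃ j, β j ≠ topExp p t j := by
      by_contra h
      exact htop (funext fun i => by_contra fun h' => h ⟨i, h'⟩)
    have hji : j ≠ i := fun e => hj (e ▸ e2)
    have hji' : j ≠ i.swap := fun e => hj (e ▸ e1)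
    -- The pair `i, i'` is at the top, so `β_i = -1` is neither 0 nor 1, and the room at `j` permits
    -- the use of `x_i x_{j'}`.
    refine h0 (lam_mixed hP hG hK hβ (i := i) (j := j.swap) hi ?_ ?_ ?_ ?_ (by simp) (by simp) u)
    · rw [e2, hP.natCast_topExp]
      intro h
      exact hP.two_ne_zero (F := F) (by linear_combination -h)
    · rw [Sum.swap_swap]
      exact lt_of_le_of_ne (hβ _) hj
    · rintro rfl; exact hji' (by rw [Sum.swap_swap])
    · rw [Sum.swap_swap]; exact hji.symm
  have h3 : ∀ i, p ∣ β i := fun i => (CharP.cast_eq_zero_iff F p _).1 (h2 i)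
  by_cases h4 : ∀ r s, β ≠ Pi.single r (p ^ s)
  · obtain ⟨γ, ε, rfl, hγ0, hε0, hγ, hε, hne⟩ := exists_split (F := F) h3 hβ0 h4
    have := lam_split hP hG hK (θ := 0) (i := Sum.inl ⟨0, by have := hP.one_lt; omega⟩)
      (Or.inl rfl) hγ0 hε0 hγ hε hβ hne (b := Sum.inr k) (by simp) u
    exact absurd this h0
  · push Not at h4
    obtain ⟨r, s, h⟩ := h4
    refine ⟨r, s, hP.exp_lt (not_dvd_single hP h3 h) ?_, h⟩
    have := hβ r
    rwa [h, Pi.single_eq_same] at this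

/-- The even components of `G(x^(β))` can only be nonzero modulo the even variables for special `β`. -/
theorem lam_even_special (hP : Params p m n t) (hG : IsCocycle p t G) (hK : KillsQuad G)
    {β : EvenIdx m → ℕ} (hβ : β ≤ topExp p t) {b : EvenIdx m} {u : Finset (Fin n)}
    (h0 : lam G (Sum.inl b) u β ≠ 0) :
    ∃ r s, (1 ≤ s ∧ s ≤ t r - 1) ∧ β = Pi.single r (p ^ s) + Pi.single b.swap 1 := by
  have h2ne := hP.two_ne_zero (F := F)
  have hw := lam_weight hP hG hK hβ h0
  have hsq : ∀ i, i ≠ b.swap → (β i : F) ≠ 0 → β i.swap = topExp p t i.swap := fun i hib hi => by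
    by_contra hne
    refine h0 (lam_square hP hG hK hβ hi (lt_of_le_of_ne (hβ _) hne) ?_ u)
    intro e
    exact hib (by rw [Sum.inl_injective e, Sum.swap_swap])
  -- Otherwise `β_{b'}` is at the top, hence `-1`, and the weight relation gives `β_b = -2`: the
  -- case of `lam_cubic`.
  have hb : (β b : F) = 0 := by
    by_contra hb
    have e := hsq b (swap_ne b).symm hb
    have e1 : (β b.swap : F) = -1 := by rw [e, hP.natCast_topExp]
    exact h0 (lam_cubic hP hG hβ (b := b) (by linear_combination e1 - hw) e1 _ u)
  rw [hb, zero_add] at hw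
  have hlt : β b.swap < topExp p t b.swap := by
    refine lt_of_le_of_ne (hβ _) fun e => ?_
    rw [e, hP.natCast_topExp] at hw
    exact h2ne (by linear_combination -hw)
  -- A further entry prime to `p` would put both `i` and `i'` at the top; then `x_i x_b`, using the
  -- room at `b'`, forces the value to be zero.
  have ho : ∀ i, i ≠ b → i ≠ b.swap → (β i : F) = 0 := fun i hib hib' => by
    by_contra hi
    have hbi : b ≠ i.swap := fun e => hib' (by rw [e, Sum.swap_swap])
    have e1 := hsq i hib' hi
    have e2 : β i = topExp p t i := by
      have := hsq i.swap (fun e => hib (by rw [← Sum.swap_swap i, e, Sum.swap_swap]))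
        (by rw [e1, hP.natCast_topExp]; simp)
      rwa [Sum.swap_swap] at this
    refine h0 (lam_mixed hP hG hK hβ (i := i) (j := b) hi ?_ hlt hib hib' ?_ ?_ u)
    · rw [e2, hP.natCast_topExp]
      intro h
      exact h2ne (by linear_combination -h)
    · exact fun e => hbi (Sum.inl_injective e)
    · exact fun e => swap_ne b (Sum.inl_injective e).symm
  obtain ⟨δ, rfl⟩ := exists_eq_add_single (i := b.swap) (α := β) (by
    intro h
    rw [h] at hw
    simp at hw)
  have hd : ∀ i, p ∣ δ i := fun i => by
    rw [← CharP.cast_eq_zero_iff F p]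
    rcases eq_or_ne i b.swap with rfl | h
    · simpa using hw
    · rcases eq_or_ne i b with rfl | h'
      · simpa [h] using hb
      · simpa [h] using ho i h' h
  -- For `δ = 0` the function is the coordinate `x_{b'}`, which `G` kills.
  have hδ0 : δ ≠ 0 := by
    rintro rfl
    refine h0 ?_
    have := hK.lin b.swap
    rw [coord, Sum.elim_inl] at this
    rw [lam, zero_add, this]
    simp
  by_cases h4 : ∀ r s, δ ≠ Pi.single r (p ^ s)
  · obtain ⟨γ, ε, rfl, hγ0, hε0, hγ, hε, hne⟩ := exists_split (F := F) hd hδ0 h4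
    have := lam_split hP hG hK (θ := Pi.single b.swap 1) (i := b)
      (Or.inr rfl) hγ0 hε0 hγ hε (le_of_add_single hβ) hne (b := Sum.inl b)
      (fun j _ hj e => hj (by rw [Sum.inl_injective e, Sum.swap_swap])) u
    exact absurd this h0
  · push Not at h4
    obtain ⟨r, s, h⟩ := h4
    refine ⟨r, s, hP.exp_lt (not_dvd_single hP hd h) ?_, by rw [h]⟩
    have := (le_of_add_single hβ) r
    rwa [h, Pi.single_eq_same] at this

/-- One special value of `lam` determines the others. -/
theorem lam_spread (hP : Params p m n t) (hG : IsCocycle p t G) (hK : KillsQuad G)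
    {r : EvenIdx m} {s : ℕ} (hs : 1 ≤ s ∧ s ≤ t r - 1) {u : Finset (Fin n)}
    (h0 : lam G (Sum.inl r) u (Pi.single r (p ^ s) + Pi.single r.swap 1) = 0) (b : EvenIdx m) :
    lam G (Sum.inl b) u (Pi.single r (p ^ s) + Pi.single b.swap 1) = 0 := by
  rcases eq_or_ne b r with rfl | hbr
  · exact h0
  have hd : p ∣ p ^ s := dvd_pow_self p (by omega)
  have hps : ((p ^ s : ℕ) : F) = 0 := (CharP.cast_eq_zero_iff F p _).2 hd
  have hle : (Pi.single r (p ^ s) + Pi.single r.swap 1 : EvenIdx m → ℕ) ≤ topExp p t := by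
    refine add_single_le (fun j => ?_) ?_
    · rcases eq_or_ne j r with rfl | h
      · have h1 : p ^ s < p ^ t j :=
          Nat.pow_lt_pow_right (by have := hP.three_lt; omega) (by have := hP.pos j; omega)
        simp only [Pi.single_eq_same, topExp]
        omega
      · simp [h]
    · rw [Pi.single_eq_of_ne (swap_ne r)]
      have := hP.four_le r.swap
      omega
  -- Acting by `x_{b'} x_r` on `x^(p^s ε_r + ε_{r'})` produces the index `p^s ε_r + ε_{b'}`. The
  -- other contributions are multiples of the vanishing value at `r`, or are zero, or, for `b = r'`,
  -- a second copy of the wanted term.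
  have h := hG.quad_rel hP hK.quad hle b.swap r (Sum.inl b) u
  have hz : (if (Sum.inl b : Idx m n) = Sum.inl r.swap then lam G (Sum.inl b.swap) u
      (Pi.single r (p ^ s) + Pi.single r.swap 1) else 0) = 0 := by
    split_ifs with hb
    · obtain rfl := Sum.inl_injective hb
      rw [Sum.swap_swap]
      exact h0
    · rfl
  rw [hz, Sum.swap_swap, h0, if_pos rfl, mul_zero, mul_zero, add_zero, neg_zero,
    lam_quad_mono, tau_swap] at h
  have hc : ((((Pi.single r (p ^ s) : EvenIdx m → ℕ) b.swap + 1 : ℕ)) : F) = 1 := by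
    rcases eq_or_ne b.swap r with h | h
    · rw [h, Pi.single_eq_same, Nat.cast_add, hps, zero_add, Nat.cast_one]
    · rw [Pi.single_eq_of_ne h]
      simp
  rw [hc, one_mul] at h
  rcases eq_or_ne b r.swap with rfl | hb
  · have e : (dEven r.swap (mono (Pi.single r (p ^ s) + Pi.single r.swap 1) ∅) : O F m n) =
        mono (Pi.single r (p ^ s)) ∅ := dEven_mono_add _ _ _
    rw [e, ← coord_mul_of_dvd (p := p) (by simpa using hd)] at h
    rw [Sum.swap_swap] at h ⊢
    rw [tau_swap, neg_neg] at h
    change _ + _ * lam G _ _ _ = 0 at h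
    rw [← add_mul, ← two_mul] at h
    exact (mul_eq_zero.1 h).resolve_left (mul_ne_zero hP.two_ne_zero (tau_ne_zero _))
  · rw [dEven_mono_zero (i := b) (by simp [hb, hbr])] at h
    simp only [mul_zero, map_zero, LinearMap.zero_apply, add_zero] at h
    exact (mul_eq_zero.1 h).resolve_left (tau_ne_zero _)

end HamSuper

/-! ### Rotations in the odd variables and their invariants. -/

namespace HamSuper

section Rotations

variable {F : Type*} [Field F] {m n : ℕ}

/-- The quadratic monomial `x_k x_l` in the odd variables. -/
noncomputable def rot (F : Type*) [Field F] {m n : ℕ} (k l : Fin n) : O F m n :=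
  coord F (Sum.inr k) * coord F (Sum.inr l)

theorem coord_odd_mem_par (k : Fin n) : (coord F (Sum.inr k) : O F m n) ∈ par F m n 1 :=
  mono_mem_par (by simp)

theorem rot_mem_par (k l : Fin n) : (rot F k l : O F m n) ∈ par F m n 0 := by
  have := mul_mem_par (coord_odd_mem_par (F := F) (m := m) k) (coord_odd_mem_par l)
  have h : (1 + 1 : ZMod 2) = 0 := by decide
  rwa [h] at this

theorem dOdd_coord (k l : Fin n) :
    dOdd k (coord F (Sum.inr l) : O F m n) = if k = l then 1 else 0 := by
  have := d_coord (F := F) (m := m) (Sum.inr k) (Sum.inr l)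
  simpa [d] using this

theorem dOdd_coord_even (k : Fin n) (i : EvenIdx m) :
    dOdd k (coord F (Sum.inl i) : O F m n) = 0 := by
  simp [coord, dOdd]

theorem rot_eq (k l : Fin n) (h : k ≠ l) :
    (rot F k l : O F m n) = sgn F {k} {l} • mono 0 {k, l} := by
  rw [rot, coord, Sum.elim_inr, Sum.elim_inr, mono_mul_mono, if_pos (by simpa using h),
    multiBinom_zero_left, Nat.cast_one, one_mul, add_zero]
  rfl

theorem sgn_ne_zero (u v : Finset (Fin n)) : sgn F u v ≠ 0 := fun h => by
  have := sgn_sq (F := F) u v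
  simp [h] at this

theorem coord_odd_mul_mono (k : Fin n) (α : EvenIdx m → ℕ) (u : Finset (Fin n)) :
    coord F (Sum.inr k) * mono α u = if k ∈ u then 0 else sgn F {k} u • mono α (insert k u) := by
  rw [coord, Sum.elim_inr, mono_mul_mono]
  by_cases h : k ∈ u
  · simp [h]
  · simp [h, multiBinom_zero_left]

theorem mono_mul_coord_odd (k : Fin n) (α : EvenIdx m → ℕ) (u : Finset (Fin n)) :
    mono α u * coord F (Sum.inr k) = if k ∈ u then 0 else sgn F u {k} • mono α (insert k u) := by
  rw [coord, Sum.elim_inr, mono_mul_mono]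
  by_cases h : k ∈ u
  · simp [h]
  · simp [h, multiBinom_zero_right]

theorem DH_rot {k l : Fin n} (_ : k ≠ l) (f : O F m n) :
    DH (rot F k l) f = coord F (Sum.inr l) * dOdd k f - coord F (Sum.inr k) * dOdd l f := by
  have he : ∀ i : EvenIdx m, dEven i (rot F k l : O F m n) = 0 := fun i => by
    rw [rot, dEven_mul, dEven_coord, dEven_coord]
    simp
  have ho : ∀ r, dOdd r (rot F k l : O F m n) =
      (if r = k then coord F (Sum.inr l) else 0) - if r = l then coord F (Sum.inr k) else 0 :=
    fun r => by
    rw [rot, dOdd_mul, dOdd_coord, dOdd_coord, parityInv_of_odd (coord_odd_mem_par k)]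
    split_ifs <;> simp [sub_eq_add_neg]
  rw [DH_even (rot_mem_par k l), Fintype.sum_sum_type, Finset.sum_eq_zero, zero_add]
  · simp only [tau, d, prime, Sum.elim_inr, Sum.map_inr, id, ho, sub_mul, ite_mul, zero_mul,
      one_smul, Finset.sum_sub_distrib, Finset.sum_ite_eq', Finset.mem_univ, if_true]
  · intro i _
    simp only [d, Sum.elim_inl, he, zero_mul, smul_zero]

theorem DH_rot_coord_even {k l : Fin n} (hkl : k ≠ l) (i : EvenIdx m) :
    DH (rot F k l) (coord F (Sum.inl i)) = (0 : O F m n) := by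
  simp [DH_rot hkl, dOdd_coord_even]

theorem DH_rot_coord_odd {k l : Fin n} (hkl : k ≠ l) (r : Fin n) :
    DH (rot F k l) (coord F (Sum.inr r)) =
      ((if k = r then coord F (Sum.inr l) else 0) - if l = r then coord F (Sum.inr k) else 0 :
        O F m n) := by
  rw [DH_rot hkl, dOdd_coord, dOdd_coord]
  simp

theorem DH_rot_mono_empty {k l : Fin n} (hkl : k ≠ l) (β : EvenIdx m → ℕ) :
    DH (rot F k l) (mono β ∅) = (0 : O F m n) := by
  simp [DH_rot hkl, dOdd]

theorem coeff_coord_odd_mul {k : Fin n} {u : Finset (Fin n)} (hk : k ∉ u) (α : EvenIdx m → ℕ)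
    (f : O F m n) :
    coeff α (insert k u) (coord F (Sum.inr k) * f) = sgn F {k} u * coeff α u f := by
  refine O_ind f (by simp) (fun β v => ?_) (fun a b ha hb => by simp [mul_add, ha, hb])
    (fun c a ha => by simp [ha]; ring)
  rw [coord_odd_mul_mono, coeff_mono]
  by_cases h : k ∈ v
  · rw [if_pos h, map_zero, if_neg, mul_zero]
    rintro ⟨-, rfl⟩
    exact hk h
  · rw [if_neg h, map_smul, coeff_mono]
    by_cases e : v = u
    · simp [e]
    · have : insert k v ≠ insert k u := fun h' => e (by
        rw [← Finset.erase_insert h, h', Finset.erase_insert hk])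
      simp [e, this]

theorem coeff_mul_coord_odd {k : Fin n} {u : Finset (Fin n)} (hk : k ∉ u) (α : EvenIdx m → ℕ)
    (f : O F m n) :
    coeff α (insert k u) (f * coord F (Sum.inr k)) = sgn F u {k} * coeff α u f := by
  refine O_ind f (by simp) (fun β v => ?_) (fun a b ha hb => by simp [add_mul, mul_add, ha, hb])
    (fun c a ha => by simp [ha]; ring)
  rw [mono_mul_coord_odd, coeff_mono]
  by_cases h : k ∈ v
  · rw [if_pos h, map_zero, if_neg, mul_zero]
    rintro ⟨-, rfl⟩
    exact hk h
  · rw [if_neg h, map_smul, coeff_mono]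
    by_cases e : v = u
    · simp [e]
    · have : insert k v ≠ insert k u := fun h' => e (by
        rw [← Finset.erase_insert h, h', Finset.erase_insert hk])
      simp [e, this]

theorem coeff_coord_odd_mul_of_notMem {k : Fin n} {u : Finset (Fin n)} (hk : k ∉ u)
    (α : EvenIdx m → ℕ) (f : O F m n) : coeff α u (coord F (Sum.inr k) * f) = 0 := by
  refine O_ind f (by simp) (fun β v => ?_) (fun a b ha hb => by simp [mul_add, ha, hb])
    (fun c a ha => by simp [ha])
  rw [coord_odd_mul_mono]
  split_ifs
  · simp
  · rw [map_smul, coeff_mono, if_neg, smul_zero]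
    rintro ⟨-, rfl⟩
    exact hk (Finset.mem_insert_self _ _)

theorem coeff_dOdd {k : Fin n} {u : Finset (Fin n)} (hk : k ∉ u) (α : EvenIdx m → ℕ)
    (f : O F m n) : coeff α u (dOdd k f) = sgn F {k} (insert k u) * coeff α (insert k u) f := by
  refine O_ind f (by simp) (fun β v => ?_) (fun a b ha hb => by simp [mul_add, ha, hb])
    (fun c a ha => by simp [ha]; ring)
  simp only [dOdd, ofBasis_mono]
  split_ifs with h
  · rw [map_smul, coeff_mono, coeff_mono]
    by_cases e : v = insert k u
    · simp [e, hk]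
    · have : v.erase k ≠ u := fun h' => e (by rw [← h', Finset.insert_erase h])
      simp [e, this]
  · rw [coeff_mono, if_neg]
    · simp
    · rintro ⟨-, rfl⟩
      exact h (Finset.mem_insert_self _ _)

theorem coeff_dOdd_of_mem {k : Fin n} {u : Finset (Fin n)} (hk : k ∈ u) (α : EvenIdx m → ℕ)
    (f : O F m n) : coeff α u (dOdd k f) = 0 := by
  refine O_ind f (by simp) (fun β v => ?_) (fun a b ha hb => by simp [ha, hb])
    (fun c a ha => by simp [ha])
  simp only [dOdd, ofBasis_mono]
  split_ifs with h
  · rw [map_smul, coeff_mono, if_neg, smul_zero]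
    rintro ⟨-, rfl⟩
    simp at hk
  · simp

/-- The rotation replaces one odd variable by the other. For a target monomial containing exactly
one of the two there is a single source monomial, so nothing can cancel. -/
theorem coeff_DH_rot {k l : Fin n} {v : Finset (Fin n)} (hk : k ∉ v) (hl : l ∈ v)
    (α : EvenIdx m → ℕ) (f : O F m n) :
    ∃ c : F, c ≠ 0 ∧ coeff α v (DH (rot F k l) f) = c * coeff α (insert k (v.erase l)) f := by
  have hkl : k ≠ l := by rintro rfl; exact hk hl
  refine ⟨sgn F {l} (v.erase l) * sgn F {k} (insert k (v.erase l)),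
    mul_ne_zero (sgn_ne_zero _ _) (sgn_ne_zero _ _), ?_⟩
  rw [DH_rot hkl, map_sub, coeff_coord_odd_mul_of_notMem hk, sub_zero, mul_assoc,
    ← coeff_dOdd (fun h => hk (Finset.mem_of_mem_erase h)),
    ← coeff_coord_odd_mul (Finset.notMem_erase l v), Finset.insert_erase hl]

theorem rot_swap (k l : Fin n) : (rot F k l : O F m n) = - rot F l k := by
  have := mul_comm_of_odd (coord_odd_mem_par (F := F) (m := m) k) (coord F (Sum.inr l))
  rw [parityInv_of_odd (coord_odd_mem_par l)] at this
  rw [rot, rot, ← this]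
  simp

theorem coeff_DH_rot' {k l : Fin n} {v : Finset (Fin n)} (hk : k ∈ v) (hl : l ∉ v)
    (α : EvenIdx m → ℕ) (f : O F m n) :
    ∃ c : F, c ≠ 0 ∧ coeff α v (DH (rot F k l) f) = c * coeff α (insert l (v.erase k)) f := by
  obtain ⟨c, hc, h⟩ := coeff_DH_rot hl hk α f
  refine ⟨-c, neg_ne_zero.2 hc, ?_⟩
  rw [rot_swap, map_neg, LinearMap.neg_apply, map_neg, h, neg_mul]

theorem coeff_DH_rot_of_mem {k l : Fin n} {v : Finset (Fin n)} (hkl : k ≠ l) (hk : k ∈ v)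
    (hl : l ∈ v) (α : EvenIdx m → ℕ) (f : O F m n) : coeff α v (DH (rot F k l) f) = 0 := by
  have e1 := coeff_coord_odd_mul (F := F) (Finset.notMem_erase l v) α (dOdd k f)
  have e2 := coeff_coord_odd_mul (F := F) (Finset.notMem_erase k v) α (dOdd l f)
  rw [Finset.insert_erase hl, coeff_dOdd_of_mem (Finset.mem_erase.2 ⟨hkl, hk⟩), mul_zero] at e1
  rw [Finset.insert_erase hk, coeff_dOdd_of_mem (Finset.mem_erase.2 ⟨hkl.symm, hl⟩), mul_zero] at e2
  rw [DH_rot hkl, map_sub, e1, e2, sub_zero]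

/-- `D` commutes with the rotations in the odd variables. -/
def IsRotInvariant (D : Module.End F (O F m n)) : Prop :=
  ∀ k l : Fin n, k ≠ l → ∀ b, DH (rot F k l) (D (coord F b)) = D (DH (rot F k l) (coord F b))

/-- The even components are invariants of the orthogonal Lie algebra on the exterior algebra, which
are spanned by `1` and `x^ω`: an index inside `u` and one outside it define a rotation that detects
the coefficient at `u`. -/
theorem IsRotInvariant.coeff_even {D : Module.End F (O F m n)} (hD : IsRotInvariant D)
    (b : EvenIdx m) (α : EvenIdx m → ℕ) {u : Finset (Fin n)} (h0 : u ≠ ∅)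
    (h1 : u ≠ Finset.univ) : coeff α u (D (coord F (Sum.inl b))) = 0 := by
  obtain ⟨k, hk⟩ := Finset.nonempty_iff_ne_empty.2 h0
  obtain ⟨l, hl⟩ : ∃ l, l ∉ u := by
    by_contra h
    exact h1 (Finset.eq_univ_iff_forall.2 fun l => by_contra fun h' => h ⟨l, h'⟩)
  have hkl : k ≠ l := by rintro rfl; exact hl hk
  -- The coefficient is read at `u` with `k` replaced by `l`, whose only source under this rotation
  -- is `u` itself.
  obtain ⟨c, hc, h⟩ := coeff_DH_rot (F := F) (k := k) (l := l) (v := insert l (u.erase k))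
    (by simp [hkl]) (by simp) α (D (coord F (Sum.inl b)))
  rw [Finset.erase_insert (by simp [hl]), Finset.insert_erase hk, hD k l hkl,
    DH_rot_coord_even hkl, map_zero, map_zero] at h
  exact (mul_eq_zero.1 h.symm).resolve_left hc

/-- The same argument with the rotations that fix `x_r`. It leaves `u` equal to `∅`, `{r}`, `ω` or
`ω∖r`. -/
theorem IsRotInvariant.coeff_odd {D : Module.End F (O F m n)} (hD : IsRotInvariant D)
    (r : Fin n) (α : EvenIdx m → ℕ) {u : Finset (Fin n)} {k l : Fin n} (hk : k ∈ u) (hl : l ∉ u)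
    (hkr : k ≠ r) (hlr : l ≠ r) : coeff α u (D (coord F (Sum.inr r))) = 0 := by
  have hkl : k ≠ l := by rintro rfl; exact hl hk
  obtain ⟨c, hc, h⟩ := coeff_DH_rot (F := F) (k := k) (l := l) (v := insert l (u.erase k))
    (by simp [hkl]) (by simp) α (D (coord F (Sum.inr r)))
  rw [Finset.erase_insert (by simp [hl]), Finset.insert_erase hk, hD k l hkl,
    DH_rot_coord_odd hkl, if_neg hkr, if_neg hlr, sub_zero, map_zero, map_zero] at h
  exact (mul_eq_zero.1 h.symm).resolve_left hc

/-- Rotations are transitive on the odd coordinates up to sign, so one odd component determines the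
others. -/
theorem IsRotInvariant.apply_odd {D : Module.End F (O F m n)} (hD : IsRotInvariant D)
    {k l : Fin n} (hkl : k ≠ l) :
    D (coord F (Sum.inr l)) = DH (rot F k l) (D (coord F (Sum.inr k))) := by
  rw [hD k l hkl, DH_rot_coord_odd hkl, if_pos rfl, if_neg hkl.symm, sub_zero]

theorem exists_ne_ne (hn : 3 < n) (k l : Fin n) : ∃ r, r ≠ k ∧ r ≠ l := by
  have : ({k, l} : Finset (Fin n)) ≠ Finset.univ := fun h => by
    have h1 := congrArg Finset.card h
    have h2 := Finset.card_le_two (a := k) (b := l)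
    simp at h1
    omega
  obtain ⟨r, hr⟩ : ∃ r, r ∉ ({k, l} : Finset (Fin n)) := by
    by_contra h
    exact this (Finset.eq_univ_iff_forall.2 fun l => by_contra fun h' => h ⟨l, h'⟩)
  exact ⟨r, by simpa using hr⟩

/-- Invariant odd fields that kill the quadratic functions of the odd variables are, up to a
multiple of `D_H(x^ω)`, zero. -/
theorem IsRotInvariant.coeff_odd_eq_zero {p : ℕ} {t : EvenIdx m → ℕ} [Fact p.Prime] [CharP F p]
    {D : Module.End F (O F m n)} (hW : D ∈ wittEven F n p t) (hD : IsRotInvariant D)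
    (h2 : (2 : F) ≠ 0) (hn : 3 < n) {α : EvenIdx m → ℕ}
    (hrot : ∀ k l : Fin n, k ≠ l → coeff α {k, l} (D (rot F k l)) = 0) {k₀ : Fin n}
    (h0 : coeff α (Finset.univ.erase k₀) (D (coord F (Sum.inr k₀))) = 0) (r : Fin n)
    (u : Finset (Fin n)) : coeff α u (D (coord F (Sum.inr r))) = 0 := by
  -- By the Leibniz rule, the coefficient of `x_k x_l` in `D(x_k x_l)` is, up to sign, the sum of
  -- the two diagonal coefficients.
  have hsum : ∀ k l : Fin n, k ≠ l → coeff α {k} (D (coord F (Sum.inr k))) +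
      coeff α {l} (D (coord F (Sum.inr l))) = 0 := fun k l hkl => by
    have h := hrot k l hkl
    have e1 := coeff_mul_coord_odd (F := F) (k := l) (u := {k}) (by simpa using hkl.symm) α
      (D (coord F (Sum.inr k)))
    have e2 := coeff_coord_odd_mul (F := F) (k := k) (u := {l}) (by simpa using hkl) α
      (D (coord F (Sum.inr l)))
    rw [Finset.pair_comm l k] at e1
    rw [rot, wittEven_mul hW, map_add, e1, e2, ← mul_add] at h
    exact (mul_eq_zero.1 h).resolve_left (sgn_ne_zero _ _)
  -- With three distinct indices, `c_k + c_l = c_k + c_s = c_l + c_s = 0` gives `2 c_k = 0`.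
  have hone : ∀ k : Fin n, coeff α {k} (D (coord F (Sum.inr k))) = 0 := fun k => by
    obtain ⟨l, hl, -⟩ := exists_ne_ne hn k k
    obtain ⟨s, hs, hs'⟩ := exists_ne_ne hn k l
    have e1 := hsum k l hl.symm
    have e2 := hsum k s hs.symm
    have e3 := hsum l s hs'.symm
    have : 2 * coeff α {k} (D (coord F (Sum.inr k))) = 0 := by linear_combination e1 + e2 - e3
    exact (mul_eq_zero.1 this).resolve_left h2
  -- The component at `r` is a rotation of another one, and a rotation never produces a monomial
  -- containing both of its variables.
  have htop : coeff α Finset.univ (D (coord F (Sum.inr r))) = 0 := by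
    obtain ⟨k, hk, -⟩ := exists_ne_ne hn r r
    rw [hD.apply_odd hk, coeff_DH_rot_of_mem hk (Finset.mem_univ _) (Finset.mem_univ _)]
  have herase : coeff α (Finset.univ.erase r) (D (coord F (Sum.inr r))) = 0 := by
    rcases eq_or_ne r k₀ with rfl | hr
    · exact h0
    · rw [hD.apply_odd hr.symm]
      obtain ⟨c, -, h⟩ := coeff_DH_rot' (F := F) (k := k₀) (l := r) (v := Finset.univ.erase r)
        (by simp [hr.symm]) (by simp) α (D (coord F (Sum.inr k₀)))
      rw [h, Finset.erase_right_comm, Finset.insert_erase (by simp [hr]), h0, mul_zero]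
  by_contra hne
  have hodd : (u.card : ZMod 2) = 1 := by
    by_contra h
    exact hne (coeff_coord_eq_zero hW h)
  have hcases : ∀ k l, k ∈ u → l ∉ u → k = r ∨ l = r := fun k l hk hl => by
    by_contra h
    push Not at h
    exact hne (hD.coeff_odd r α hk hl h.1 h.2)
  by_cases h1 : ∃ k ∈ u, k ≠ r
  · obtain ⟨k, hk, hkr⟩ := h1
    have h2 : ∀ l, l ∉ u → l = r := fun l hl => (hcases k l hk hl).resolve_left hkr
    by_cases hr : r ∈ u
    · have : u = Finset.univ := Finset.eq_univ_iff_forall.2 fun l => by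
        by_contra hl
        exact hl (h2 l hl ▸ hr)
      exact hne (this ▸ htop)
    · have : u = Finset.univ.erase r := by
        ext l
        simp only [Finset.mem_erase, Finset.mem_univ, and_true]
        refine ⟨fun h e => hr (e ▸ h), fun h => by_contra fun hl => h (h2 l hl)⟩
      exact hne (this ▸ herase)
  · push Not at h1
    have hsub : u ⊆ {r} := fun k hk => Finset.mem_singleton.2 (h1 k hk)
    rcases Finset.subset_singleton_iff.1 hsub with rfl | rfl
    · simp at hodd
    · exact hne (hone r)

end Rotations

end HamSuper

/-! ### Generation of the Hamiltonian algebra and vanishing of normalized cocycles. -/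

namespace HamSuper

variable {F : Type*} [Field F] {m n p : ℕ} {t : EvenIdx m → ℕ}
variable [Fact p.Prime] [CharP F p]
variable {G : O F m n →ₗ[F] Module.End F (O F m n)}

/-- The map vanishes on the quadratic functions of the odd variables and on their multiples by an even
coordinate. -/
structure KillsOdd (G : O F m n →ₗ[F] Module.End F (O F m n)) : Prop where
  rot : ∀ k l, k ≠ l → G (rot F k l) = 0
  cub : ∀ i k l, k ≠ l → G (coord F (Sum.inl i) * HamSuper.rot F k l) = 0

theorem Params.pair_ne (hP : Params p m n t) (k l : Fin n) :
    ({k, l} : Finset (Fin n)) ≠ Finset.univ := fun h => by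
  have h1 := congrArg Finset.card h
  have h2 := Finset.card_le_two (a := k) (b := l)
  have := hP.three_lt_odd
  simp at h1
  omega

theorem Params.pair_mem (hP : Params p m n t) {α : EvenIdx m → ℕ} (hα : α ≤ topExp p t)
    {k l : Fin n} (hkl : k ≠ l) : (mono α {k, l} : O F m n) ∈ hamPot F n p t :=
  mono_mem_hamPot hα (by simp [Finset.card_pair hkl]) (Or.inr (hP.pair_ne k l))

theorem Params.rot_mem (hP : Params p m n t) {k l : Fin n} (hkl : k ≠ l) :
    (rot F k l : O F m n) ∈ hamPot F n p t := by
  rw [rot_eq k l hkl]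
  exact Submodule.smul_mem _ _ (hP.pair_mem (fun _ => Nat.zero_le _) hkl)

theorem coord_mul_rot (i : EvenIdx m) {k l : Fin n} (hkl : k ≠ l) :
    (coord F (Sum.inl i) * rot F k l : O F m n) = sgn F {k} {l} • mono (Pi.single i 1) {k, l} := by
  rw [rot_eq k l hkl, mul_smul_comm, coord_mul_mono]
  simp

theorem Params.cub_mem (hP : Params p m n t) (i : EvenIdx m) {k l : Fin n} (hkl : k ≠ l) :
    (coord F (Sum.inl i) * rot F k l : O F m n) ∈ hamPot F n p t := by
  rw [coord_mul_rot i hkl]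
  exact Submodule.smul_mem _ _ (hP.pair_mem (hP.single_le i) hkl)

theorem DH_cub (i : EvenIdx m) (k l : Fin n) (f : O F m n) :
    DH (coord F (Sum.inl i) * rot F k l) f = coord F (Sum.inl i) * DH (rot F k l) f +
      tau F (Sum.inl i : Idx m n) • (rot F k l * dEven i.swap f) := by
  rw [DH_mul_arg (coord_inl_mem_par i) (rot_mem_par k l), DH_coord_even, mul_smul_comm]

/-- The kernel of a cocycle is closed under the bracket, so vanishing spreads from generators. -/
theorem IsCocycle.bracket_eq_zero (hG : IsCocycle p t G) {f g : O F m n}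
    (hf : f ∈ hamPot F n p t) (hg : g ∈ hamPot F n p t) (hf0 : G f = 0) (hg0 : G g = 0) :
    G (DH f g) = 0 := by
  ext h : 1
  rw [hG.lie_of_eq_zero hf hg hf0, hg0]
  simp

/-- `D_H(x_{i'} x_k x_l)` is `x_{i'}` times a rotation plus `±x_k x_l ∂_i`. The rotation kills
`x^(α+ε_i) x^v` because `k, l ∉ v`, so two odd variables are gained for one even degree. -/
theorem eq_zero_insert_pair (hP : Params p m n t) (hG : IsCocycle p t G) (hO : KillsOdd G)
    {α : EvenIdx m → ℕ} {v : Finset (Fin n)} {i : EvenIdx m} {k l : Fin n} (hkl : k ≠ l)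
    (hk : k ∉ v) (hl : l ∉ v)
    (hmem : (mono (α + Pi.single i 1) v : O F m n) ∈ hamPot F n p t)
    (h0 : G (mono (α + Pi.single i 1) v) = 0) :
    G (mono α (insert k (insert l v))) = 0 := by
  have h := hG.bracket_eq_zero (hP.cub_mem i.swap hkl) hmem (hO.cub _ _ _ hkl) h0
  have e1 : DH (rot F k l) (mono (α + Pi.single i 1) v : O F m n) = 0 := by
    rw [DH_rot hkl]
    simp [dOdd, hk, hl]
  rw [DH_cub, e1, mul_zero, zero_add, Sum.swap_swap, dEven_mono_add, rot, mul_assoc,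
    coord_odd_mul_mono, if_neg hl, mul_smul_comm, coord_odd_mul_mono,
    if_neg (by simp [hkl, hk])] at h
  simp only [map_smul, smul_eq_zero, sgn_ne_zero, tau_ne_zero, false_or] at h
  exact h

/-- In the bracket of `x_i x_k x_r` with `x^(γ) x^{u∖k∪r}` the part with factor `x_k x_r` dies since
`x_r` is already present. The rotation turns `x_r` into `x_k`, and `x_i` raises the exponent with
factor `γ_i + 1`. This reaches the exponent `π`, out of reach of `eq_zero_insert_pair`. -/
theorem eq_zero_exchange (hP : Params p m n t) (hG : IsCocycle p t G) (hO : KillsOdd G)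
    {γ : EvenIdx m → ℕ} {u : Finset (Fin n)} {i : EvenIdx m} {k r : Fin n} (hk : k ∈ u)
    (hr : r ∉ u) (hγ : ((γ i + 1 : ℕ) : F) ≠ 0)
    (hmem : (mono γ (insert r (u.erase k)) : O F m n) ∈ hamPot F n p t)
    (h0 : G (mono γ (insert r (u.erase k))) = 0) :
    G (mono (γ + Pi.single i 1) u) = 0 := by
  have hkr : k ≠ r := by rintro rfl; exact hr hk
  have h := hG.bracket_eq_zero (hP.cub_mem i hkr) hmem (hO.cub _ _ _ hkr) h0
  have e1 : rot F k r * dEven i.swap (mono γ (insert r (u.erase k)) : O F m n) = 0 := by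
    rw [rot, mul_assoc, dEven, ofBasis_mono]
    split_ifs
    · simp
    · rw [coord_odd_mul_mono, if_pos (Finset.mem_insert_self _ _), mul_zero]
  have e2 : DH (rot F k r) (mono γ (insert r (u.erase k)) : O F m n) =
      -(sgn F {r} (insert r (u.erase k)) * sgn F {k} (u.erase k)) • mono γ u := by
    have e3 : dOdd k (mono γ (insert r (u.erase k)) : O F m n) = 0 := by simp [dOdd, hkr]
    have e4 : dOdd r (mono γ (insert r (u.erase k)) : O F m n) =
        sgn F {r} (insert r (u.erase k)) • mono γ (u.erase k) := by
      simp [dOdd, Finset.erase_insert (show r ∉ u.erase k by simp [hr])]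
    rw [DH_rot hkr, e3, e4, mul_zero, zero_sub, mul_smul_comm, coord_odd_mul_mono,
      if_neg (Finset.notMem_erase k u), Finset.insert_erase hk, smul_smul, neg_smul]
  rw [DH_cub, e1, smul_zero, add_zero, e2, mul_smul_comm, coord_mul_mono] at h
  simp only [map_smul, smul_eq_zero, neg_eq_zero, mul_eq_zero, sgn_ne_zero, hγ, false_or] at h
  exact h

theorem Params.top_eq (hP : Params p m n t) (i : EvenIdx m) :
    ∃ γ : EvenIdx m → ℕ, topExp p t = γ + Pi.single i 1 ∧ γ ≠ topExp p t ∧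
      ((γ i + 1 : ℕ) : F) ≠ 0 := by
  have h4 := hP.four_le i
  obtain ⟨γ, hγ⟩ := exists_eq_add_single (i := i) (α := topExp p t) (by omega)
  refine ⟨γ, hγ, fun e => ?_, ?_⟩
  · have := congrFun hγ i
    rw [e] at this
    simp at this
  · have : γ i + 1 = topExp p t i := by rw [hγ]; simp
    rw [this, hP.natCast_topExp]
    simp

/-- `𝓗` is generated by the functions of the even variables and the `x_i x_k x_l`. -/
theorem eq_zero_of_pure (hP : Params p m n t) (hG : IsCocycle p t G) (hO : KillsOdd G)
    (hpure : ∀ α ≤ topExp p t, G (mono α ∅) = 0) {f : O F m n} (hf : f ∈ hamPot F n p t) :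
    G f = 0 := by
  have key : ∀ (N : ℕ) (u : Finset (Fin n)), u.card = N → Even N → ∀ α ≤ topExp p t,
      (α ≠ topExp p t ∨ u ≠ Finset.univ) → G (mono α u) = 0 := by
    intro N
    induction N using Nat.strong_induction_on with
    | _ N ih =>
      have hne : ∀ u : Finset (Fin n), u.card = N → Even N → ∀ α ≤ topExp p t,
          α ≠ topExp p t → G (mono α u) = 0 := by
        intro u hu hN α hα hαt
        rcases Finset.eq_empty_or_nonempty u with rfl | hne
        · exact hpure α hα
        obtain ⟨k, hk⟩ := hne
        have hcard := Finset.card_erase_add_one hk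
        obtain ⟨l, hl⟩ : (u.erase k).Nonempty := by
          rw [← Finset.card_pos]
          rcases hN with ⟨c, hc⟩
          omega
        have hcard' := Finset.card_erase_add_one hl
        have hkl : k ≠ l := (Finset.ne_of_mem_erase hl).symm
        obtain ⟨i, hi⟩ : ∃ i, α i ≠ topExp p t i := by
          by_contra h
          exact hαt (funext fun i => by_contra fun h' => h ⟨i, h'⟩)
        have hle := add_single_le hα (lt_of_le_of_ne (hα i) hi)
        have heven : Even ((u.erase k).erase l).card := by
          rcases hN with ⟨c, hc⟩
          exact ⟨c - 1, by omega⟩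
        have hnu : ((u.erase k).erase l) ≠ Finset.univ := fun e => by
          have := Finset.mem_univ k
          rw [← e] at this
          simp at this
        have h := eq_zero_insert_pair hP hG hO (α := α) (v := (u.erase k).erase l) (i := i) hkl
          (by simp) (by simp) (mono_mem_hamPot hle heven (Or.inr hnu))
          (ih _ (by omega) _ rfl heven _ hle (Or.inr hnu))
        rwa [Finset.insert_erase hl, Finset.insert_erase hk] at h
      intro u hu hN α hα hor
      -- At the top exponent some odd variable is missing from `x^u`, since `(π, ω)` is excluded;
      -- exchanging it leads to an exponent below `π` with the same number of odd variables.
      by_cases hαt : α = topExp p t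
      · have hun : u ≠ Finset.univ := hor.resolve_left (fun h => h hαt)
        rcases Finset.eq_empty_or_nonempty u with rfl | ⟨k, hk⟩
        · exact hpure α hα
        obtain ⟨r, hr⟩ : ∃ l, l ∉ u := by
          by_contra h
          exact hun (Finset.eq_univ_iff_forall.2 fun l => by_contra fun h' => h ⟨l, h'⟩)
        obtain ⟨γ, e, hγ, hγ1⟩ := hP.top_eq (F := F) (Sum.inl ⟨0, by have := hP.one_lt; omega⟩)
        have hγle : γ ≤ topExp p t := e ▸ le_self_add
        have hc : (insert r (u.erase k)).card = N := by
          rw [Finset.card_insert_of_notMem (by simp [hr]), Finset.card_erase_add_one hk, hu]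
        rw [hαt, e]
        exact eq_zero_exchange hP hG hO hk hr hγ1 (mono_mem_hamPot hγle (hc ▸ hN) (Or.inl hγ))
          (hne _ hc hN _ hγle hγ)
      · exact hne u hu hN α hα hαt
  refine monoSpan_ind hf (by simp) (fun α u h => ?_) (fun a b ha hb => by simp [ha, hb])
    (fun c a ha => by simp [ha])
  refine key _ u rfl (ZMod.natCast_eq_zero_iff_even.1 h.2.1) α h.1 ?_
  by_contra hc
  push Not at hc
  exact h.2.2 (Prod.ext hc.1 hc.2)

/-- Rotations annihilate functions of the even variables alone, and `G` annihilates rotations. -/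
theorem isRotInvariant_pure (hP : Params p m n t) (hG : IsCocycle p t G) (hO : KillsOdd G)
    {β : EvenIdx m → ℕ} (hβ : β ≤ topExp p t) : IsRotInvariant (G (mono β ∅)) := by
  intro k l hkl b
  have h := hG.lie_of_eq_zero (hP.rot_mem hkl) (hP.pure_mem hβ) (hO.rot k l hkl) (coord F b)
  rw [DH_rot_mono_empty hkl, map_zero, LinearMap.zero_apply] at h
  exact (sub_eq_zero.1 h.symm)

/-- At the coordinate `x_{i'}` the field of `x_i x_k x_l` takes the value `±x_k x_l`. The cocycle
identity for its bracket with `x^(β)` therefore isolates `G(x^(β))(x_k x_l)`, the input required by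
`IsRotInvariant.coeff_odd_eq_zero`. -/
theorem coeff_apply_rot (hP : Params p m n t) (hG : IsCocycle p t G) (hK : KillsQuad G)
    (hO : KillsOdd G) {β : EvenIdx m → ℕ} (hβ : β ≤ topExp p t) {i : EvenIdx m} {k l : Fin n}
    (hkl : k ≠ l) (h1 : G (rot F k l * dEven i.swap (mono β ∅)) = 0)
    (h2 : G (dEven i.swap (mono β ∅)) = 0) (u : Finset (Fin n)) :
    coeff 0 u (G (mono β ∅) (rot F k l)) = 0 := by
  have h := hG.lie_of_eq_zero (hP.cub_mem i hkl) (hP.pure_mem hβ) (hO.cub i k l hkl)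
    (coord F (Sum.inl i.swap))
  rw [DH_cub, DH_cub, DH_cub, DH_rot_mono_empty hkl, DH_rot_coord_even hkl,
    hG.dEven_comm hP hK.lin (hP.pure_mem hβ), h2, dEven_coord, if_pos rfl] at h
  simp only [mul_zero, zero_add, map_smul, h1, smul_zero, LinearMap.zero_apply, add_zero,
    mul_one] at h
  have h3 := congrArg (coeff 0 u) h
  have hc : ∀ v, coeff 0 v (coord F (Sum.inl i) : O F m n) = 0 := fun v => by
    rw [coord, Sum.elim_inl, coeff_mono, if_neg]
    rintro ⟨h, -⟩
    have := congrFun h i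
    simp at this
  rw [map_zero, map_sub, coeff_zero_mul_left hc, zero_sub, map_smul] at h3
  have h4 := neg_eq_zero.1 h3.symm
  exact (smul_eq_zero.1 h4).resolve_left (tau_ne_zero _)

/-- The constant is, up to sign, the bracket of two conjugate coordinates. -/
theorem KillsQuad.one (hP : Params p m n t) (hG : IsCocycle p t G) (hK : KillsQuad G) :
    G 1 = 0 := by
  let i : EvenIdx m := Sum.inl ⟨0, by have := hP.one_lt; omega⟩
  have h := hG.bracket_eq_zero (hP.coord_mem i) (hP.coord_mem i.swap) (hK.lin _) (hK.lin _)
  rw [DH_coord_even, dEven_coord, if_pos rfl, map_smul] at h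
  exact (smul_eq_zero.1 h).resolve_left (tau_ne_zero _)

/-- The coefficients of `G(x^(β))` are values of `lam`. -/
theorem coeff_pure (hP : Params p m n t) (hG : IsCocycle p t G) (hK : KillsQuad G) {b : Idx m n}
    {u : Finset (Fin n)}
    (h : ∀ β ≤ topExp p t, β ≠ topExp p t → lam G b u β = 0) (α β : EvenIdx m → ℕ)
    (hβ : β ≤ topExp p t) (hor : β ≠ topExp p t ∨ α ≠ 0) :
    coeff α u (G (mono β ∅) (coord F b)) = 0 := by
  induction hN : ∑ i, α i generalizing α β with
  | zero =>
    have hα : α = 0 := funext fun i => by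
      have := Finset.single_le_sum (f := α) (fun _ _ => Nat.zero_le _) (Finset.mem_univ i)
      simp only [Pi.zero_apply]
      omega
    subst hα
    exact h β hβ (hor.resolve_right (by simp))
  | succ N ih =>
    obtain ⟨i, hi⟩ : ∃ i, α i ≠ 0 := by
      by_contra hc
      push Not at hc
      simp [hc] at hN
    obtain ⟨α, rfl⟩ := exists_eq_add_single hi
    rw [← coeff_dEven, hG.dEven_comm hP hK.lin (hP.pure_mem hβ)]
    by_cases h0 : β i = 0
    · rw [dEven_mono_zero h0]
      simp
    · obtain ⟨γ, rfl⟩ := exists_eq_add_single h0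
      rw [dEven_mono_add]
      -- After one lowering the exponent is no longer `π`, so the hypothesis on `lam` is not needed
      -- at the top.
      refine ih α γ (le_of_add_single hβ) (Or.inl fun e => ?_) ?_
      · have := hβ i
        rw [e] at this
        simp at this
      · simpa [Finset.sum_add_distrib] using hN

/-- A cocycle that is normalized in low degrees vanishes if finitely many of its coefficients do. -/
theorem cocycle_eq_zero (hP : Params p m n t) (hG : IsCocycle p t G) (hK : KillsQuad G)
    (hO : KillsOdd G) (k₀ : Fin n)
    (h1 : ∀ r s, 1 ≤ s ∧ s ≤ t r - 1 →
      lam G (Sum.inl r) ∅ (Pi.single r (p ^ s) + Pi.single r.swap 1) = 0)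
    (h2 : ∀ r s, 1 ≤ s ∧ s ≤ t r - 1 →
      lam G (Sum.inl r) Finset.univ (Pi.single r (p ^ s) + Pi.single r.swap 1) = 0)
    (h3 : ∀ r s, 1 ≤ s ∧ s ≤ t r - 1 →
      lam G (Sum.inr k₀) (Finset.univ.erase k₀) (Pi.single r (p ^ s)) = 0)
    (h4 : lam G (Sum.inr k₀) (Finset.univ.erase k₀) (topExp p t) = 0)
    {f : O F m n} (hf : f ∈ hamPot F n p t) : G f = 0 := by
  have he : ∀ b u, ∀ β ≤ topExp p t, lam G (Sum.inl b) u β = 0 := by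
    intro b u β hβ
    by_contra hne
    obtain ⟨r, s, hs, rfl⟩ := lam_even_special hP hG hK hβ hne
    by_cases hu : u = ∅
    · subst hu
      exact hne (lam_spread hP hG hK hs (h1 r s hs) b)
    by_cases hu' : u = Finset.univ
    · subst hu'
      exact hne (lam_spread hP hG hK hs (h2 r s hs) b)
    exact hne ((isRotInvariant_pure hP hG hO hβ).coeff_even b 0 hu hu')
  have ho : ∀ k u, ∀ β ≤ topExp p t, β ≠ topExp p t → lam G (Sum.inr k) u β = 0 := by
    intro k u β hβ hβt
    by_contra hne
    by_cases hβ0 : β = 0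
    · subst hβ0
      refine hne ?_
      rw [lam, ← one_def, hK.one hP hG]
      simp
    obtain ⟨r, s, hs, rfl⟩ := (lam_odd_special hP hG hK hβ hne hβ0).resolve_left hβt
    -- Since `x^(p^s ε_r)` does not involve `x_{r'}`, both conditions of `coeff_apply_rot` are
    -- trivial for `i = r`.
    have hz : dEven r.swap (mono (Pi.single r (p ^ s)) ∅ : O F m n) = 0 :=
      dEven_mono_zero (by simp [swap_ne]) _
    refine hne ((isRotInvariant_pure hP hG hO hβ).coeff_odd_eq_zero (hG.mem _ (hP.pure_mem hβ))
      hP.two_ne_zero hP.three_lt_odd (fun k l hkl => ?_) (h3 r s hs) k u)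
    exact coeff_apply_rot hP hG hK hO hβ (i := r) hkl (by rw [hz]; simp) (by rw [hz]; simp) _
  have hall : ∀ b u, ∀ β ≤ topExp p t, β ≠ topExp p t → lam G b u β = 0 := by
    rintro (b | k) u β hβ hβt
    · exact he b u β hβ
    · exact ho k u β hβ hβt
  have hlt : ∀ β ≤ topExp p t, β ≠ topExp p t → G (mono β ∅) = 0 := fun β hβ hβt =>
    wittEven_eq_zero (hG.mem _ (hP.pure_mem hβ)) fun b => O_eq_zero fun α u =>
      coeff_pure hP hG hK (hall b u) α β hβ (Or.inl hβt)
  have htop : ∀ k u, lam G (Sum.inr k) u (topExp p t) = 0 := by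
    intro k u
    let i : EvenIdx m := Sum.inl ⟨0, by have := hP.one_lt; omega⟩
    obtain ⟨γ, e, hγ, hγ1⟩ := hP.top_eq (F := F) i.swap
    have hγle : γ ≤ topExp p t := e ▸ le_self_add
    refine (isRotInvariant_pure hP hG hO le_rfl).coeff_odd_eq_zero
      (hG.mem _ (hP.pure_mem le_rfl)) hP.two_ne_zero hP.three_lt_odd (fun k l hkl => ?_) h4 k u
    have hd : dEven i.swap (mono (topExp p t) ∅ : O F m n) = mono γ ∅ := by
      rw [e, dEven_mono_add]
    refine coeff_apply_rot hP hG hK hO le_rfl (i := i) hkl ?_ (by rw [hd]; exact hlt γ hγle hγ) _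
    -- It remains to kill `x^(γ) x_k x_l` for `γ = π - ε_{i'}` without knowing the value at `x^(π)`.
    -- A pair `r, l` is inserted into `x^(γ)`, which lowers the exponent to `δ = γ - ε_i`;
    -- exchanging `r` for `k` restores `γ`.
    rw [hd, rot_eq k l hkl, smul_mul_assoc, mono_zero_empty_mul_mono, map_smul]
    refine smul_eq_zero_of_right _ ?_
    have hγi : γ i = topExp p t i := by
      rw [e]; simp [Pi.single_eq_of_ne (swap_ne i).symm]
    obtain ⟨δ, rfl⟩ := exists_eq_add_single (i := i) (α := γ) (by
      have := hP.four_le i; omega)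
    obtain ⟨r, hrk, hrl⟩ := exists_ne_ne hP.three_lt_odd k l
    have hδle := le_of_add_single hγle
    have hδi : ((δ i + 1 : ℕ) : F) ≠ 0 := by
      have : δ i + 1 = topExp p t i := by rw [← hγi]; simp
      rw [this, hP.natCast_topExp]
      simp
    refine eq_zero_exchange hP hG hO (k := k) (r := r) (by simp) (by simp [hrk, hrl]) hδi ?_ ?_
    · rw [Finset.erase_insert (by simpa using hkl)]
      exact hP.pair_mem hδle hrl
    · rw [Finset.erase_insert (by simpa using hkl)]
      have h5 := eq_zero_insert_pair hP hG hO (α := δ) (v := ∅) (i := i) hrl (by simp) (by simp)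
        (hP.pure_mem hγle) (hlt _ hγle hγ)
      simpa using h5
  refine eq_zero_of_pure hP hG hO (fun β hβ => ?_) hf
  by_cases hβt : β = topExp p t
  · subst hβt
    refine wittEven_eq_zero (hG.mem _ (hP.pure_mem hβ)) fun b => O_eq_zero fun α u => ?_
    by_cases hα : α = 0
    · subst hα
      rcases b with b | k
      · exact he b u _ hβ
      · exact htop k u
    · exact coeff_pure hP hG hK (hall b u) α _ hβ (Or.inr hα)
  · exact hlt β hβ hβt

end HamSuper

/-! ### Homogeneous cocycles of negative degree in low degrees. -/

namespace HamSuper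

variable {F : Type*} [Field F] {m n p : ℕ} {t : EvenIdx m → ℕ}

/-- The homogeneous elements of degree `e`. -/
noncomputable def homog (F : Type*) [Field F] (m n : ℕ) (e : ℤ) : Submodule F (O F m n) :=
  monoSpan F {a : Mon m n | ((∑ i, a.1 i + a.2.card : ℕ) : ℤ) = e}

theorem mono_mem_homog (α : EvenIdx m → ℕ) (u : Finset (Fin n)) :
    (mono α u : O F m n) ∈ homog F m n ((∑ i, α i + u.card : ℕ) : ℤ) :=
  mono_mem rfl

theorem coeff_of_homog {e : ℤ} {f : O F m n} (hf : f ∈ homog F m n e) {α : EvenIdx m → ℕ}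
    {u : Finset (Fin n)} (h : ((∑ i, α i + u.card : ℕ) : ℤ) ≠ e) : coeff α u f = 0 :=
  mem_monoSpan.1 hf α u h

theorem d_mem_homog {e : ℤ} {f : O F m n} (hf : f ∈ homog F m n e) (i : Idx m n) :
    d i f ∈ homog F m n (e - 1) := by
  refine monoSpan_ind hf (by simp) (fun α u h => ?_)
    (fun a b ha hb => by simpa using add_mem ha hb)
    (fun c a ha => by simpa using Submodule.smul_mem _ c ha)
  simp only [Set.mem_ofPred_eq] at h
  rcases i with i | k
  · change dEven i _ ∈ _
    by_cases h0 : α i = 0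
    · rw [dEven_mono_zero h0]
      exact zero_mem _
    · obtain ⟨α, rfl⟩ := exists_eq_add_single h0
      rw [dEven_mono_add]
      refine mono_mem ?_
      simp only [Pi.add_apply, Finset.sum_add_distrib, Finset.sum_pi_single', Finset.mem_univ,
        if_true, Set.mem_ofPred_eq] at h ⊢
      push_cast at h ⊢
      linarith
  · simp only [d, Sum.elim_inr, dOdd, ofBasis_mono]
    split_ifs with hk
    · refine Submodule.smul_mem _ _ (mono_mem ?_)
      have := Finset.card_erase_add_one hk
      simp only [Set.mem_ofPred_eq]
      omega
    · exact zero_mem _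

theorem mul_mem_homog {e e' : ℤ} {f g : O F m n} (hf : f ∈ homog F m n e)
    (hg : g ∈ homog F m n e') : f * g ∈ homog F m n (e + e') := by
  refine monoSpan_ind hf (by simp) (fun α u h => ?_)
    (fun a b ha hb => by simpa [add_mul] using add_mem ha hb)
    (fun c a ha => by simpa using Submodule.smul_mem _ c ha)
  refine monoSpan_ind hg (by simp) (fun β v h' => ?_)
    (fun a b ha hb => by simpa [mul_add] using add_mem ha hb)
    (fun c a ha => by simpa using Submodule.smul_mem _ c ha)
  rw [mono_mul_mono]
  split_ifs with hd
  · refine Submodule.smul_mem _ _ (mono_mem ?_)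
    simp only [Set.mem_ofPred_eq] at h h' ⊢
    rw [Finset.card_union_of_disjoint hd]
    simp only [Pi.add_apply, Finset.sum_add_distrib]
    push_cast at h h' ⊢
    linarith
  · exact zero_mem _

theorem eq_smul_one {f : O F m n} {e : ℤ} (hf : f ∈ homog F m n e) (he : e ≤ 0) :
    f = coeff 0 ∅ f • 1 := by
  refine sub_eq_zero.1 (O_eq_zero fun α u => ?_)
  rw [map_sub, map_smul, one_def, coeff_mono]
  by_cases h : 0 = α ∧ ∅ = u
  · obtain ⟨rfl, rfl⟩ := h
    simp
  · rw [if_neg h, smul_zero, sub_zero]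
    refine coeff_of_homog hf fun h' => h ?_
    have h1 : ∑ i, α i + u.card = 0 := by omega
    rw [Nat.add_eq_zero_iff, Finset.card_eq_zero, Finset.sum_eq_zero_iff] at h1
    exact ⟨funext fun i => (h1.1 i (Finset.mem_univ i)).symm, h1.2.symm⟩

theorem d_one (i : Idx m n) : d i (1 : O F m n) = 0 := by
  rcases i with i | k <;> simp [d, one_def, dEven, dOdd]

theorem d_eq_zero_of_homog {f : O F m n} {e : ℤ} (hf : f ∈ homog F m n e) (he : e ≤ 0)
    (i : Idx m n) : d i f = 0 := by
  rw [eq_smul_one hf he, map_smul, d_one, smul_zero]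

theorem DH_eq_zero_of_d {f g : O F m n} (hf : f ∈ par F m n 0) (h : ∀ i : Idx m n, d i g = 0) :
    DH f g = 0 := by
  rw [DH_even hf]
  simp [h]

/-- The functions `x_l x_{l'}` form a torus that is diagonal on monomials; the weight arguments rest
on this. -/
theorem DH_weight (l : EvenIdx m) (β : EvenIdx m → ℕ) (u : Finset (Fin n)) :
    DH (coord F (Sum.inl l) * coord F (Sum.inl l.swap)) (mono β u : O F m n) =
      (tau F (Sum.inl l : Idx m n) * ((β l.swap : F) - β l)) • mono β u := by
  rw [DH_quad, Sum.swap_swap, coord_mul_dEven, coord_mul_dEven, tau_swap, smul_smul, smul_smul,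
    ← add_smul]
  congr 1
  ring

variable [Fact p.Prime] [CharP F p]
variable {G : O F m n →ₗ[F] Module.End F (O F m n)}

/-- The map is homogeneous of degree `k`. -/
def HasDegree (p : ℕ) (t : EvenIdx m → ℕ) (k : ℤ) (G : O F m n →ₗ[F] Module.End F (O F m n)) :
    Prop :=
  ∀ α u, (mono α u : O F m n) ∈ hamPot F n p t → ∀ b,
    G (mono α u) (coord F b) ∈ homog F m n (((∑ i, α i + u.card : ℕ) : ℤ) - 1 + k)

/-- The components of the image would have degree `k < 0`. -/
theorem HasDegree.lin (hP : Params p m n t) (hG : IsCocycle p t G) {k : ℤ}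
    (hD : HasDegree p t k G) (hk : k ≤ -1) (i : EvenIdx m) : G (coord F (Sum.inl i)) = 0 := by
  refine wittEven_eq_zero (hG.mem _ (hP.coord_mem i)) fun b => O_eq_zero fun α u => ?_
  refine coeff_of_homog (hD _ _ (hP.coord_mem i) b) ?_
  simp only [Finset.sum_pi_single', Finset.mem_univ, if_true, Finset.card_empty]
  push_cast
  intro h
  have h1 : (0 : ℤ) ≤ ∑ i, (α i : ℤ) := Finset.sum_nonneg fun _ _ => Int.natCast_nonneg _
  omega

theorem quad_eq_smul (i j : EvenIdx m) :
    (coord F (Sum.inl i) * coord F (Sum.inl j) : O F m n) =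
      (((Pi.single j 1 : EvenIdx m → ℕ) i + 1 : ℕ) : F) •
        mono (Pi.single j 1 + Pi.single i 1) ∅ := by
  exact coord_mul_mono i _ _

theorem HasDegree.quad_mem (hP : Params p m n t) {k : ℤ} (hD : HasDegree p t k G)
    (i j : EvenIdx m) (b : Idx m n) :
    G (coord F (Sum.inl i) * coord F (Sum.inl j)) (coord F b) ∈ homog F m n (1 + k) := by
  rw [quad_eq_smul, map_smul]
  refine Submodule.smul_mem _ _ ?_
  have hle : (Pi.single j 1 + Pi.single i 1 : EvenIdx m → ℕ) ≤ topExp p t := fun k => by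
    have := hP.four_le k
    simp only [Pi.add_apply, Pi.single_apply]
    split_ifs <;> omega
  have h := hD _ _ (hP.pure_mem hle) b
  simp only [Pi.add_apply, Finset.sum_add_distrib, Finset.sum_pi_single', Finset.mem_univ,
    if_true, Finset.card_empty] at h
  convert h using 2
  norm_num

theorem HasDegree.quad (hP : Params p m n t) {k : ℤ} (hD : HasDegree p t k G) (hk : k ≤ -1)
    (i j : EvenIdx m) (b : Idx m n) :
    ∃ e ≤ 0, G (coord F (Sum.inl i) * coord F (Sum.inl j)) (coord F b) ∈ homog F m n e :=
  ⟨1 + k, by omega, hD.quad_mem hP i j b⟩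

theorem HasDegree.rot (hP : Params p m n t) {k : ℤ} (hD : HasDegree p t k G) (hk : k ≤ -1)
    {r l : Fin n} (hrl : r ≠ l) (b : Idx m n) :
    ∃ e ≤ 0, G (rot F r l) (coord F b) ∈ homog F m n e := by
  refine ⟨1 + k, by omega, ?_⟩
  rw [rot_eq r l hrl, map_smul]
  refine Submodule.smul_mem _ _ ?_
  have h := hD _ _ (hP.pair_mem (F := F) (α := 0) (fun _ => Nat.zero_le _) hrl) b
  rw [Finset.card_pair hrl] at h
  convert h using 2
  norm_num

theorem HasDegree.cub (hP : Params p m n t) {k : ℤ} (hD : HasDegree p t k G) (hk : k ≤ -1)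
    (i : EvenIdx m) {r l : Fin n} (hrl : r ≠ l) (b : Idx m n) :
    ∃ e ≤ 1, G (coord F (Sum.inl i) * HamSuper.rot F r l) (coord F b) ∈ homog F m n e := by
  refine ⟨2 + k, by omega, ?_⟩
  rw [coord_mul_rot i hrl, map_smul]
  refine Submodule.smul_mem _ _ ?_
  have h := hD _ _ (hP.pair_mem (F := F) (hP.single_le i) hrl) b
  rw [Finset.card_pair hrl] at h
  simp only [Finset.sum_pi_single', Finset.mem_univ, if_true] at h
  convert h using 2
  norm_num

theorem mul_coord_comm (i j : EvenIdx m) :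
    (coord F (Sum.inl i) * coord F (Sum.inl j) : O F m n) = coord F (Sum.inl j) * coord F (Sum.inl i) :=
  mul_comm_of_even (coord_inl_mem_par i) _

theorem quad_mem_par (i j : EvenIdx m) :
    (coord F (Sum.inl i) * coord F (Sum.inl j) : O F m n) ∈ par F m n 0 := by
  simpa using mul_mem_par (coord_inl_mem_par (F := F) (n := n) i) (coord_inl_mem_par j)

/-- Degree at most zero means constant, and constants have the wrong parity for an odd direction. -/
theorem odd_eq_zero_of_homog {D : Module.End F (O F m n)} (hD : D ∈ wittEven F n p t) {k : Fin n}
    {e : ℤ} (he : e ≤ 0) (h : D (coord F (Sum.inr k)) ∈ homog F m n e) :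
    D (coord F (Sum.inr k)) = 0 := by
  rw [eq_smul_one h he, coeff_coord_eq_zero hD (by simp [mu]), zero_smul]

/-- The torus elements `x_i x_{i'}` are killed once their `i`-components are. -/
theorem torus_eq_zero (hP : Params p m n t) (hG : IsCocycle p t G) {k : ℤ}
    (hD : HasDegree p t k G) (hk : k ≤ -1)
    (h0 : ∀ i, G (coord F (Sum.inl i) * coord F (Sum.inl i.swap)) (coord F (Sum.inl i)) = 0)
    (i : EvenIdx m) : G (coord F (Sum.inl i) * coord F (Sum.inl i.swap)) = 0 := by
  have hm := fun i => hP.quad_mem (F := F) (n := n) i (Sum.swap i)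
  refine wittEven_eq_zero (hG.mem _ (hm i)) fun b => ?_
  rcases b with a | r
  · rcases eq_or_ne a i with rfl | hai
    · exact h0 a
    rcases eq_or_ne a i.swap with rfl | hai'
    · have := h0 i.swap
      rwa [Sum.swap_swap, mul_coord_comm] at this
    have hai'' : a.swap ≠ i := fun e => hai' (by rw [← e, Sum.swap_swap])
    have hsw : a.swap ≠ i.swap := fun e => hai (by rw [← Sum.swap_swap a, e, Sum.swap_swap])
    -- The two torus elements commute and all components involved are constant. Evaluated at `x_a`,
    -- the identity leaves only the eigenvalue of `x_a` times the wanted component.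
    have h1 := hG.lie _ (hm a) _ (hm i) (coord F (Sum.inl a))
    obtain ⟨e, he, h2⟩ := hD.quad hP hk i i.swap (Sum.inl a)
    have e1 : DH (coord F (Sum.inl a) * coord F (Sum.inl a.swap))
        (coord F (Sum.inl i) * coord F (Sum.inl i.swap) : O F m n) = 0 := by
      simp [DH_quad, dEven_mul, dEven_coord, hai.symm, hai'.symm, hai''.symm, hsw.symm]
    have e2 : DH (coord F (Sum.inl i) * coord F (Sum.inl i.swap))
        (coord F (Sum.inl a) : O F m n) = 0 := by
      simp [DH_quad, dEven_coord, hai, hai']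
    have e3 : DH (coord F (Sum.inl a) * coord F (Sum.inl a.swap))
        (coord F (Sum.inl a) : O F m n) = - tau F (Sum.inl a : Idx m n) • coord F (Sum.inl a) := by
      simp [DH_quad, dEven_coord, tau_swap, (swap_ne a).symm]
    rw [e1, e2, e3, h0 a, DH_eq_zero_of_d (quad_mem_par _ _) (d_eq_zero_of_homog h2 he)] at h1
    simp only [map_zero, LinearMap.zero_apply, map_smul, sub_zero, zero_sub, neg_smul, neg_neg,
      map_neg] at h1
    exact (smul_eq_zero.1 h1.symm).resolve_left (tau_ne_zero _)
  · obtain ⟨e, he, h⟩ := hD.quad hP hk i i.swap (Sum.inr r)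
    exact odd_eq_zero_of_homog (hG.mem _ (hm i)) he h

/-- The weight argument: a function of nonconstant weight pattern maps to zero in degree `-1`. -/
theorem weight_rel (hP : Params p m n t) (hG : IsCocycle p t G)
    (hT : ∀ l, G (coord F (Sum.inl l) * coord F (Sum.inl l.swap)) = 0) {β : EvenIdx m → ℕ}
    {u : Finset (Fin n)} (hm : (mono β u : O F m n) ∈ hamPot F n p t) {b : Idx m n}
    (hd : ∀ i : EvenIdx m, dEven i (G (mono β u) (coord F b)) = 0) (l : EvenIdx m) :
    ((β l.swap : F) - β l) • G (mono β u) (coord F b) =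
      (if b = Sum.inl l then G (mono β u) (coord F b) else 0) -
        if b = Sum.inl l.swap then G (mono β u) (coord F b) else 0 := by
  have h := hG.lie_of_eq_zero (hP.quad_mem l l.swap) hm (hT l) (coord F b)
  rw [DH_weight, DH_quad, DH_quad, hd, hd, dEven_coord, dEven_coord, Sum.swap_swap, tau_swap] at h
  have ht := tau_ne_zero (F := F) (Sum.inl l : Idx m n)
  refine smul_right_injective _ ht ?_
  simp only [smul_smul]
  rw [map_smul, LinearMap.smul_apply] at h
  rw [h]
  have hne : l ≠ l.swap := (swap_ne l).symm
  by_cases h1 : b = Sum.inl l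
  · subst h1
    simp [hne]
  · by_cases h2 : b = Sum.inl l.swap
    · subst h2
      simp [swap_ne]
    · simp [h1, h2]

/-- The components of `G(x_i x_j)` are constant, and for `j ≠ i'` the weight of `x_i x_j` is not
that of any `∂_a`. The differences that occur are 1, 2 or 3 up to sign, hence invertible for `p >
3`. -/
theorem quad_eq_zero (hP : Params p m n t) (hG : IsCocycle p t G) {k : ℤ}
    (hD : HasDegree p t k G) (hk : k ≤ -1)
    (hT : ∀ l, G (coord F (Sum.inl l) * coord F (Sum.inl l.swap)) = 0) (i j : EvenIdx m) :
    G (coord F (Sum.inl i) * coord F (Sum.inl j)) = 0 := by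
  by_cases hij : j = i.swap
  · subst hij
    exact hT i
  have hle : (Pi.single j 1 + Pi.single i 1 : EvenIdx m → ℕ) ≤ topExp p t := fun k => by
    have := hP.four_le k
    simp only [Pi.add_apply, Pi.single_apply]
    split_ifs <;> omega
  have hm := hP.pure_mem (F := F) hle
  have hij' : i ≠ j.swap := fun e => hij (by rw [e, Sum.swap_swap])
  rw [quad_eq_smul, map_smul]
  refine smul_eq_zero_of_right _ (wittEven_eq_zero (hG.mem _ hm) fun b => ?_)
  have hh : ∃ e ≤ 0, G (mono (Pi.single j 1 + Pi.single i 1) ∅) (coord F b) ∈ homog F m n e := by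
    refine ⟨1 + k, by omega, ?_⟩
    have h := hD _ _ hm b
    simp only [Pi.add_apply, Finset.sum_add_distrib, Finset.sum_pi_single', Finset.mem_univ,
      if_true, Finset.card_empty] at h
    convert h using 2
    norm_num
  obtain ⟨e, he, h⟩ := hh
  rcases b with a | r
  · have hw := weight_rel hP hG hT hm (b := Sum.inl a) (fun i => d_eq_zero_of_homog h he (Sum.inl i))
    set g := G (mono (Pi.single j 1 + Pi.single i 1) ∅) (coord F (Sum.inl a)) with hg
    have h2 := hP.two_ne_zero (F := F)
    have h3 := hP.three_ne_zero (F := F)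
    have done : ∀ c : F, c ≠ 0 → c • g = 0 → g = 0 := fun c hc h => (smul_eq_zero.1 h).resolve_left hc
    have key : ∀ l, a ≠ l → a ≠ l.swap → (l = i ∨ l = j) → g = 0 := by
      intro l hl hl' hlij
      have h4 := hw l
      rw [if_neg (fun e => hl (Sum.inl_injective e)), if_neg (fun e => hl' (Sum.inl_injective e)),
        sub_zero] at h4
      refine done _ ?_ h4
      rcases hlij with rfl | rfl
      · rcases eq_or_ne l j with rfl | hne
        · simpa [swap_ne, one_add_one_eq_two] using h2
        · simp [swap_ne, hne, Ne.symm hij]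
      · rcases eq_or_ne l i with rfl | hne
        · simpa [swap_ne, one_add_one_eq_two] using h2
        · simp [swap_ne, hne, Ne.symm hij']
    -- If `a` lies outside one of the pairs `{i, i'}`, `{j, j'}`, the torus element of that pair
    -- decides. Otherwise the pairs agree, and `j ≠ i'` leaves `i = j`.
    by_cases hi : a = i ∨ a = i.swap
    · by_cases hj : a = j ∨ a = j.swap
      · have hij2 : i = j := by
          rcases hi with rfl | rfl <;> rcases hj with e | e
          · exact e
          · exact absurd e hij'
          · exact absurd e.symm hij
          · rw [← Sum.swap_swap i, e, Sum.swap_swap]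
        subst hij2
        have h4 := hw i
        rcases hi with rfl | rfl
        · refine done 3 h3 ?_
          rw [if_pos rfl, if_neg (fun e => swap_ne a (Sum.inl_injective e).symm), sub_zero] at h4
          simp only [Pi.add_apply, Pi.single_eq_same, Pi.single_eq_of_ne (swap_ne a)] at h4
          have h5 : (3 : F) • g = g - (((0 + 0 : ℕ) : F) - ((1 + 1 : ℕ) : F)) • g := by
            push_cast
            module
          rw [h5, h4, sub_self]
        · refine done 1 one_ne_zero ?_
          rw [if_pos rfl, if_neg (fun e => swap_ne i (Sum.inl_injective e)), zero_sub] at h4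
          simp only [Pi.add_apply, Pi.single_eq_same, Pi.single_eq_of_ne (swap_ne i)] at h4
          have h5 : (1 : F) • g = -((((0 + 0 : ℕ) : F) - ((1 + 1 : ℕ) : F)) • g) - g := by
            push_cast
            module
          rw [h5, h4]
          simp
      · push Not at hj
        exact key j hj.1 hj.2 (Or.inr rfl)
    · push Not at hi
      exact key i hi.1 hi.2 (Or.inl rfl)
  · exact odd_eq_zero_of_homog (hG.mem _ hm) he h

/-- A function of the odd variables has torus weight zero, whereas `∂_a` has nonzero weight for `x_a
x_{a'}`. -/
theorem rot_eq_zero (hP : Params p m n t) (hG : IsCocycle p t G) {k : ℤ}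
    (hD : HasDegree p t k G) (hk : k ≤ -1)
    (hT : ∀ l, G (coord F (Sum.inl l) * coord F (Sum.inl l.swap)) = 0) {r l : Fin n} (hrl : r ≠ l) :
    G (rot F r l) = 0 := by
  have hm := hP.pair_mem (F := F) (α := 0) (fun _ => Nat.zero_le _) hrl
  refine wittEven_eq_zero (hG.mem _ (hP.rot_mem hrl)) fun b => ?_
  obtain ⟨e, he, h⟩ := hD.rot hP hk hrl b
  rcases b with a | q
  · rw [rot_eq r l hrl, map_smul, LinearMap.smul_apply] at h ⊢
    refine smul_eq_zero_of_right _ ?_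
    have hw := weight_rel hP hG hT hm (b := Sum.inl a) (fun i => by
      have := d_eq_zero_of_homog h he (Sum.inl i)
      rw [map_smul] at this
      exact (smul_eq_zero.1 this).resolve_left (sgn_ne_zero _ _)) a
    rw [if_pos rfl, if_neg (fun e => swap_ne a (Sum.inl_injective e).symm), sub_zero] at hw
    simpa using hw.symm
  · exact odd_eq_zero_of_homog (hG.mem _ (hP.rot_mem hrl)) he h

/-- The even components are constant by degree, parity and commutation with the `∂_j`. A rotation
kills constants but carries `x_i x_s x_l` to `-x_i x_r x_l`. In odd directions the nonzero weight of
`x_i` has no counterpart. -/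
theorem cub_eq_zero (hP : Params p m n t) (hG : IsCocycle p t G) {k : ℤ}
    (hD : HasDegree p t k G) (hk : k ≤ -1) (hK : KillsQuad G)
    (hR : ∀ r l, r ≠ l → G (rot F r l) = 0) (i : EvenIdx m) {r l : Fin n} (hrl : r ≠ l) :
    G (coord F (Sum.inl i) * rot F r l) = 0 := by
  have hde : ∀ {r l : Fin n}, r ≠ l → ∀ (j : EvenIdx m) (b : Idx m n),
      dEven j (G (coord F (Sum.inl i) * rot F r l) (coord F b)) = 0 := fun {r l} hrl j b => by
    have e1 : dEven j (rot F r l : O F m n) = 0 := by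
      rw [rot, dEven_mul, dEven_coord, dEven_coord]
      simp
    rw [hG.dEven_comm hP hK.lin (hP.cub_mem i hrl), dEven_mul, e1, mul_zero, add_zero, dEven_coord]
    split_ifs
    · rw [one_mul, hR r l hrl, LinearMap.zero_apply]
    · simp
  have hconst : ∀ {r l : Fin n}, r ≠ l → ∀ a : EvenIdx m, ∀ q : Idx m n,
      d q (G (coord F (Sum.inl i) * rot F r l) (coord F (Sum.inl a))) = 0 := by
    intro r l hrl a q
    obtain ⟨e, he, h⟩ := hD.cub hP hk i hrl (Sum.inl a)
    -- The degree is at most one and no even variable occurs; a term linear in an odd variable has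
    -- the wrong parity.
    have h0 : G (coord F (Sum.inl i) * rot F r l) (coord F (Sum.inl a)) ∈ homog F m n 0 := by
      refine mem_monoSpan.2 fun α u hu => ?_
      by_cases hα : α = 0
      · subst hα
        by_cases h1 : u.card = 1
        · exact coeff_coord_eq_zero (hG.mem _ (hP.cub_mem i hrl)) (by simp [h1, mu])
        · refine coeff_of_homog h fun h2 => hu ?_
          simp only [Pi.zero_apply, Finset.sum_const_zero, zero_add] at h2
          simp only [Set.mem_ofPred_eq, Pi.zero_apply, Finset.sum_const_zero, zero_add]
          omega
      · obtain ⟨j, hj⟩ : ∃ j, α j ≠ 0 := by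
          by_contra hc
          exact hα (funext fun i => by_contra fun h' => hc ⟨i, h'⟩)
        obtain ⟨α, rfl⟩ := exists_eq_add_single hj
        rw [← coeff_dEven, hde hrl, map_zero]
    exact d_eq_zero_of_homog h0 le_rfl q
  refine wittEven_eq_zero (hG.mem _ (hP.cub_mem i hrl)) fun b => ?_
  rcases b with a | q
  · obtain ⟨s, hsr, hsl⟩ := exists_ne_ne hP.three_lt_odd r l
    have h := hG.lie_of_eq_zero (hP.rot_mem hsr.symm) (hP.cub_mem i hsl) (hR r s hsr.symm)
      (coord F (Sum.inl a))
    have e1 : DH (rot F r s) (coord F (Sum.inl i) * rot F s l : O F m n) =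
        -(coord F (Sum.inl i) * rot F r l) := by
      have hi : parityInv (coord F (Sum.inl i) : O F m n) = coord F (Sum.inl i) :=
        parityInv_of_even (coord_inl_mem_par i)
      have hd : ∀ q (f : O F m n), dOdd q (coord F (Sum.inl i) * f) =
          coord F (Sum.inl i) * dOdd q f := fun q f => by
        rw [dOdd_mul, dOdd_coord_even, zero_mul, zero_add, hi]
      rw [DH_rot hsr.symm, hd, hd, rot, dOdd_mul, dOdd_mul, dOdd_coord, dOdd_coord, dOdd_coord,
        dOdd_coord, if_neg hsr.symm, if_neg hrl, if_pos rfl, if_neg hsl]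
      simp only [zero_mul, mul_zero, add_zero, one_mul, zero_sub]
      rw [← mul_assoc, ← mul_comm_of_even (coord_inl_mem_par i), mul_assoc, rot]
    rw [e1, DH_rot_coord_even hsr.symm, map_zero, sub_zero,
      DH_eq_zero_of_d (rot_mem_par r s) (hconst hsl a)] at h
    simpa using h
  · have hm := hP.pair_mem (F := F) (hP.single_le i) hrl
    have hd : ∀ j : EvenIdx m, dEven j (G (mono (Pi.single i 1) {r, l}) (coord F (Sum.inr q))) = 0 :=
      fun j => by
      have := hde hrl j (Sum.inr q)
      rw [coord_mul_rot i hrl, map_smul, LinearMap.smul_apply, map_smul] at this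
      exact (smul_eq_zero.1 this).resolve_left (sgn_ne_zero _ _)
    have hw := weight_rel hP hG (fun l => hK.quad l l.swap) hm hd i
    rw [coord_mul_rot i hrl, map_smul, LinearMap.smul_apply]
    refine smul_eq_zero_of_right _ ?_
    simpa [swap_ne] using hw

/-- A cocycle of negative degree whose inner part is normalized vanishes in low degrees. -/
theorem kills_of_degree (hP : Params p m n t) (hG : IsCocycle p t G) {k : ℤ}
    (hD : HasDegree p t k G) (hk : k ≤ -1)
    (h0 : ∀ i, G (coord F (Sum.inl i) * coord F (Sum.inl i.swap)) (coord F (Sum.inl i)) = 0) :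
    KillsQuad G ∧ KillsOdd G := by
  have hT := torus_eq_zero hP hG hD hk h0
  have hK : KillsQuad G := ⟨hD.lin hP hG hk, quad_eq_zero hP hG hD hk hT⟩
  have hR : ∀ r l, r ≠ l → G (rot F r l) = 0 := fun r l h => rot_eq_zero hP hG hD hk hT h
  exact ⟨hK, hR, fun i r l h => cub_eq_zero hP hG hD hk hK hR i h⟩

end HamSuper

/-! ### Derivations as cocycles on potentials. -/

namespace HamSuper

variable {F : Type*} [Field F] {m n p : ℕ} {t : EvenIdx m → ℕ}
variable [Fact p.Prime] [CharP F p]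

/-- Values outside `hamPot` are irrelevant. Extending to all of `O` spares every later formula the
membership proof in the argument of `G`. -/
theorem exists_lift (D : hamEven F n p t →ₗ[F] wittEven F n p t) :
    ∃ G : O F m n →ₗ[F] Module.End F (O F m n), ∀ f (hf : f ∈ hamPot F n p t),
      G f = (D (hamOf ⟨f, hf⟩) : Module.End F (O F m n)) := by
  obtain ⟨G, hG⟩ := LinearMap.exists_extend
    ((wittEven F n p t).toSubmodule.subtype ∘ₗ D ∘ₗ hamOf)
  exact ⟨G, fun f hf => LinearMap.congr_fun hG ⟨f, hf⟩⟩

/-- A map on potentials whose value at `f` is `D (D_H(f))`. -/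
noncomputable def lift (D : hamEven F n p t →ₗ[F] wittEven F n p t) :
    O F m n →ₗ[F] Module.End F (O F m n) :=
  (exists_lift D).choose

theorem lift_apply (D : hamEven F n p t →ₗ[F] wittEven F n p t) {f : O F m n}
    (hf : f ∈ hamPot F n p t) : lift D f = (D (hamOf ⟨f, hf⟩) : Module.End F (O F m n)) :=
  (exists_lift D).choose_spec f hf

theorem lift_add {D E : hamEven F n p t →ₗ[F] wittEven F n p t} {f : O F m n}
    (hf : f ∈ hamPot F n p t) : lift (D + E) f = lift D f + lift E f := by
  rw [lift_apply _ hf, lift_apply _ hf, lift_apply _ hf]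
  rfl

theorem lift_smul {D : hamEven F n p t →ₗ[F] wittEven F n p t} (c : F) {f : O F m n}
    (hf : f ∈ hamPot F n p t) : lift (c • D) f = c • lift D f := by
  rw [lift_apply _ hf, lift_apply _ hf]
  rfl

theorem eq_zero_of_lift {D : hamEven F n p t →ₗ[F] wittEven F n p t}
    (h : ∀ f ∈ hamPot F n p t, lift D f = 0) : D = 0 := by
  ext1 x
  obtain ⟨f, rfl⟩ := hamOf_surjective x
  have := h f f.2
  rw [lift_apply _ f.2] at this
  exact Subtype.ext this

theorem hamOf_lie (f g : hamPot F n p t) :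
    ⁅hamOf f, hamOf g⁆ = hamOf ⟨DH (f : O F m n) g, DH_mem_hamPot (hamPot_le f.2) (hamPot_le g.2)⟩ :=
  Subtype.ext (Subtype.ext (DH_lie (hamPot_le f.2) (hamPot_le g.2)))

theorem mem_derSpace_iff {D : hamEven F n p t →ₗ[F] wittEven F n p t} :
    D ∈ derSpace F n p t ↔ IsCocycle p t (lift D) := by
  constructor
  · rintro ⟨E, rfl⟩
    refine ⟨fun f hf => ?_, fun f hf g hg h => ?_⟩
    · rw [lift_apply _ hf]
      exact Subtype.prop _
    · rw [lift_apply _ hf, lift_apply _ hg,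
        lift_apply _ (DH_mem_hamPot (hamPot_le hf) (hamPot_le hg)), ← hamOf_lie ⟨f, hf⟩ ⟨g, hg⟩]
      have := E.leibniz' (hamOf ⟨f, hf⟩) (hamOf ⟨g, hg⟩)
      have h1 := congrArg (fun w : wittEven F n p t => w.1 h) this
      exact h1
  · intro hG
    refine ⟨⟨D, fun x y => ?_⟩, rfl⟩
    obtain ⟨f, rfl⟩ := hamOf_surjective x
    obtain ⟨g, rfl⟩ := hamOf_surjective y
    refine Subtype.ext (LinearMap.ext fun h => ?_)
    have := hG.lie f f.2 g g.2 h
    rw [lift_apply _ f.2, lift_apply _ g.2,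
      lift_apply _ (DH_mem_hamPot (hamPot_le f.2) (hamPot_le g.2)), ← hamOf_lie f g] at this
    exact this

theorem vf_coord (i b : Idx m n) (a : O F m n) :
    vf i a (coord F b) = if i = b then a else 0 := by
  rw [vf_apply, d_coord]
  split_ifs <;> simp

theorem mem_wittGr_iff {k : ℤ} {w : wittEven F n p t} :
    w ∈ wittGr F n p t k ↔ ∀ b, w.1 (coord F b) ∈ homog F m n (k + 1) := by
  constructor
  · intro h b
    refine Submodule.span_induction
      (p := fun (D : Module.End F (O F m n)) _ => D (coord F b) ∈ homog F m n (k + 1))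
      ?_ (by simp) (fun x y _ _ hx hy => by simpa using add_mem hx hy)
      (fun c x _ hx => by simpa using Submodule.smul_mem _ c hx) h
    rintro _ ⟨i, a, ha, rfl⟩
    rw [vf_coord]
    split_ifs
    · exact ha.2
    · exact zero_mem _
  · intro h
    change w.1 ∈ Submodule.span F _
    rw [wittEven_eq_sum w.2]
    exact sum_mem fun b _ => Submodule.subset_span
      ⟨b, _, ⟨wittEven_coord_mem w.2 b, h b⟩, rfl⟩

theorem DH_one : DH (1 : O F m n) = 0 := by
  ext f : 1
  have h : (1 : O F m n) ∈ par F m n 0 := mono_empty_mem_par 0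
  rw [DH_even h]
  simp [d_one]

theorem lift_one (D : hamEven F n p t →ₗ[F] wittEven F n p t)
    (h1 : (1 : O F m n) ∈ hamPot F n p t) : lift D 1 = 0 := by
  have : hamOf ⟨1, h1⟩ = (0 : hamEven F n p t) := Subtype.ext (Subtype.ext DH_one)
  rw [lift_apply _ h1, this, map_zero]
  rfl

/-- Every nonconstant monomial is detected by some partial derivative, and these are the components
of `D_H(f)`. The constant term lies in the kernel of `D_H` and stays unconstrained. -/
theorem homog_of_wittGr {i : ℤ} (f : hamPot F n p t)
    (hf : (hamOf f : wittEven F n p t) ∈ wittGr F n p t i) {α : EvenIdx m → ℕ}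
    {u : Finset (Fin n)} (h0 : (α, u) ≠ (0, ∅))
    (h : ((∑ i, α i + u.card : ℕ) : ℤ) ≠ i + 2) : coeff α u (f : O F m n) = 0 := by
  have hd : ∀ b : Idx m n, d b (f : O F m n) ∈ homog F m n (i + 1) := fun b => by
    have h1 := mem_wittGr_iff.1 hf (prime b)
    have h2 : (hamOf f : wittEven F n p t).1 (coord F (prime b)) =
        tau F b • d b (f : O F m n) := by
      have := DH_coord (Otr_le_par _ (hamPot_le f.2)) (prime b)
      rwa [prime_prime] at this
    rw [h2] at h1
    have h3 := Submodule.smul_mem _ (tau F b)⁻¹ h1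
    rwa [smul_smul, inv_mul_cancel₀ (tau_ne_zero b), one_smul] at h3
  by_cases hα : α = 0
  · subst hα
    obtain ⟨k, hk⟩ := Finset.nonempty_iff_ne_empty.2 (fun hu : u = ∅ => h0 (by rw [hu]))
    have h1 := coeff_dOdd (Finset.notMem_erase k u) 0 (f : O F m n)
    have hz : coeff 0 (u.erase k) (dOdd k (f : O F m n)) = 0 := by
      refine coeff_of_homog (hd (Sum.inr k)) ?_
      have := Finset.card_erase_add_one hk
      omega
    rw [Finset.insert_erase hk, hz] at h1
    exact (mul_eq_zero.1 h1.symm).resolve_left (sgn_ne_zero _ _)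
  · obtain ⟨j, hj⟩ : ∃ j, α j ≠ 0 := by
      by_contra hc
      exact hα (funext fun i => by_contra fun h' => hc ⟨i, h'⟩)
    obtain ⟨α, rfl⟩ := exists_eq_add_single hj
    rw [← coeff_dEven]
    refine coeff_of_homog (hd (Sum.inl j)) fun e => h ?_
    simp only [Pi.add_apply, Finset.sum_add_distrib, Finset.sum_pi_single', Finset.mem_univ,
      if_true]
    push_cast at e ⊢
    linarith

/-- Homogeneity can be tested on monomials, since `D_H(x^(α) x^u)` has degree `|α| + |u| - 2`. The
constant monomial satisfies every degree condition because its image is zero. -/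
theorem mem_derGr_iff {k : ℤ} {D : hamEven F n p t →ₗ[F] wittEven F n p t} :
    D ∈ derGr F n p t k ↔ IsCocycle p t (lift D) ∧ HasDegree p t k (lift D) := by
  rw [← mem_derSpace_iff]
  refine and_congr_right fun _ => ⟨fun h α u hm b => ?_, fun h i x hx => ?_⟩
  · have h1 : (hamOf ⟨_, hm⟩ : wittEven F n p t) ∈
        wittGr F n p t (((∑ i, α i + u.card : ℕ) : ℤ) - 2) := by
      refine mem_wittGr_iff.2 fun b => ?_
      have h2 := DH_coord (Otr_le_par _ (hamPot_le hm)) b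
      change DH _ _ ∈ _
      rw [h2]
      refine Submodule.smul_mem _ _ ?_
      have := d_mem_homog (mono_mem_homog (F := F) α u) (prime b)
      convert this using 2
      ring
    have h3 := mem_wittGr_iff.1 (h _ _ h1) b
    rw [lift_apply _ hm]
    convert h3 using 2
    ring
  · obtain ⟨f, rfl⟩ := hamOf_surjective x
    refine mem_wittGr_iff.2 fun b => ?_
    have e : (D (hamOf f)).1 = lift D f := (lift_apply D f.2).symm
    rw [e]
    have hf : (f : O F m n) ∈ monoSpan F {a : Mon m n | (mono a.1 a.2 : O F m n) ∈ hamPot F n p t ∧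
        (a = (0, ∅) ∨ ((∑ i, a.1 i + a.2.card : ℕ) : ℤ) = i + 2)} := by
      refine mem_monoSpan.2 fun α u hau => ?_
      by_contra hne
      have h1 : (mono α u : O F m n) ∈ hamPot F n p t := by
        refine mono_mem ?_
        by_contra hc
        exact hne (mem_monoSpan.1 f.2 α u hc)
      refine hau ⟨h1, ?_⟩
      by_contra hc
      push Not at hc
      exact hne (homog_of_wittGr f hx hc.1 hc.2)
    refine monoSpan_ind hf (by simp) (fun α u hau => ?_)
      (fun a b ha hb => by simpa using add_mem ha hb)
      (fun c a ha => by simpa using Submodule.smul_mem _ c ha)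
    rcases hau.2 with h0 | h0
    · obtain ⟨rfl, rfl⟩ := Prod.ext_iff.1 h0
      have := lift_one D hau.1
      rw [one_def] at this
      simp only at this ⊢
      rw [this]
      simp
    · have := h α u hau.1 b
      rw [show k + i + 1 = ((∑ i, α i + u.card : ℕ) : ℤ) - 1 + k by rw [h0]; ring]
      exact this

end HamSuper

/-! ### Powers of `∂_i`, the element `x^ω`, and brackets. -/

namespace HamSuper

variable {F : Type*} [Field F] {m n p : ℕ} {t : EvenIdx m → ℕ}

/-- Powers of `∂_i`, `i ∈ Y₀`. -/
noncomputable def dPow (i : EvenIdx m) (k : ℕ) : Module.End F (O F m n) :=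
  (d (Sum.inl i) : Module.End F (O F m n)) ^ k

theorem dPow_succ_apply (i : EvenIdx m) (k : ℕ) (f : O F m n) :
    dPow i (k + 1) f = dEven i (dPow i k f) := by
  rw [dPow, pow_succ', Module.End.mul_apply]
  rfl

theorem dPow_zero_apply (i : EvenIdx m) (f : O F m n) : dPow i 0 f = f := rfl

theorem dPow_mono_add (i : EvenIdx m) (k : ℕ) (α : EvenIdx m → ℕ) (u : Finset (Fin n)) :
    dPow i k (mono (α + Pi.single i k) u : O F m n) = mono α u := by
  induction k generalizing α with
  | zero => simp [dPow_zero_apply]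
  | succ k ih =>
    have e : α + Pi.single i (k + 1) = (α + Pi.single i 1) + Pi.single i k := by
      rw [add_assoc, ← Pi.single_add, add_comm 1 k]
    rw [dPow_succ_apply, e, ih, dEven_mono_add]

theorem dPow_mono_lt {i : EvenIdx m} {k : ℕ} {α : EvenIdx m → ℕ} (h : α i < k)
    (u : Finset (Fin n)) : dPow i k (mono α u : O F m n) = 0 := by
  induction k with
  | zero => omega
  | succ k ih =>
    rw [dPow_succ_apply]
    rcases lt_or_ge (α i) k with h1 | h1
    · rw [ih h1, map_zero]
    · have hk : α i = k := by omega
      have e : α = Function.update α i 0 + Pi.single i k := by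
        funext j
        rcases eq_or_ne j i with rfl | hj
        · simp [hk]
        · simp [hj]
      rw [e, dPow_mono_add, dEven_mono_zero (by simp)]

theorem dPow_mono_eq (i : EvenIdx m) (k : ℕ) (α : EvenIdx m → ℕ) (u : Finset (Fin n)) :
    dPow i k (mono α u : O F m n) = 0 ∨
      ∃ β, α = β + Pi.single i k ∧ dPow i k (mono α u : O F m n) = mono β u := by
  rcases lt_or_ge (α i) k with h | h
  · exact Or.inl (dPow_mono_lt h u)
  · right
    have e : α = (α - Pi.single i k) + Pi.single i k := by
      funext j
      rcases eq_or_ne j i with rfl | hj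
      · simp; omega
      · simp [hj]
    refine ⟨_, e, ?_⟩
    conv_lhs => rw [e]
    exact dPow_mono_add _ _ _ _

theorem dPow_mem_homog {e : ℤ} {f : O F m n} (hf : f ∈ homog F m n e) (i : EvenIdx m) (k : ℕ) :
    dPow i k f ∈ homog F m n (e - k) := by
  induction k with
  | zero => simpa [dPow_zero_apply] using hf
  | succ k ih =>
    rw [dPow_succ_apply]
    have := d_mem_homog ih (Sum.inl i)
    push_cast
    rwa [sub_sub] at this

theorem dPow_mem_Otr [Fact p.Prime] [CharP F p] {f : O F m n} (hf : f ∈ Otr F n p t 0) (i : EvenIdx m) (k : ℕ) :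
    dPow i k f ∈ Otr F n p t 0 := by
  induction k with
  | zero => simpa [dPow_zero_apply] using hf
  | succ k ih =>
    rw [dPow_succ_apply]
    exact dEven_mem ih

/-- The top element `x^ω` of the exterior algebra. -/
noncomputable def topOdd (F : Type*) [Field F] (m n : ℕ) : O F m n := mono 0 Finset.univ

/-- In `∂_k(f) ∂_k(x^ω)` the factor `∂_k(f)` has odd parity, so each of its monomials contains an
odd variable other than `x_k`, and that variable already occurs in `∂_k(x^ω)`. -/
theorem DH_topOdd {f : O F m n} (hf : f ∈ par F m n 0) : DH f (topOdd F m n) = 0 := by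
  refine monoSpan_ind hf (by simp) (fun α u h => ?_) (fun a b ha hb => by simp [ha, hb])
    (fun c a ha => by simp [ha])
  rw [DH_even (mono_mem_par h)]
  refine Finset.sum_eq_zero fun i _ => smul_eq_zero_of_right _ ?_
  rcases i with i | k
  · have : d (prime (Sum.inl i : Idx m n)) (topOdd F m n) = 0 := by
      simp [prime, d, dEven, topOdd]
    rw [this, mul_zero]
  · simp only [prime, Sum.map_inr, id, d, Sum.elim_inr, dOdd, topOdd, ofBasis_mono]
    split_ifs with hk
    · rw [smul_mul_assoc, mul_smul_comm, mono_mul_mono, if_neg, smul_zero, smul_zero]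
      intro hd
      have hcard := Finset.card_erase_add_one hk
      obtain ⟨l, hl⟩ : (u.erase k).Nonempty := by
        rw [← Finset.card_pos]
        rcases ZMod.natCast_eq_zero_iff_even.1 h with ⟨c, hc⟩
        change u.card = c + c at hc
        omega
      exact Finset.disjoint_left.1 hd hl (Finset.mem_erase.2 ⟨Finset.ne_of_mem_erase hl,
        Finset.mem_univ l⟩)
    · exact absurd (Finset.mem_univ k) ‹_›
    · rw [zero_mul]
    · rw [zero_mul]

theorem topOdd_mem_homog : topOdd F m n ∈ homog F m n n := by
  have := mono_mem_homog (F := F) (0 : EvenIdx m → ℕ) (Finset.univ : Finset (Fin n))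
  simpa [topOdd] using this

theorem DH_antisymm {f g : O F m n} (hf : f ∈ par F m n 0) (hg : g ∈ par F m n 0) :
    DH f g = - DH g f := by
  rw [DH_even hf, DH_even hg, ← Finset.sum_neg_distrib]
  refine Finset.sum_nbij' prime prime (by simp) (by simp) (fun i _ => prime_prime i)
    (fun i _ => prime_prime i) fun i _ => ?_
  rw [prime_prime]
  have hpar : ∀ {h : O F m n}, h ∈ par F m n 0 → ∀ i : Idx m n, d i h ∈ par F m n (mu i) := by
    intro h hh i
    refine monoSpan_ind hh (by simp) (fun α u hu => ?_)
      (fun a b ha hb => by simpa using add_mem ha hb)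
      (fun c a ha => by simpa using Submodule.smul_mem _ c ha)
    -- The parity of a derivative does not depend on the truncation. With base 2 and heights `α_i +
    -- 1` the truncated algebra contains the given monomial.
    have hm : (mono α u : O F m n) ∈ Otr F n 2 (fun i => α i + 1) 0 := by
      refine mono_mem ⟨fun i => ?_, hu⟩
      have : α i + 1 < 2 ^ (α i + 1) := Nat.lt_two_pow_self
      simp only [topExp]
      omega
    have := Otr_le_par _ (d_mem (i := i) hm)
    rwa [zero_add] at this
  rcases i with i | k
  · have h1 := hpar hf (Sum.inl i)
    change dEven i f ∈ par F m n 0 at h1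
    change tau F (Sum.inl i : Idx m n) • (dEven i f * dEven i.swap g) =
      -(tau F (Sum.inl i.swap : Idx m n) • (dEven i.swap g * dEven i f))
    rw [tau_swap, neg_smul, neg_neg, mul_comm_of_even h1]
  · have h1 := hpar hf (Sum.inr k)
    have h2 := hpar hg (Sum.inr k)
    change dOdd k f ∈ par F m n 1 at h1
    change dOdd k g ∈ par F m n 1 at h2
    change (1 : F) • (dOdd k f * dOdd k g) = -((1 : F) • (dOdd k g * dOdd k f))
    have := mul_comm_of_odd h1 (dOdd k g)
    rw [parityInv_of_odd h2] at this
    rw [one_smul, one_smul, ← this, mul_neg, neg_neg]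

/-- A bracket is a divergence. An even `∂_i` cannot produce `x^(π)` inside the truncated algebra,
and an odd `∂_k` would need a term `x^(π) x_k` in `f ∂_k(g)`, forcing a monomial of `f` to have
exactly the one odd variable `x_k`, against its parity. -/
theorem coeff_top_empty_DH [Fact p.Prime] [CharP F p] {f g : O F m n}
    (hf : f ∈ Otr F n p t 0) (hg : g ∈ Otr F n p t 0) :
    coeff (topExp p t) ∅ (DH f g) = 0 := by
  rw [DH_divergence (Otr_le_par _ hf), map_sum]
  refine Finset.sum_eq_zero fun i _ => ?_
  rw [map_smul]
  refine smul_eq_zero_of_right _ ?_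
  rcases i with i | k
  · have hx := mul_mem_Otr hf (d_mem (i := prime (Sum.inl i)) hg)
    change coeff _ _ (dEven i _) = 0
    rw [coeff_dEven]
    refine mem_monoSpan.1 hx _ _ fun h => ?_
    have := h.1 i
    simp at this
  · change coeff _ _ (dOdd k (f * dOdd k g)) = 0
    rw [coeff_dOdd (Finset.notMem_empty k)]
    refine mul_eq_zero_of_right _ ?_
    rw [insert_empty_eq]
    refine monoSpan_ind (Otr_le_par _ hf) (by simp) (fun α u h => ?_)
      (fun a b ha hb => by simp [add_mul, ha, hb]) (fun c a ha => by simp [ha])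
    refine O_ind g (by simp) (fun β v => ?_) (fun a b ha hb => by simp [mul_add, ha, hb])
      (fun c a ha => by simp [ha])
    simp only [dOdd, ofBasis_mono]
    split_ifs with hk
    · rw [mul_smul_comm, mono_mul_mono]
      split_ifs with hd
      · rw [map_smul, map_smul, coeff_mono, if_neg]
        · simp
        · rintro ⟨-, e⟩
          have h1 : u ⊆ {k} := fun x hx => by
            have : x ∈ u ∪ v.erase k := Finset.mem_union_left _ hx
            rw [e] at this
            simpa using this
          have h2 : k ∈ u := by
            have : k ∈ u ∪ v.erase k := by rw [e]; simp
            simpa using this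
          have h3 : u = {k} := Finset.Subset.antisymm h1 (by simpa using h2)
          rw [h3] at h
          simp at h
      · simp
    · simp

theorem O_nontrivial : Nontrivial (O F m n) :=
  ⟨⟨1, 0, fun h => by
    have := congrArg (coeff 0 ∅) h
    rw [one_def, coeff_mono] at this
    simp at this⟩⟩

theorem DH_lie_d {f : O F m n} (hf : f ∈ Otr F n p t 0) (i : EvenIdx m) :
    (d (Sum.inl i) : Module.End F (O F m n)) * DH f - DH f * (d (Sum.inl i)) =
      DH (dEven i f) := by
  ext h : 1
  have := DH_d hf (Sum.inl i) h
  change dEven i (DH f h) - DH f (dEven i h) = DH (dEven i f) h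
  change DH f (dEven i h) = dEven i (DH f h) - DH (dEven i f) h at this
  rw [this]
  abel

variable [Fact p.Prime] [CharP F p]

theorem DH_lie_apply {f g : O F m n} (hf : f ∈ Otr F n p t 0) (hg : g ∈ Otr F n p t 0)
    (h : O F m n) : DH (DH f g) h = DH f (DH g h) - DH g (DH f h) := by
  rw [← DH_lie hf hg]
  rfl

/-- `∂_i^(p^s)` is a derivation of the bracket. -/
theorem dPow_DH {f : O F m n} (hf : f ∈ Otr F n p t 0) (i : EvenIdx m) (s : ℕ) (g : O F m n) :
    dPow i (p ^ s) (DH f g) = DH (dPow i (p ^ s) f) g + DH f (dPow i (p ^ s) g) := by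
  set a : Module.End F (O F m n) := d (Sum.inl i) with ha
  -- The difference of left and right multiplication by `∂_i` is `ad ∂_i` on operators.
  have h1 : ∀ k, ((LinearMap.mulLeft F a - LinearMap.mulRight F a) ^ k) (DH f) =
      DH (dPow i k f) := by
    intro k
    induction k with
    | zero => rfl
    | succ k ih =>
      rw [pow_succ', Module.End.mul_apply, ih, dPow_succ_apply,
        ← DH_lie_d (dPow_mem_Otr hf i k)]
      rfl
  have := O_nontrivial (F := F) (m := m) (n := n)
  have : CharP (Module.End F (Module.End F (O F m n))) p :=
    charP_of_injective_algebraMap (algebraMap F _).injective p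
  have h2 := h1 (p ^ s)
  -- Left and right multiplications commute, so Frobenius gives `(ad ∂_i)^{p^s} = ad(∂_i^{p^s})`.
  rw [sub_pow_char_pow_of_commute _ _ (LinearMap.commute_mulLeft_right a a),
    LinearMap.pow_mulLeft, LinearMap.pow_mulRight] at h2
  have h3 := LinearMap.congr_fun h2 g
  change dPow i (p ^ s) (DH f g) - DH f (dPow i (p ^ s) g) = _ at h3
  rw [← h3]
  abel

end HamSuper

/-! ### The exceptional maps are derivations of the expected degree. -/

namespace HamSuper

variable {F : Type*} [Field F] {m n p : ℕ} {t : EvenIdx m → ℕ}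
variable [Fact p.Prime] [CharP F p]

theorem topOdd_mem (he : Even n) : topOdd F m n ∈ Otr F n p t 0 := topMono_mem he

theorem ad_partialW_pow (i : EvenIdx m) (k : ℕ) {f : O F m n} (hf : f ∈ Otr F n p t 0) :
    (((LieAlgebra.ad F (wittEven F n p t) (partialW i)) ^ k) ⟨DH f, DH_mem_wittEven hf⟩).1 =
      DH (dPow i k f) := by
  induction k with
  | zero => rfl
  | succ k ih =>
    rw [pow_succ', Module.End.mul_apply, dPow_succ_apply, ← DH_lie_d (dPow_mem_Otr hf i k), ← ih]
    rfl

theorem lift_adPartialPow (s : ℕ) (i : EvenIdx m) {f : O F m n} (hf : f ∈ hamPot F n p t) :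
    lift (adPartialPow (t := t) s i) f = DH (dPow i (p ^ s) f) := by
  rw [lift_apply _ hf, ← ad_partialW_pow i _ (hamPot_le hf)]
  rfl

theorem lift_theta (he : Even n) (s : ℕ) (i : EvenIdx m) {f : O F m n}
    (hf : f ∈ hamPot F n p t) (h : O F m n) :
    lift (theta (t := t) he s i) f h = topOdd F m n * DH (dPow i (p ^ s) f) h := by
  rw [← lift_adPartialPow s i hf, lift_apply _ hf, lift_apply _ hf]
  rfl

theorem lift_phi (he : Even n) (s : ℕ) (i : EvenIdx m) {f : O F m n}
    (hf : f ∈ hamPot F n p t) (h : O F m n) :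
    lift (phi (t := t) he s i) f h = dPow i (p ^ s) f * DH (topOdd F m n) h := by
  rw [lift_apply _ hf, phi_hamOf]
  rfl

theorem lift_gam (hπ : topExp p t ≠ 0) (he : Even n) {f : O F m n}
    (hf : f ∈ hamPot F n p t) (h : O F m n) :
    lift (gam (t := t) he (1 : F)) f h = coeff (topExp p t) ∅ f • DH (topOdd F m n) h := by
  rw [lift_apply _ hf, gam_hamOf hπ, one_smul]
  rfl

theorem lift_adMap (v : wittEven F n p t) {f : O F m n} (hf : f ∈ hamPot F n p t) (h : O F m n) :
    lift (adMap F n p t v) f h = v.1 (DH f h) - DH f (v.1 h) := by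
  rw [lift_apply _ hf]
  rfl

theorem DH_dPow_DH {f g : O F m n} (hf : f ∈ Otr F n p t 0) (hg : g ∈ Otr F n p t 0)
    (i : EvenIdx m) (s : ℕ) (h : O F m n) :
    DH (dPow i (p ^ s) (DH f g)) h =
      DH f (DH (dPow i (p ^ s) g) h) - DH (dPow i (p ^ s) g) (DH f h) -
        (DH g (DH (dPow i (p ^ s) f) h) - DH (dPow i (p ^ s) f) (DH g h)) := by
  rw [dPow_DH hf, map_add, LinearMap.add_apply, DH_lie_apply (dPow_mem_Otr hf _ _) hg,
    DH_lie_apply hf (dPow_mem_Otr hg _ _)]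
  abel

/-- The commutator is `D_H` of `D_H(f)(x^ω) = 0`. -/
theorem DH_topOdd_comm (he : Even n) {f : O F m n} (hf : f ∈ Otr F n p t 0) (h : O F m n) :
    DH f (DH (topOdd F m n) h) = DH (topOdd F m n) (DH f h) := by
  have := DH_lie_apply hf (topOdd_mem he) h
  rw [DH_topOdd (Otr_le_par _ hf), map_zero, LinearMap.zero_apply] at this
  exact sub_eq_zero.1 this.symm

theorem isCocycle_adPartialPow (s : ℕ) (i : EvenIdx m) :
    IsCocycle p t (lift (adPartialPow s i : hamEven F n p t →ₗ[F] wittEven F n p t)) := by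
  refine ⟨fun f hf => ?_, fun f hf g hg h => ?_⟩
  · rw [lift_apply _ hf]
    exact Subtype.prop _
  · rw [lift_adPartialPow _ _ (DH_mem_hamPot (hamPot_le hf) (hamPot_le hg)),
      lift_adPartialPow _ _ hf, lift_adPartialPow _ _ hg, DH_dPow_DH (hamPot_le hf) (hamPot_le hg)]

/-- Since every `D_H(f)` kills `x^ω`, multiplication by `x^ω` commutes with the action and sends the
cocycle of `(ad ∂_i)^{p^s}` to a cocycle. -/
theorem isCocycle_theta (he : Even n) (s : ℕ) (i : EvenIdx m) :
    IsCocycle p t (lift (theta he s i : hamEven F n p t →ₗ[F] wittEven F n p t)) := by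
  refine ⟨fun f hf => ?_, fun f hf g hg h => ?_⟩
  · rw [lift_apply _ hf]
    exact Subtype.prop _
  · rw [lift_theta _ _ _ (DH_mem_hamPot (hamPot_le hf) (hamPot_le hg)),
      lift_theta _ _ _ hf, lift_theta _ _ _ hg, lift_theta _ _ _ hf, lift_theta _ _ _ hg,
      DH_dPow_DH (hamPot_le hf) (hamPot_le hg), DH_mul (hamPot_le hf), DH_mul (hamPot_le hg),
      DH_topOdd (Otr_le_par _ (hamPot_le hf)), DH_topOdd (Otr_le_par _ (hamPot_le hg))]
    simp only [zero_mul, zero_add, mul_sub]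

/-- `∂_i^{p^s}` is a derivation of the bracket with values in functions, and the factor `D_H(x^ω)`
commutes with all `D_H(f)`. -/
theorem isCocycle_phi (he : Even n) (s : ℕ) (i : EvenIdx m) :
    IsCocycle p t (lift (phi he s i : hamEven F n p t →ₗ[F] wittEven F n p t)) := by
  refine ⟨fun f hf => ?_, fun f hf g hg h => ?_⟩
  · rw [lift_apply _ hf]
    exact Subtype.prop _
  · have hf' := hamPot_le hf
    have hg' := hamPot_le hg
    rw [lift_phi _ _ _ (DH_mem_hamPot hf' hg'),
      lift_phi _ _ _ hf, lift_phi _ _ _ hg, lift_phi _ _ _ hf, lift_phi _ _ _ hg,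
      DH_mul hf', DH_mul hg', DH_topOdd_comm he hf', DH_topOdd_comm he hg', dPow_DH hf',
      DH_antisymm (Otr_le_par _ (dPow_mem_Otr hf' _ _)) (Otr_le_par _ hg'), add_mul, neg_mul]
    abel

/-- Both sides of the Leibniz rule vanish: the coefficient of `x^(π)` is zero on brackets, and
`D_H(x^ω)` commutes with all `D_H(f)`. -/
theorem isCocycle_gam (hπ : topExp p t ≠ 0) (he : Even n) :
    IsCocycle p t (lift (gam he 1 : hamEven F n p t →ₗ[F] wittEven F n p t)) := by
  refine ⟨fun f hf => ?_, fun f hf g hg h => ?_⟩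
  · rw [lift_apply _ hf]
    exact Subtype.prop _
  · have hf' := hamPot_le hf
    have hg' := hamPot_le hg
    rw [lift_gam hπ _ (DH_mem_hamPot hf' hg'), lift_gam hπ _ hf, lift_gam hπ _ hg,
      lift_gam hπ _ hf, lift_gam hπ _ hg, map_smul, map_smul, DH_topOdd_comm he hf',
      DH_topOdd_comm he hg', coeff_top_empty_DH hf' hg']
    simp

theorem isCocycle_adMap (v : wittEven F n p t) : IsCocycle p t (lift (adMap F n p t v)) := by
  refine ⟨fun f hf => ?_, fun f hf g hg h => ?_⟩
  · rw [lift_apply _ hf]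
    exact Subtype.prop _
  · have hf' := hamPot_le hf
    have hg' := hamPot_le hg
    rw [lift_adMap _ (DH_mem_hamPot hf' hg'), lift_adMap _ hf, lift_adMap _ hg,
      lift_adMap _ hf, lift_adMap _ hg, DH_lie_apply hf' hg', DH_lie_apply hf' hg']
    simp only [map_sub]
    abel

theorem DH_coord_mem_homog {f : O F m n} (hp : f ∈ par F m n 0) {e : ℤ}
    (hf : f ∈ homog F m n e) (b : Idx m n) : DH f (coord F b) ∈ homog F m n (e - 1) := by
  rw [DH_coord hp]
  exact Submodule.smul_mem _ _ (d_mem_homog hf _)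

theorem wittGr_apply_mem {k e : ℤ} {v : wittEven F n p t} (hv : v ∈ wittGr F n p t k)
    {f : O F m n} (hf : f ∈ homog F m n e) : v.1 f ∈ homog F m n (e + k) := by
  rw [wittEven_apply v.2]
  refine sum_mem fun b _ => ?_
  have := mul_mem_homog (mem_wittGr_iff.1 hv b) (d_mem_homog hf b)
  rwa [show k + 1 + (e - 1) = e + k by ring] at this

theorem DH_mem_wittGr {f : O F m n} (hf : f ∈ Otr F n p t 0) {e : ℤ}
    (h : f ∈ homog F m n e) :
    (⟨DH f, DH_mem_wittEven hf⟩ : wittEven F n p t) ∈ wittGr F n p t (e - 2) :=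
  mem_wittGr_iff.2 fun b => by
    have := DH_coord_mem_homog (Otr_le_par _ hf) h b
    rwa [show e - 2 + 1 = e - 1 by ring]

theorem adPartialPow_mem (s : ℕ) (i : EvenIdx m) :
    (adPartialPow s i : hamEven F n p t →ₗ[F] wittEven F n p t) ∈
      derGr F n p t (-(p : ℤ) ^ s) := by
  refine mem_derGr_iff.2 ⟨isCocycle_adPartialPow s i, fun α u hm b => ?_⟩
  rw [lift_adPartialPow _ _ hm]
  have := DH_coord_mem_homog (Otr_le_par _ (dPow_mem_Otr (hamPot_le hm) i (p ^ s)))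
    (dPow_mem_homog (mono_mem_homog (F := F) α u) i (p ^ s)) b
  convert this using 2
  push_cast
  ring

theorem theta_mem (he : Even n) (s : ℕ) (i : EvenIdx m) :
    (theta he s i : hamEven F n p t →ₗ[F] wittEven F n p t) ∈
      derGr F n p t (n - (p : ℤ) ^ s) := by
  refine mem_derGr_iff.2 ⟨isCocycle_theta he s i, fun α u hm b => ?_⟩
  rw [lift_theta _ _ _ hm]
  have := mul_mem_homog topOdd_mem_homog
    (DH_coord_mem_homog (Otr_le_par _ (dPow_mem_Otr (hamPot_le hm) i (p ^ s)))
    (dPow_mem_homog (mono_mem_homog (F := F) α u) i (p ^ s)) b)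
  convert this using 2
  push_cast
  ring

theorem phi_mem (he : Even n) (s : ℕ) (i : EvenIdx m) :
    (phi he s i : hamEven F n p t →ₗ[F] wittEven F n p t) ∈ derGr F n p t (n - (p : ℤ) ^ s) := by
  refine mem_derGr_iff.2 ⟨isCocycle_phi he s i, fun α u hm b => ?_⟩
  rw [lift_phi _ _ _ hm]
  have := mul_mem_homog (dPow_mem_homog (mono_mem_homog (F := F) α u) i (p ^ s))
    (DH_coord_mem_homog (Otr_le_par _ (topOdd_mem (F := F) (p := p) (t := t) he))
      topOdd_mem_homog b)
  convert this using 2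
  push_cast
  ring

/-- `D_H(x^(π))` has degree `|π| - 2` and `D_H(x^ω)` has degree `n - 2`; the difference is negative
exactly when `|π| > n`. -/
theorem gam_mem (hπ : topExp p t ≠ 0) (he : Even n) :
    (gam he 1 : hamEven F n p t →ₗ[F] wittEven F n p t) ∈
      derGr F n p t (n - (∑ i, topExp p t i : ℕ)) := by
  refine mem_derGr_iff.2 ⟨isCocycle_gam hπ he, fun α u hm b => ?_⟩
  rw [lift_gam hπ _ hm, coeff_mono]
  split_ifs with h
  · obtain ⟨rfl, rfl⟩ := h
    refine Submodule.smul_mem _ _ ?_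
    have := DH_coord_mem_homog (Otr_le_par _ (topOdd_mem (F := F) (p := p) (t := t) he))
      topOdd_mem_homog b
    convert this using 2
    rw [Finset.card_empty]
    push_cast
    ring
  · simp

theorem adMap_mem {k : ℤ} {v : wittEven F n p t} (hv : v ∈ wittGr F n p t k) :
    adMap F n p t v ∈ derGr F n p t k := by
  refine mem_derGr_iff.2 ⟨isCocycle_adMap v, fun α u hm b => ?_⟩
  rw [lift_adMap _ hm]
  have hp := Otr_le_par _ (hamPot_le hm)
  have hh := mono_mem_homog (F := F) α u
  refine sub_mem ?_ ?_
  · have := wittGr_apply_mem hv (DH_coord_mem_homog hp hh b)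
    exact this
  · have := wittGr_apply_mem (DH_mem_wittGr (hamPot_le hm) hh) (mem_wittGr_iff.1 hv b)
    convert this using 2
    ring

end HamSuper

/-! ### Scalar invariants of the exceptional derivations and removal of the inner part. -/

namespace HamSuper

variable {F : Type*} [Field F] {m n p : ℕ} {t : EvenIdx m → ℕ}

theorem coeff_dPow (i : EvenIdx m) (k : ℕ) (α : EvenIdx m → ℕ) (u : Finset (Fin n))
    (f : O F m n) : coeff α u (dPow i k f) = coeff (α + Pi.single i k) u f := by
  induction k generalizing α with
  | zero => simp [dPow_zero_apply]
  | succ k ih =>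
    rw [dPow_succ_apply, coeff_dEven, ih, add_assoc, ← Pi.single_add, add_comm 1 k]

theorem coeff_topOdd_mul (g : O F m n) (v : Finset (Fin n)) :
    coeff 0 v (topOdd F m n * g) = if v = Finset.univ then coeff 0 ∅ g else 0 := by
  refine O_ind g (by simp) (fun β w => ?_) (fun a b ha hb => ?_) (fun c a ha => ?_)
  · rw [topOdd, mono_mul_mono]
    by_cases hw : w = ∅
    · subst hw
      rw [if_pos (Finset.disjoint_empty_right _), sgn_empty_right, multiBinom_zero_left,
        map_smul, zero_add, Finset.union_empty, coeff_mono, coeff_mono]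
      simp only [and_true, Nat.cast_one, mul_one, one_smul, eq_comm (a := Finset.univ)]
      by_cases hv : v = Finset.univ <;> simp [hv]
    · rw [if_neg, map_zero, coeff_mono]
      · simp [hw]
      · intro h
        rw [Finset.disjoint_iff_inter_eq_empty, Finset.univ_inter] at h
        exact hw h
  · rw [mul_add, map_add, ha, hb, map_add]
    split_ifs <;> simp
  · rw [mul_smul_comm, map_smul, ha, map_smul]
    split_ifs <;> simp

theorem topOdd_mem_par (he : Even n) : topOdd F m n ∈ par F m n 0 :=
  mono_mem_par (by simpa using ZMod.natCast_eq_zero_iff_even.2 he)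

theorem DH_topOdd_even (he : Even n) (i : EvenIdx m) :
    DH (topOdd F m n) (coord F (Sum.inl i)) = 0 := by
  rw [DH_coord (topOdd_mem_par he)]
  simp [prime, d, dEven, topOdd]

theorem DH_topOdd_odd (he : Even n) (k : Fin n) :
    DH (topOdd F m n) (coord F (Sum.inr k)) =
      sgn F {k} Finset.univ • mono 0 (Finset.univ.erase k) := by
  rw [DH_coord (topOdd_mem_par he)]
  simp [prime, d, dOdd, topOdd, tau]

theorem coeff_mul_mono_zero {g : O F m n} (hg : g ∈ monoSpan F {a : Mon m n | a.2 = ∅})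
    (w : Finset (Fin n)) : coeff 0 w (g * mono 0 w) = coeff 0 ∅ g := by
  refine monoSpan_ind hg (by simp) (fun α u h => ?_) (fun a b ha hb => by simp [add_mul, ha, hb])
    (fun c a ha => by simp [ha])
  obtain rfl : u = ∅ := h
  rw [mono_empty_mul_mono, multiBinom_zero_right, Nat.cast_one, one_smul, add_zero, coeff_mono,
    coeff_mono]
  simp

theorem dPow_mono_mem (i : EvenIdx m) (k : ℕ) (α : EvenIdx m → ℕ) :
    (dPow i k (mono α ∅) : O F m n) ∈ monoSpan F {a : Mon m n | a.2 = ∅} := by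
  rcases dPow_mono_eq (F := F) (n := n) i k α ∅ with h | ⟨β, -, h⟩
  · rw [h]
    exact zero_mem _
  · rw [h]
    exact mono_mem rfl

theorem single_pow_inj [hp : Fact p.Prime] {i r : EvenIdx m} {s s' : ℕ} :
    (Pi.single i (p ^ s') : EvenIdx m → ℕ) = Pi.single r (p ^ s) ↔ i = r ∧ s' = s := by
  constructor
  · intro h
    have hi : i = r := by
      by_contra hne
      have := congrFun h i
      rw [Pi.single_eq_same, Pi.single_eq_of_ne hne] at this
      exact pow_ne_zero _ hp.out.ne_zero this
    subst hi
    exact ⟨rfl, Nat.pow_right_injective hp.out.two_le (Pi.single_injective i h)⟩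
  · rintro ⟨rfl, rfl⟩
    rfl

theorem Params.topExp_ne_single [Fact p.Prime] (hP : Params p m n t) (r : EvenIdx m) (k : ℕ) :
    topExp p t ≠ Pi.single r k := fun h => by
  have := hP.four_le r.swap
  rw [h, Pi.single_eq_of_ne (swap_ne r)] at this
  omega

theorem Params.topExp_ne_zero [Fact p.Prime] (hP : Params p m n t) : topExp p t ≠ 0 := fun h => by
  have := hP.four_le (Sum.inl ⟨0, by have := hP.one_lt; omega⟩)
  rw [h] at this
  simp at this

variable [Fact p.Prime] [CharP F p]

/-- This and the following evaluations form a diagonal table: on the four families of scalars in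
`cocycle_eq_zero`, each exceptional family is nonzero in one of them only, where its values are
signs. -/
theorem lam_adPartialPow_even {β : EvenIdx m → ℕ} (hm : (mono β ∅ : O F m n) ∈ hamPot F n p t)
    (s : ℕ) (i : EvenIdx m) (r : EvenIdx m) (v : Finset (Fin n)) :
    lam (lift (adPartialPow (F := F) (t := t) s i)) (Sum.inl r) v β =
      if β = Pi.single r.swap 1 + Pi.single i (p ^ s) ∧ ∅ = v then
        tau F (Sum.inl r.swap : Idx m n) else 0 := by
  rw [lam, lift_adPartialPow _ _ hm, DH_coord (Otr_le_par _ (dPow_mem_Otr (hamPot_le hm) _ _))]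
  change coeff 0 v (tau F (Sum.inl r.swap : Idx m n) • dEven r.swap _) = _
  rw [map_smul, coeff_dEven, coeff_dPow, zero_add, coeff_mono, smul_eq_mul, mul_ite, mul_one,
    mul_zero]

theorem lam_adPartialPow_odd {β : EvenIdx m → ℕ} (hm : (mono β ∅ : O F m n) ∈ hamPot F n p t)
    (s : ℕ) (i : EvenIdx m) (hn : (∅ : Finset (Fin n)) ≠ Finset.univ) (k : Fin n) :
    lam (lift (adPartialPow (F := F) (t := t) s i)) (Sum.inr k) (Finset.univ.erase k) β = 0 := by
  rw [lam, lift_adPartialPow _ _ hm, DH_coord (Otr_le_par _ (dPow_mem_Otr (hamPot_le hm) _ _))]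
  change coeff 0 _ ((1 : F) • dOdd k _) = 0
  rw [one_smul, coeff_dOdd (Finset.notMem_erase _ _), Finset.insert_erase (Finset.mem_univ _),
    coeff_dPow, coeff_mono, if_neg (fun h => hn h.2), mul_zero]

theorem lam_theta_even {β : EvenIdx m → ℕ} (hm : (mono β ∅ : O F m n) ∈ hamPot F n p t)
    (s : ℕ) (i : EvenIdx m) (he : Even n) (r : EvenIdx m) (v : Finset (Fin n)) :
    lam (lift (theta (F := F) (t := t) he s i)) (Sum.inl r) v β =
      if β = Pi.single r.swap 1 + Pi.single i (p ^ s) ∧ v = Finset.univ then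
        tau F (Sum.inl r.swap : Idx m n) else 0 := by
  rw [lam, lift_theta _ _ _ hm, coeff_topOdd_mul, ← lift_adPartialPow _ _ hm]
  have := lam_adPartialPow_even hm s i r ∅
  rw [lam] at this
  rw [this]
  split_ifs <;> simp_all

theorem lam_theta_odd {β : EvenIdx m → ℕ} (hm : (mono β ∅ : O F m n) ∈ hamPot F n p t)
    (s : ℕ) (i : EvenIdx m) (he : Even n) (k : Fin n) :
    lam (lift (theta (F := F) (t := t) he s i)) (Sum.inr k) (Finset.univ.erase k) β = 0 := by
  rw [lam, lift_theta _ _ _ hm, coeff_topOdd_mul, if_neg]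
  intro h
  have := Finset.notMem_erase k Finset.univ
  rw [h] at this
  exact this (Finset.mem_univ k)

theorem lam_phi_even {β : EvenIdx m → ℕ} (hm : (mono β ∅ : O F m n) ∈ hamPot F n p t)
    (s : ℕ) (i : EvenIdx m) (he : Even n) (r : EvenIdx m) (v : Finset (Fin n)) :
    lam (lift (phi (F := F) (t := t) he s i)) (Sum.inl r) v β = 0 := by
  rw [lam, lift_phi _ _ _ hm, DH_topOdd_even he, mul_zero, map_zero]

theorem lam_phi_odd {β : EvenIdx m → ℕ} (hm : (mono β ∅ : O F m n) ∈ hamPot F n p t)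
    (s : ℕ) (i : EvenIdx m) (he : Even n) (k : Fin n) :
    lam (lift (phi (F := F) (t := t) he s i)) (Sum.inr k) (Finset.univ.erase k) β =
      if β = Pi.single i (p ^ s) then sgn F {k} Finset.univ else 0 := by
  rw [lam, lift_phi _ _ _ hm, DH_topOdd_odd he, mul_smul_comm, map_smul,
    coeff_mul_mono_zero (dPow_mono_mem _ _ _), coeff_dPow, zero_add, coeff_mono]
  simp

theorem lam_gam_even {β : EvenIdx m → ℕ} (hm : (mono β ∅ : O F m n) ∈ hamPot F n p t)
    (hP : Params p m n t) (he : Even n) (r : EvenIdx m) (v : Finset (Fin n)) :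
    lam (lift (gam (t := t) he (1 : F))) (Sum.inl r) v β = 0 := by
  rw [lam, lift_gam hP.topExp_ne_zero _ hm, DH_topOdd_even he, smul_zero, map_zero]

theorem lam_gam_odd {β : EvenIdx m → ℕ} (hm : (mono β ∅ : O F m n) ∈ hamPot F n p t)
    (hP : Params p m n t) (he : Even n) (k : Fin n) :
    lam (lift (gam (t := t) he (1 : F))) (Sum.inr k) (Finset.univ.erase k) β =
      if β = topExp p t then sgn F {k} Finset.univ else 0 := by
  rw [lam, lift_gam hP.topExp_ne_zero _ hm, DH_topOdd_odd he, coeff_mono, map_smul, map_smul,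
    coeff_mono]
  simp

/-- The value at a potential and a coordinate, as a linear function of the derivation. -/
noncomputable def evalLift {f : O F m n} (hf : f ∈ hamPot F n p t) (b : Idx m n) :
    (hamEven F n p t →ₗ[F] wittEven F n p t) →ₗ[F] O F m n where
  toFun D := lift D f (coord F b)
  map_add' D E := by rw [lift_add hf]; rfl
  map_smul' c D := by rw [lift_smul c hf]; rfl

theorem evalLift_apply {f : O F m n} (hf : f ∈ hamPot F n p t) (b : Idx m n)
    (D : hamEven F n p t →ₗ[F] wittEven F n p t) : evalLift hf b D = lift D f (coord F b) := rfl

/-- The coefficient `lam`, as a linear function of the derivation. -/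
noncomputable def lamL {β : EvenIdx m → ℕ} (hm : (mono β ∅ : O F m n) ∈ hamPot F n p t)
    (b : Idx m n) (u : Finset (Fin n)) :
    (hamEven F n p t →ₗ[F] wittEven F n p t) →ₗ[F] F :=
  coeff 0 u ∘ₗ evalLift hm b

theorem lamL_apply {β : EvenIdx m → ℕ} (hm : (mono β ∅ : O F m n) ∈ hamPot F n p t)
    (b : Idx m n) (u : Finset (Fin n)) (D : hamEven F n p t →ₗ[F] wittEven F n p t) :
    lamL hm b u D = lam (lift D) b u β := rfl

/-- The components of a map that a suitable inner derivation removes. -/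
noncomputable def torusPart (hP : Params p m n t) (i : EvenIdx m) :
    (hamEven F n p t →ₗ[F] wittEven F n p t) →ₗ[F] O F m n :=
  evalLift (hP.quad_mem i i.swap) (Sum.inl i)

/-- As `p^s > 1`, the operator `∂_r^{p^s}` kills `x_i x_{i'}`, in which every exponent is at most
one. Subtracting such terms does not disturb the normalization. -/
theorem torusPart_adPartialPow (hP : Params p m n t) {s : ℕ} (hs : s ≠ 0) (r i : EvenIdx m) :
    torusPart hP i (adPartialPow s r : hamEven F n p t →ₗ[F] wittEven F n p t) = 0 ∧
      dPow r (p ^ s) (coord F (Sum.inl i) * coord F (Sum.inl i.swap) : O F m n) = 0 := by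
  have h1 : 1 < p ^ s := Nat.one_lt_pow hs (by have := hP.three_lt; omega)
  have h2 : dPow r (p ^ s) (coord F (Sum.inl i) * coord F (Sum.inl i.swap) : O F m n) = 0 := by
    rw [quad_eq_smul, map_smul, dPow_mono_lt, smul_zero]
    refine lt_of_le_of_lt ?_ h1
    have := (swap_ne i)
    simp only [Pi.add_apply, Pi.single_apply]
    split_ifs with h3 h4 <;> first | omega | exact absurd (h3.symm.trans h4) this
  refine ⟨?_, h2⟩
  rw [torusPart, evalLift_apply, lift_adPartialPow _ _ (hP.quad_mem _ _), h2]
  simp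

theorem torusPart_theta (hP : Params p m n t) (he : Even n) {s : ℕ} (hs : s ≠ 0)
    (r i : EvenIdx m) :
    torusPart hP i (theta he s r : hamEven F n p t →ₗ[F] wittEven F n p t) = 0 := by
  rw [torusPart, evalLift_apply, lift_theta _ _ _ (hP.quad_mem _ _),
    (torusPart_adPartialPow hP hs r i).2]
  simp

theorem torusPart_phi (hP : Params p m n t) (he : Even n) (s : ℕ) (r i : EvenIdx m) :
    torusPart hP i (phi he s r : hamEven F n p t →ₗ[F] wittEven F n p t) = 0 := by
  rw [torusPart, evalLift_apply, lift_phi _ _ _ (hP.quad_mem _ _), DH_topOdd_even he, mul_zero]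

theorem torusPart_gam (hP : Params p m n t) (he : Even n) (i : EvenIdx m) :
    torusPart hP i (gam he 1 : hamEven F n p t →ₗ[F] wittEven F n p t) = 0 := by
  rw [torusPart, evalLift_apply, lift_gam hP.topExp_ne_zero _ (hP.quad_mem _ _),
    DH_topOdd_even he, smul_zero]

theorem partialW_mem (i : EvenIdx m) : (partialW i : wittEven F n p t) ∈ wittGr F n p t (-1) := by
  refine mem_wittGr_iff.2 fun b => ?_
  change d (Sum.inl i) (coord F b) ∈ _
  rw [d_coord]
  split_ifs
  · have := mono_mem_homog (F := F) (0 : EvenIdx m → ℕ) (∅ : Finset (Fin n))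
    simpa [one_def] using this
  · exact zero_mem _

/-- The field of `x_i x_{i'}` scales `x_i` by `-τ(i)`, so `torusPart` is diagonal with invertible
entries on the inner derivations `ad ∂_a`. -/
theorem torusPart_adMap_partialW (hP : Params p m n t) (a i : EvenIdx m) :
    torusPart hP i (adMap F n p t (partialW a)) =
      if a = i then -tau F (Sum.inl i : Idx m n) • 1 else 0 := by
  rw [torusPart, evalLift_apply, lift_adMap _ (hP.quad_mem _ _)]
  change d (Sum.inl a) _ - DH _ (d (Sum.inl a) _) = _
  have e3 : DH (coord F (Sum.inl i) * coord F (Sum.inl i.swap))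
      (coord F (Sum.inl i) : O F m n) = - tau F (Sum.inl i : Idx m n) • coord F (Sum.inl i) := by
    simp [DH_quad, dEven_coord, tau_swap, (swap_ne i).symm]
  have e4 : DH (coord F (Sum.inl i) * coord F (Sum.inl i.swap))
      (d (Sum.inl a) (coord F (Sum.inl i)) : O F m n) = 0 := by
    refine DH_eq_zero_of_d (quad_mem_par _ _) fun j => ?_
    rw [d_coord]
    split_ifs
    · exact d_one j
    · exact map_zero _
  rw [e4, sub_zero, e3, map_smul, d_coord]
  simp only [Sum.inl.injEq]
  split_ifs <;> simp

theorem tau_mul_self (i : Idx m n) : tau F i * tau F i = 1 := by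
  rcases i with (i | i) | k <;> simp [tau]

/-- Subtracting an inner derivation removes the torus components. -/
theorem exists_sub_adMap (hP : Params p m n t) {k : ℤ} (hk : k ≤ -1)
    {D : hamEven F n p t →ₗ[F] wittEven F n p t} (hD : D ∈ derGr F n p t k) :
    ∃ v ∈ wittGr F n p t (-1), D - adMap F n p t v ∈ derGr F n p t k ∧
      ∀ i, torusPart hP i (D - adMap F n p t v) = 0 := by
  have hh : ∀ i, torusPart hP i D ∈ homog F m n (1 + k) := fun i =>
    (mem_derGr_iff.1 hD).2.quad_mem hP _ _ _
  set c : EvenIdx m → F := fun i =>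
    -(tau F (Sum.inl i : Idx m n) * coeff 0 ∅ (torusPart hP i D)) with hc
  have hv : ∑ i, c i • (partialW i : wittEven F n p t) ∈ wittGr F n p t (-1) :=
    sum_mem fun i _ => Submodule.smul_mem _ _ (partialW_mem i)
  refine ⟨_, hv, ?_, fun i => ?_⟩
  · refine sub_mem hD ?_
    by_cases hk1 : k = -1
    · subst hk1
      exact adMap_mem hv
    -- For `k < -1` the torus components have negative degree, so nothing is subtracted and the
    -- degree is preserved.
    · have : ∀ i, c i = 0 := fun i => by
        rw [hc]
        simp only [neg_eq_zero, mul_eq_zero]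
        refine Or.inr (coeff_of_homog (hh i) ?_)
        simp
        omega
      simp [this]
  · rw [map_sub, map_sum, map_sum]
    simp only [map_smul, torusPart_adMap_partialW]
    rw [Finset.sum_eq_single i (fun j _ hj => by rw [if_neg hj, smul_zero]) (by simp),
      if_pos rfl, smul_smul, hc]
    have e := eq_smul_one (hh i) (by omega)
    have h2 := tau_mul_self (F := F) (Sum.inl i : Idx m n)
    have h3 : -(tau F (Sum.inl i : Idx m n) * coeff 0 ∅ (torusPart hP i D)) *
        -tau F (Sum.inl i : Idx m n) = coeff 0 ∅ (torusPart hP i D) := by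
      linear_combination (coeff 0 ∅ (torusPart hP i D)) * h2
    rw [h3, ← e, sub_self]

end HamSuper

/-! ### Expansion of a normalized derivation and the final decomposition. -/

namespace HamSuper

variable {F : Type*} [Field F] {m n p : ℕ} {t : EvenIdx m → ℕ}
variable [Fact p.Prime] [CharP F p]

theorem Params.single_pow_le (hP : Params p m n t) {r : EvenIdx m} {s : ℕ}
    (hs : 1 ≤ s ∧ s ≤ t r - 1) : Pi.single r (p ^ s) ≤ topExp p t := fun j => by
  rcases eq_or_ne j r with rfl | h
  · have : p ^ s < p ^ t j :=
      Nat.pow_lt_pow_right (by have := hP.three_lt; omega) (by have := hP.pos j; omega)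
    simp only [Pi.single_eq_same, topExp]
    omega
  · simp [h]

theorem Params.single_pow_add_le (hP : Params p m n t) {r : EvenIdx m} {s : ℕ}
    (hs : 1 ≤ s ∧ s ≤ t r - 1) :
    Pi.single r (p ^ s) + Pi.single r.swap 1 ≤ topExp p t := fun j => by
  have h1 := hP.single_pow_le hs j
  have h2 := hP.single_le r.swap j
  rcases eq_or_ne j r with rfl | h
  · simpa [(swap_ne j).symm] using h1
  · simpa [h] using h2

theorem single_pow_add_eq {r i : EvenIdx m} {s s' : ℕ} :
    (Pi.single r (p ^ s) + Pi.single r.swap 1 : EvenIdx m → ℕ) =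
      Pi.single r.swap 1 + Pi.single i (p ^ s') ↔ r = i ∧ s = s' := by
  rw [add_comm, add_right_inj, single_pow_inj]

/-- A normalized derivation of negative degree with vanishing scalar invariants is zero. -/
theorem derGr_eq_zero (hP : Params p m n t) {k : ℤ} (hk : k ≤ -1)
    {D : hamEven F n p t →ₗ[F] wittEven F n p t} (hD : D ∈ derGr F n p t k)
    (h0 : ∀ i, torusPart hP i D = 0) (k₀ : Fin n)
    (h1 : ∀ r s, 1 ≤ s ∧ s ≤ t r - 1 →
      lam (lift D) (Sum.inl r) ∅ (Pi.single r (p ^ s) + Pi.single r.swap 1) = 0)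
    (h2 : ∀ r s, 1 ≤ s ∧ s ≤ t r - 1 →
      lam (lift D) (Sum.inl r) Finset.univ (Pi.single r (p ^ s) + Pi.single r.swap 1) = 0)
    (h3 : ∀ r s, 1 ≤ s ∧ s ≤ t r - 1 →
      lam (lift D) (Sum.inr k₀) (Finset.univ.erase k₀) (Pi.single r (p ^ s)) = 0)
    (h4 : lam (lift D) (Sum.inr k₀) (Finset.univ.erase k₀) (topExp p t) = 0) : D = 0 := by
  obtain ⟨hG, hH⟩ := mem_derGr_iff.1 hD
  obtain ⟨hK, hO⟩ := kills_of_degree hP hG hH hk h0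
  exact eq_zero_of_lift fun f hf => cocycle_eq_zero hP hG hK hO k₀ h1 h2 h3 h4 hf

/-- A nonzero scalar ties `k` to `β` and `u`. Hence only exceptional derivations of degree exactly
`k` occur in the expansion, and subtracting them keeps homogeneity. -/
theorem lam_degree {k : ℤ} {D : hamEven F n p t →ₗ[F] wittEven F n p t}
    (hD : D ∈ derGr F n p t k) {β : EvenIdx m → ℕ}
    (hm : (mono β ∅ : O F m n) ∈ hamPot F n p t) {b : Idx m n} {u : Finset (Fin n)}
    (h : lam (lift D) b u β ≠ 0) : (u.card : ℤ) = ((∑ i, β i : ℕ) : ℤ) - 1 + k := by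
  by_contra hne
  refine h (coeff_of_homog ((mem_derGr_iff.1 hD).2 _ _ hm b) ?_)
  simpa using hne

/-- The index set of the exceptional powers of the partial derivatives. -/
def powIdx (t : EvenIdx m → ℕ) : Finset (Σ _ : EvenIdx m, ℕ) :=
  Finset.univ.sigma fun r => Finset.Icc 1 (t r - 1)

theorem mem_powIdx {q : Σ _ : EvenIdx m, ℕ} : q ∈ powIdx t ↔ 1 ≤ q.2 ∧ q.2 ≤ t q.1 - 1 := by
  simp [powIdx]

/-- For odd `n`, normalized derivations are combinations of powers of partial derivatives. -/
theorem eq_sum_of_odd (hP : Params p m n t) (ho : Odd n) {k : ℤ} (hk : k ≤ -1)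
    {D : hamEven F n p t →ₗ[F] wittEven F n p t} (hD : D ∈ derGr F n p t k)
    (h0 : ∀ i, torusPart hP i D = 0) :
    ∃ a : (Σ _ : EvenIdx m, ℕ) → F, D = ∑ q ∈ powIdx t, a q • adPartialPow q.2 q.1 := by
  set κ : (Σ _ : EvenIdx m, ℕ) → F := fun q =>
    lam (lift D) (Sum.inl q.1) ∅ (Pi.single q.1 (p ^ q.2) + Pi.single q.1.swap 1) with hκ
  set a : (Σ _ : EvenIdx m, ℕ) → F := fun q =>
    κ q * tau F (Sum.inl q.1.swap : Idx m n) with ha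
  refine ⟨a, sub_eq_zero.1 ?_⟩
  set E := D - ∑ q ∈ powIdx t, a q • adPartialPow q.2 q.1 with hE
  have hEd : E ∈ derGr F n p t k := by
    refine sub_mem hD (sum_mem fun q hq => ?_)
    by_cases hz : κ q = 0
    · rw [ha]
      simp [hz]
    · have := lam_degree hD (hP.pure_mem (hP.single_pow_add_le (mem_powIdx.1 hq))) hz
      have e : k = -(p : ℤ) ^ q.2 := by
        simp only [Finset.card_empty, Pi.add_apply, Finset.sum_add_distrib,
          Finset.sum_pi_single', Finset.mem_univ, if_true] at this
        push_cast at this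
        linarith
      rw [e]
      exact Submodule.smul_mem _ _ (adPartialPow_mem _ _)
  have hn0 : 0 < n := by have := hP.three_lt_odd; omega
  have hu : ((Finset.univ : Finset (Fin n)).card : ZMod 2) = 1 := by
    rw [Finset.card_univ, Fintype.card_fin]
    exact ZMod.natCast_eq_one_iff_odd.2 ho
  have hu' : ((Finset.univ.erase (⟨0, hn0⟩ : Fin n)).card : ZMod 2) = 0 := by
    rw [Finset.card_erase_of_mem (Finset.mem_univ _), Finset.card_univ, Fintype.card_fin]
    exact ZMod.natCast_eq_zero_iff_even.2 (Nat.Odd.sub_odd ho odd_one)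
  have hmem := (mem_derGr_iff.1 hEd).1.mem
  refine derGr_eq_zero hP hk hEd (fun i => ?_) ⟨0, hn0⟩ (fun r s hs => ?_) (fun r s hs => ?_)
    (fun r s hs => ?_) ?_
  · rw [hE, map_sub, map_sum, h0, zero_sub, neg_eq_zero]
    refine Finset.sum_eq_zero fun q hq => ?_
    rw [map_smul, (torusPart_adPartialPow hP (by have := mem_powIdx.1 hq; omega) _ _).1, smul_zero]
  · have hm := hP.pure_mem (F := F) (hP.single_pow_add_le hs)
    have hq : (⟨r, s⟩ : Σ _ : EvenIdx m, ℕ) ∈ powIdx t := mem_powIdx.2 hs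
    rw [← lamL_apply hm, hE, map_sub, map_sum, Finset.sum_eq_single_of_mem _ hq]
    · rw [map_smul, lamL_apply, lamL_apply, lam_adPartialPow_even hm,
        if_pos ⟨single_pow_add_eq.2 ⟨rfl, rfl⟩, rfl⟩, smul_eq_mul, ha]
      simp only [mul_assoc, tau_mul_self, mul_one, hκ, sub_self]
    · rintro ⟨r', s'⟩ - hne
      rw [map_smul, lamL_apply, lam_adPartialPow_even hm, if_neg, smul_zero]
      rintro ⟨h, -⟩
      obtain ⟨rfl, rfl⟩ := single_pow_add_eq.1 h
      exact hne rfl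
  -- For odd `n` the sets `ω` and `ω∖k₀` have the wrong parity for even and odd directions
  -- respectively, so the remaining invariants vanish.
  · refine coeff_coord_eq_zero (hmem _ (hP.pure_mem (hP.single_pow_add_le hs))) ?_
    rw [hu]
    simp [mu]
  · refine coeff_coord_eq_zero (hmem _ (hP.pure_mem (hP.single_pow_le hs))) ?_
    rw [hu']
    simp [mu]
  · refine coeff_coord_eq_zero (hmem _ (hP.pure_mem le_rfl)) ?_
    rw [hu']
    simp [mu]

set_option maxHeartbeats 1600000 in
/-- For even `n`, normalized derivations are combinations of the exceptional ones. -/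
theorem eq_sum_of_even (hP : Params p m n t) (he : Even n) {k : ℤ} (hk : k ≤ -1)
    {D : hamEven F n p t →ₗ[F] wittEven F n p t} (hD : D ∈ derGr F n p t k)
    (h0 : ∀ i, torusPart hP i D = 0) :
    ∃ (a b c : (Σ _ : EvenIdx m, ℕ) → F) (g : F),
      D = g • gam he 1 +
        (∑ q ∈ powIdx t, (b q • phi he q.2 q.1 + c q • theta he q.2 q.1) +
          ∑ q ∈ powIdx t, a q • adPartialPow q.2 q.1) ∧
      (g ≠ 0 → n < ∑ i, topExp p t i) ∧
      ∀ q ∈ powIdx t, b q ≠ 0 ∨ c q ≠ 0 → (n : ℤ) - (p : ℤ) ^ q.2 < 0 := by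
  have hn0 : 0 < n := by have := hP.three_lt_odd; omega
  set k₀ : Fin n := ⟨0, hn0⟩
  have hcard : ((Finset.univ.erase k₀).card : ℤ) = n - 1 := by
    rw [Finset.card_erase_of_mem (Finset.mem_univ _), Finset.card_univ, Fintype.card_fin]
    omega
  -- The sign in the `k₀`-component of `D_H(x^ω)`; it is its own inverse.
  set σ : F := sgn F {k₀} Finset.univ
  have hσ : σ * σ = 1 := sgn_sq _ _
  set κ : Finset (Fin n) → (Σ _ : EvenIdx m, ℕ) → F := fun u q =>
    lam (lift D) (Sum.inl q.1) u (Pi.single q.1 (p ^ q.2) + Pi.single q.1.swap 1) with hκ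
  set a : Finset (Fin n) → (Σ _ : EvenIdx m, ℕ) → F := fun u q =>
    κ u q * tau F (Sum.inl q.1.swap : Idx m n) with ha
  set ν : (EvenIdx m → ℕ) → F := fun β =>
    lam (lift D) (Sum.inr k₀) (Finset.univ.erase k₀) β with hν
  have hdeg : ∀ q ∈ powIdx t, ∀ u, κ u q ≠ 0 → k = u.card - (p : ℤ) ^ q.2 := fun q hq u hz => by
    have := lam_degree hD (hP.pure_mem (hP.single_pow_add_le (mem_powIdx.1 hq))) hz
    simp only [Pi.add_apply, Finset.sum_add_distrib, Finset.sum_pi_single', Finset.mem_univ,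
      if_true] at this
    push_cast at this
    linarith
  have hdeg' : ∀ q ∈ powIdx t, ν (Pi.single q.1 (p ^ q.2)) ≠ 0 → k = n - (p : ℤ) ^ q.2 :=
    fun q hq hz => by
      have := lam_degree hD (hP.pure_mem (hP.single_pow_le (mem_powIdx.1 hq))) hz
      rw [hcard] at this
      simp only [Finset.sum_pi_single', Finset.mem_univ, if_true] at this
      push_cast at this
      linarith
  have hdegG : ν (topExp p t) ≠ 0 → k = n - (∑ i, topExp p t i : ℕ) := fun hz => by
    have := lam_degree hD (hP.pure_mem le_rfl) hz
    rw [hcard] at this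
    linarith
  refine ⟨a ∅, fun q => ν (Pi.single q.1 (p ^ q.2)) * σ, a Finset.univ, ν (topExp p t) * σ,
    sub_eq_zero.1 ?_, fun h => ?_, fun q hq h => ?_⟩
  · set E := D - (_ + _) with hE
    have hEd : E ∈ derGr F n p t k := by
      refine sub_mem hD (add_mem ?_ (add_mem (sum_mem fun q hq => add_mem ?_ ?_)
        (sum_mem fun q hq => ?_)))
      · by_cases hz : ν (topExp p t) = 0
        · simp [hz]
        · rw [hdegG hz]
          exact Submodule.smul_mem _ _ (gam_mem hP.topExp_ne_zero he)
      · by_cases hz : ν (Pi.single q.1 (p ^ q.2)) = 0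
        · simp [hz]
        · rw [hdeg' q hq hz]
          exact Submodule.smul_mem _ _ (phi_mem he _ _)
      · by_cases hz : κ Finset.univ q = 0
        · simp [ha, hz]
        · rw [hdeg q hq _ hz, Finset.card_univ, Fintype.card_fin]
          exact Submodule.smul_mem _ _ (theta_mem he _ _)
      · by_cases hz : κ ∅ q = 0
        · simp [ha, hz]
        · rw [hdeg q hq _ hz, Finset.card_empty, Nat.cast_zero, zero_sub]
          exact Submodule.smul_mem _ _ (adPartialPow_mem _ _)
    have hne : ∀ {r s} {q : Σ _ : EvenIdx m, ℕ}, q ≠ ⟨r, s⟩ → ¬(r = q.1 ∧ s = q.2) := by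
      rintro r s q hq ⟨rfl, rfl⟩
      exact hq rfl
    -- To each scalar invariant only one of the subtracted families contributes, and where a pair
    -- `(r, s)` is fixed, only the index `(r, s)` of that family.
    refine derGr_eq_zero hP hk hEd (fun i => ?_) k₀ (fun r s hs => ?_) (fun r s hs => ?_)
      (fun r s hs => ?_) ?_
    · have hs : ∀ q ∈ powIdx t, q.2 ≠ 0 := fun q hq => by have := mem_powIdx.1 hq; omega
      rw [hE, map_sub, map_add, map_add, map_sum, map_sum, h0, map_smul, torusPart_gam hP,
        Finset.sum_eq_zero fun q hq => ?_, Finset.sum_eq_zero fun q hq => ?_]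
      · simp
      · rw [map_smul, (torusPart_adPartialPow hP (hs q hq) _ _).1, smul_zero]
      · rw [map_add, map_smul, map_smul, torusPart_phi hP, torusPart_theta hP _ (hs q hq),
          smul_zero, smul_zero, add_zero]
    · have hm := hP.pure_mem (F := F) (hP.single_pow_add_le hs)
      have hq : (⟨r, s⟩ : Σ _ : EvenIdx m, ℕ) ∈ powIdx t := mem_powIdx.2 hs
      rw [← lamL_apply hm, hE, map_sub, map_add, map_add, map_sum, map_sum, map_smul, lamL_apply,
        lamL_apply, lam_gam_even hm hP, Finset.sum_eq_zero fun q _ => ?_,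
        Finset.sum_eq_single_of_mem _ hq fun q _ hqne => ?_]
      · rw [map_smul, lamL_apply, lam_adPartialPow_even hm,
          if_pos ⟨single_pow_add_eq.2 ⟨rfl, rfl⟩, rfl⟩, ha]
        simp only [smul_eq_mul, mul_assoc, tau_mul_self, hκ]
        ring
      · rw [map_smul, lamL_apply, lam_adPartialPow_even hm, if_neg, smul_zero]
        exact fun h => hne hqne (single_pow_add_eq.1 h.1)
      · rw [map_add, map_smul, map_smul, lamL_apply, lamL_apply, lam_phi_even hm,
          lam_theta_even hm, if_neg (fun h => hP.univ_ne h.2), smul_zero, smul_zero, add_zero]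
    · have hm := hP.pure_mem (F := F) (hP.single_pow_add_le hs)
      have hq : (⟨r, s⟩ : Σ _ : EvenIdx m, ℕ) ∈ powIdx t := mem_powIdx.2 hs
      rw [← lamL_apply hm, hE, map_sub, map_add, map_add, map_sum, map_sum, map_smul, lamL_apply,
        lamL_apply, lam_gam_even hm hP, Finset.sum_eq_single_of_mem _ hq fun q _ hqne => ?_,
        Finset.sum_eq_zero fun q _ => ?_]
      · rw [map_add, map_smul, map_smul, lamL_apply, lamL_apply, lam_phi_even hm,
          lam_theta_even hm, if_pos ⟨single_pow_add_eq.2 ⟨rfl, rfl⟩, rfl⟩, ha]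
        simp only [smul_eq_mul, mul_assoc, tau_mul_self, hκ]
        ring
      · rw [map_smul, lamL_apply, lam_adPartialPow_even hm, if_neg (fun h => hP.univ_ne h.2),
          smul_zero]
      · rw [map_add, map_smul, map_smul, lamL_apply, lamL_apply, lam_phi_even hm,
          lam_theta_even hm, if_neg, smul_zero, smul_zero, add_zero]
        exact fun h => hne hqne (single_pow_add_eq.1 h.1)
    · have hm := hP.pure_mem (F := F) (hP.single_pow_le hs)
      have hq : (⟨r, s⟩ : Σ _ : EvenIdx m, ℕ) ∈ powIdx t := mem_powIdx.2 hs
      rw [← lamL_apply hm, hE, map_sub, map_add, map_add, map_sum, map_sum, map_smul, lamL_apply,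
        lamL_apply, lam_gam_odd hm hP, if_neg (hP.topExp_ne_single _ _).symm,
        Finset.sum_eq_single_of_mem _ hq fun q _ hqne => ?_, Finset.sum_eq_zero fun q _ => ?_]
      · rw [map_add, map_smul, map_smul, lamL_apply, lamL_apply, lam_phi_odd hm,
          lam_theta_odd hm, if_pos rfl]
        simp only [smul_eq_mul, mul_assoc, hν]
        change _ - (_ + (_ * (σ * σ) + _ + _)) = _
        rw [hσ]
        ring
      · rw [map_smul, lamL_apply, lam_adPartialPow_odd hm _ _ hP.univ_ne, smul_zero]
      · rw [map_add, map_smul, map_smul, lamL_apply, lamL_apply, lam_phi_odd hm,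
          lam_theta_odd hm, if_neg, smul_zero, smul_zero, add_zero]
        exact fun h => hne hqne (single_pow_inj.1 h)
    · have hm := hP.pure_mem (F := F) (n := n) (t := t) le_rfl
      rw [← lamL_apply hm, hE, map_sub, map_add, map_add, map_sum, map_sum, map_smul, lamL_apply,
        lamL_apply, lam_gam_odd hm hP, if_pos rfl, Finset.sum_eq_zero fun q _ => ?_,
        Finset.sum_eq_zero fun q _ => ?_]
      · change ν _ - (ν _ * σ * σ + _) = 0
        rw [mul_assoc, hσ]
        ring
      · rw [map_smul, lamL_apply, lam_adPartialPow_odd hm _ _ hP.univ_ne, smul_zero]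
      · rw [map_add, map_smul, map_smul, lamL_apply, lamL_apply, lam_phi_odd hm,
          lam_theta_odd hm, if_neg (hP.topExp_ne_single _ _), smul_zero, smul_zero, add_zero]
  -- The degree equation `k = n - |π|` together with `k ≤ -1` yields the bound; the bounds for `Φ`
  -- and `Θ` arise in the same way.
  · have := hdegG (left_ne_zero_of_mul h)
    omega
  · rcases h with h | h
    · have := hdeg' q hq (left_ne_zero_of_mul h)
      linarith
    · have := hdeg q hq _ (left_ne_zero_of_mul h)
      rw [Finset.card_univ, Fintype.card_fin] at this
      linarith

theorem derGr_le_derNeg {k : ℤ} (hk : k ≤ -1) : derGr F n p t k ≤ derNeg F n p t :=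
  le_iSup₂_of_le (f := fun (k : ℤ) (_ : k ≤ -1) => derGr F n p t k) k hk le_rfl

theorem map_adMap_le : (wittGr F n p t (-1)).map (adMap F n p t) ≤ derNeg F n p t := by
  rintro _ ⟨v, hv, rfl⟩
  exact derGr_le_derNeg le_rfl (adMap_mem hv)

theorem iSup_adPartialPow_le :
    (⨆ r : EvenIdx m, ⨆ s ∈ Finset.Icc 1 (t r - 1),
      Submodule.span F {(adPartialPow s r : hamEven F n p t →ₗ[F] wittEven F n p t)}) ≤
      derNeg F n p t := by
  refine iSup_le fun r => iSup₂_le fun s _ => ?_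
  rw [Submodule.span_singleton_le_iff_mem]
  refine derGr_le_derNeg ?_ (adPartialPow_mem s r)
  have : 0 < (p : ℤ) ^ s := pow_pos (by exact_mod_cast (Fact.out : p.Prime).pos) s
  omega

theorem sum_adPartialPow_mem (a : (Σ _ : EvenIdx m, ℕ) → F) :
    (∑ q ∈ powIdx t, a q • adPartialPow q.2 q.1 :
      hamEven F n p t →ₗ[F] wittEven F n p t) ∈
      ⨆ r : EvenIdx m, ⨆ s ∈ Finset.Icc 1 (t r - 1),
        Submodule.span F {(adPartialPow s r : hamEven F n p t →ₗ[F] wittEven F n p t)} := by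
  refine sum_mem fun q hq => Submodule.smul_mem _ _ ?_
  refine Submodule.mem_iSup_of_mem q.1 (Submodule.mem_iSup_of_mem q.2
    (Submodule.mem_iSup_of_mem ?_ (Submodule.mem_span_singleton_self _)))
  exact Finset.mem_Icc.2 (mem_powIdx.1 hq)

theorem derNeg_of_odd (hP : Params p m n t) (ho : Odd n) :
    derNeg F n p t = (wittGr F n p t (-1)).map (adMap F n p t) ⊔
      (⨆ r : EvenIdx m, ⨆ s ∈ Finset.Icc 1 (t r - 1), Submodule.span F {adPartialPow s r}) := by
  refine le_antisymm (iSup₂_le fun k hk D hD => ?_) (sup_le map_adMap_le iSup_adPartialPow_le)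
  obtain ⟨v, hv, hDv, h0⟩ := exists_sub_adMap hP hk hD
  obtain ⟨a, h⟩ := eq_sum_of_odd hP ho hk hDv h0
  rw [← add_sub_cancel (adMap F n p t v) D, h]
  exact Submodule.add_mem_sup ⟨v, hv, rfl⟩ (sum_adPartialPow_mem a)

/-- The conditions `n - p^s < 0` and `|π| > n` make `Φ`, `Θ` and `Γ` derivations of negative degree.
In the other inclusion they come for free, since a nonzero coefficient forces that degree to be `k`.
-/
theorem derNeg_of_even (hP : Params p m n t) (he : Even n) :
    derNeg F n p t =
      (wittGr F n p t (-1)).map (adMap F n p t) ⊔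
      Submodule.span F {if n < ∑ i, topExp p t i then gam he 1 else 0} ⊔
      (⨆ r : EvenIdx m, ⨆ s ∈ {s : ℕ | 1 ≤ s ∧ s ≤ t r - 1 ∧ (n : ℤ) - (p : ℤ) ^ s < 0},
        Submodule.span F {phi he s r} ⊔ Submodule.span F {theta he s r}) ⊔
      (⨆ r : EvenIdx m, ⨆ s ∈ Finset.Icc 1 (t r - 1), Submodule.span F {adPartialPow s r}) := by
  refine le_antisymm (iSup₂_le fun k hk D hD => ?_)
    (sup_le (sup_le (sup_le map_adMap_le ?_) ?_) iSup_adPartialPow_le)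
  · obtain ⟨v, hv, hDv, h0⟩ := exists_sub_adMap hP hk hD
    obtain ⟨a, b, c, g, h, hg, hbc⟩ := eq_sum_of_even hP he hk hDv h0
    rw [← add_sub_cancel (adMap F n p t v) D, h, ← add_assoc, ← add_assoc]
    refine Submodule.add_mem_sup (Submodule.add_mem_sup
      (Submodule.add_mem_sup ⟨v, hv, rfl⟩ ?_) ?_) (sum_adPartialPow_mem a)
    · by_cases hz : g = 0
      · rw [hz, zero_smul]
        exact zero_mem _
      · rw [if_pos (hg hz)]
        exact Submodule.smul_mem _ _ (Submodule.mem_span_singleton_self _)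
    · refine sum_mem fun q hq => ?_
      by_cases hz : b q ≠ 0 ∨ c q ≠ 0
      · have hs := mem_powIdx.1 hq
        refine Submodule.mem_iSup_of_mem q.1 (Submodule.mem_iSup_of_mem q.2
          (Submodule.mem_iSup_of_mem ⟨hs.1, hs.2, hbc q hq hz⟩ (Submodule.add_mem_sup ?_ ?_))) <;>
        exact Submodule.smul_mem _ _ (Submodule.mem_span_singleton_self _)
      · push Not at hz
        rw [hz.1, hz.2, zero_smul, zero_smul, add_zero]
        exact zero_mem _
  · rw [Submodule.span_singleton_le_iff_mem]
    split_ifs with h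
    · exact derGr_le_derNeg (by omega) (gam_mem hP.topExp_ne_zero he)
    · exact zero_mem _
  · refine iSup_le fun r => iSup₂_le fun s hs => ?_
    have hk : (n : ℤ) - (p : ℤ) ^ s ≤ -1 := by have := hs.2.2; omega
    rw [sup_le_iff, Submodule.span_singleton_le_iff_mem, Submodule.span_singleton_le_iff_mem]
    exact ⟨derGr_le_derNeg hk (phi_mem he s r), derGr_le_derNeg hk (theta_mem he s r)⟩

end HamSuper

theorem mainTheorem4 (F : Type*) [Field F] (p : ℕ) [Fact p.Prime] [CharP F p] (hp : 3 < p)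
    (m n : ℕ) (hm : 1 < m) (hn : 3 < n) (t : EvenIdx m → ℕ) (ht : ∀ i, 0 < t i) :
    (∀ he : Even n,
      derNeg F n p t =
        (wittGr F n p t (-1)).map (adMap F n p t) ⊔
        Submodule.span F {if n < ∑ i, topExp p t i then gam he 1 else 0} ⊔
        (⨆ r : EvenIdx m, ⨆ s ∈ {s : ℕ | 1 ≤ s ∧ s ≤ t r - 1 ∧ (n : ℤ) - (p : ℤ) ^ s < 0},
          Submodule.span F {phi he s r} ⊔ Submodule.span F {theta he s r}) ⊔
        (⨆ r : EvenIdx m, ⨆ s ∈ Finset.Icc 1 (t r - 1), Submodule.span F {adPartialPow s r})) ∧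
    (Odd n →
      derNeg F n p t =
        (wittGr F n p t (-1)).map (adMap F n p t) ⊔
        (⨆ r : EvenIdx m, ⨆ s ∈ Finset.Icc 1 (t r - 1), Submodule.span F {adPartialPow s r})) := by
  have hP : Params p m n t := ⟨hp, hm, hn, ht⟩
  exact ⟨fun he => derNeg_of_even hP he, fun ho => derNeg_of_odd hP ho⟩
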